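/- Let $d\ge 1$, let $\Omega=C_0([0,1];\mathbb R^d)$ be the space of continuous paths $\gamma$ with $\gamma(0)=0$, with the topology of uniform convergence and its Borel $\sigma$-algebra, and let $\nu$ be the Wiener measure on $\Omega$. Let $Z$ be the space of cylindrical functions $F(\gamma)=f(\gamma(s_1),\dots,\gamma(s_k))$, $k\ge 1$, $0<s_1<\dots<s_k=1$, where $f:(\mathbb R^d)^k\to\mathbb R$ is smooth and $f$ and all its derivatives have at most polynomial growth. For $F\in Z$ put $$D_sF(\gamma)=\sum_{i=1}^k (s_i\wedge s)\,(\nabla_{s_i}f)(\gamma(s_1),\dots,\gamma(s_k)),\qquad s\in[0,1],$$ where $\nabla_{s_i}f$ is the gradient of $f$ in its $i$-th variable. Let $\mathbb H$ be the Cameron–Martin space with $\langle h_1,h_2\rangle_{\mathbb H}=\int_0^1\langle h_1'(x),h_2'(x)\rangle_{\mathbb R^d}\,dx$. Let $H_1=1$ and, for $m\ge 0$, $1\le k\le 2^m$, let $H_{2^m+k}$ be the Haar function equal to $2^{m/2}$ on $[\frac{k-1}{2^m},\frac{2k-1}{2^{m+1}})$, to $-2^{m/2}$ on $[\frac{2k-1}{2^{m+1}},\frac{k}{2^m})$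 and to $0$ elsewhere; let $g_{d(r-1)+j}=H_r e_j$ ($r\ge1$, $1\le j\le d$), with $(e_j)$ the standard basis of $\mathbb R^d$, and $S_n(s)=\int_0^s g_n(u)\,du$, $n\ge 1$. Let $0<\lambda_1\le\lambda_2\le\cdots$, and let $\varphi:\Omega\to\mathbb R$ be measurable with $0<\varphi\le C$ $\nu$-a.e. for some constant $C$, and $$\frac F\varphi\in L^1(\nu)\qquad\text{for all }F\in Z.$$ Assume moreover that $$\sum_{p=1}^\infty\frac{\lambda_{i_{p,j}}}{2^p}<\infty\quad\text{for all }j\in\{1,\dots,d\},\qquad i_{p,j}=2^{p-1}(d+j-1)+1+\sum_{q=0}^{p-1}c_q2^{p-q-1},$$ for some sequence $c_0=0$, $c_1,c_2,\dots\in\{0,1\}$. Then for $$\mathcal E(F,G)=\sum_{n=1}^\infty\lambda_n\int\langle S_n,DF\rangle_{\mathbb H}\langle S_n,DG\rangle_{\mathbb H}\,\varphi\,d\nu,\qquad F,G\in Z,$$ the series and the integrals defining $\mathcal E(F,F)$ converge for every $F\in Z$, the form $(\mathcal E,Z)$ is closable on $L^2(\varphi\nu)$, and its closure is a symmetric Dirichlet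 form on $L^2(\varphi\nu)$ that is quasi-regular: (i) there is an $\mathcal E$-nest of compact sets; (ii) a subset of the domain, dense in the norm $(\mathcal E(u,u)+\|u\|_{L^2(\varphi\nu)}^2)^{1/2}$, consists of elements with $\mathcal E$-quasi-continuous versions; (iii) countably many elements of the domain have $\mathcal E$-quasi-continuous versions that separate the points of $\Omega\setminus N$ for some $\mathcal E$-exceptional set $N$. -/

import Mathlib

open MeasureTheory ProbabilityTheory Filter Topology

noncomputable section

/-! ### Symmetric Dirichlet forms on `L²(m)` and quasi-regularity -/

namespace DirForm

variable {X : Type*} [MeasurableSpace X]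

/-- A symmetric non-negative definite bilinear form on a linear subspace `dom` of `L²(m)`. -/
structure SymmForm (m : Measure X) where
  dom : Submodule ℝ (Lp ℝ 2 m)
  form : LinearMap.BilinForm ℝ dom
  symm : ∀ u v, form u v = form v u
  nonneg : ∀ u, 0 ≤ form u u

namespace SymmForm

variable {m : Measure X} (ℰ : SymmForm m)

/-- `ℰ₁(u,u) = ℰ(u,u) + ‖u‖²`. -/
def E1 (u : ℰ.dom) : ℝ := ℰ.form u u + ‖(u : Lp ℝ 2 m)‖ ^ 2

/-- The domain is complete with respect to the norm `ℰ₁^{1/2}`. -/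
def IsClosedForm : Prop :=
  ∀ u : ℕ → ℰ.dom, (∀ ε > 0, ∃ N, ∀ k ≥ N, ∀ l ≥ N, ℰ.E1 (u k - u l) < ε) →
    ∃ v : ℰ.dom, Tendsto (fun n => ℰ.E1 (u n - v)) atTop (𝓝 0)

/-- A set of elements of the domain is dense with respect to the norm `ℰ₁^{1/2}`. -/
def IsE1Dense (A : Set ℰ.dom) : Prop := ∀ u : ℰ.dom, ∀ ε > 0, ∃ v ∈ A, ℰ.E1 (u - v) < ε

/-- A symmetric Dirichlet form: densely defined, closed, and the unit contraction
`u ↦ u⁺ ∧ 1` operates. -/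
structure IsDirichletForm : Prop where
  dense : Dense (ℰ.dom : Set (Lp ℝ 2 m))
  closed : ℰ.IsClosedForm
  markov : ∀ u : ℰ.dom, ∃ v : ℰ.dom,
    ((v : Lp ℝ 2 m) =ᵐ[m] fun x => min (max ((u : Lp ℝ 2 m) x) 0) 1) ∧ ℰ.form v v ≤ ℰ.form u u

/-- `ℰ` is the closure on `L²(m)` of the form `q`, given on a set `Z` of functions:
`ℰ` extends `(q, Z)`, is closed, and (the classes of) the elements of `Z` are `ℰ₁`-dense. -/
structure IsClosureOf (Z : Set (X → ℝ)) (q : (X → ℝ) → (X → ℝ) → ℝ) : Prop where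
  mem_dom : ∀ F ∈ Z, ∃ u : ℰ.dom, (u : Lp ℝ 2 m) =ᵐ[m] F
  form_eq : ∀ F ∈ Z, ∀ G ∈ Z, ∀ u v : ℰ.dom, (u : Lp ℝ 2 m) =ᵐ[m] F → (v : Lp ℝ 2 m) =ᵐ[m] G →
    ℰ.form u v = q F G
  closed : ℰ.IsClosedForm
  dense : ℰ.IsE1Dense {u | ∃ F ∈ Z, (u : Lp ℝ 2 m) =ᵐ[m] F}

variable [TopologicalSpace X]

/-- An `ℰ`-nest: an increasing sequence of closed sets `K k` such that the elements of the domain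
vanishing `m`-a.e. outside one of the `K k` are `ℰ₁`-dense. -/
structure IsNest (K : ℕ → Set X) : Prop where
  closed : ∀ k, IsClosed (K k)
  mono : Monotone K
  dense : ℰ.IsE1Dense {u | ∃ k, ∀ᵐ x ∂m, x ∉ K k → (u : Lp ℝ 2 m) x = 0}

/-- An `ℰ`-exceptional set. -/
def IsExceptional (N : Set X) : Prop := ∃ K, ℰ.IsNest K ∧ N ⊆ ⋂ k, (K k)ᶜ

/-- An `ℰ`-quasi-continuous function. -/
def IsQuasiContinuous (f : X → ℝ) : Prop := ∃ K, ℰ.IsNest K ∧ ∀ k, ContinuousOn f (K k)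

/-- Quasi-regularity: there is an `ℰ`-nest of compact sets; an `ℰ₁`-dense subset of the
domain consists of elements with quasi-continuous versions; and countably many elements of the
domain have quasi-continuous versions that separate the points off an exceptional set. -/
structure IsQuasiRegular : Prop where
  compact_nest : ∃ K, ℰ.IsNest K ∧ ∀ k, IsCompact (K k)
  dense_quasiContinuous : ∃ A : Set ℰ.dom, ℰ.IsE1Dense A ∧
    ∀ u ∈ A, ∃ f, ℰ.IsQuasiContinuous f ∧ (u : Lp ℝ 2 m) =ᵐ[m] f
  separating : ∃ (u : ℕ → ℰ.dom) (f : ℕ → X → ℝ) (N : Set X), ℰ.IsExceptional N ∧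
    (∀ n, ℰ.IsQuasiContinuous (f n) ∧ (u n : Lp ℝ 2 m) =ᵐ[m] f n) ∧
    ∀ x ∉ N, ∀ y ∉ N, x ≠ y → ∃ n, f n x ≠ f n y

end SymmForm

/-- Closability on `L²(m)` of a form `q` on a linear space `Z` of functions. -/
def IsClosable (m : Measure X) (Z : Set (X → ℝ)) (q : (X → ℝ) → (X → ℝ) → ℝ) : Prop :=
  ∀ F : ℕ → X → ℝ, (∀ n, F n ∈ Z) → Tendsto (fun n => eLpNorm (F n) 2 m) atTop (𝓝 0) →
    (∀ ε > 0, ∃ N, ∀ k ≥ N, ∀ l ≥ N, q (F k - F l) (F k - F l) < ε) →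
    Tendsto (fun n => q (F n) (F n)) atTop (𝓝 0)

end DirForm

/-! ### The form on Wiener space -/

namespace WienerForm

/-- `ℝ^d` with its Euclidean norm. -/
abbrev E (d : ℕ) : Type := EuclideanSpace ℝ (Fin d)

/-- The continuous paths `γ : [0,1] → ℝ^d` with `γ(0) = 0`, as a subspace of `C([0,1]; ℝ^d)`
with the supremum norm. -/
def paths (d : ℕ) : Submodule ℝ C(unitInterval, E d) where
  carrier := {γ | γ 0 = 0}
  add_mem' := by
    intro a b ha hb
    simp only [Set.mem_ofPred_eq] at *
    simp [ha, hb]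
  zero_mem' := by simp
  smul_mem' := by
    intro c a ha
    simp only [Set.mem_ofPred_eq] at *
    simp [ha]

/-- The space `Ω = C₀([0,1]; ℝ^d)`. -/
abbrev Omega (d : ℕ) : Type := paths d

instance (d : ℕ) : MeasurableSpace (Omega d) := borel _

instance (d : ℕ) : BorelSpace (Omega d) := ⟨rfl⟩

/-- `ν` is the Wiener measure on `Ω`: under `ν` the coordinate process has independent increments,
and `γ(t) - γ(s)` has law `N(0, (t - s) I_d)`. -/
structure IsWienerMeasure {d : ℕ} (ν : Measure (Omega d)) : Prop where
  prob : IsProbabilityMeasure ν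
  indep : HasIndepIncrements (fun (t : unitInterval) (γ : Omega d) => γ.1 t) ν
  gauss : ∀ s t : unitInterval, s ≤ t →
    ν.map (fun γ : Omega d => γ.1 t - γ.1 s) =
      (stdGaussian (E d)).map (fun x => √((t : ℝ) - (s : ℝ)) • x)

/-- A representation `γ ↦ f (γ(t₀), …, γ(t_k))`, `0 < t₀ < … < t_k = 1`, of a cylindrical function,
where `f` is smooth and `f` and all its derivatives have at most polynomial growth. -/
structure CylRep (d : ℕ) where
  k : ℕ
  t : Fin (k + 1) → unitInterval
  t_pos : 0 < t 0
  t_strictMono : StrictMono t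
  t_last : t (Fin.last k) = 1
  f : (Fin (k + 1) → E d) → ℝ
  f_smooth : f.HasTemperateGrowth

namespace CylRep

variable {d : ℕ} (R : CylRep d)

/-- The vector `(γ(t₀), …, γ(t_k))`. -/
def pt (γ : Omega d) : Fin (R.k + 1) → E d := fun i => γ.1 (R.t i)

/-- The cylindrical function represented by `R`. -/
def toFun (γ : Omega d) : ℝ := R.f (R.pt γ)

/-- The gradient of `f` with respect to its `i`-th variable, the others being held fixed. -/
def partialGrad (i : Fin (R.k + 1)) (x : Fin (R.k + 1) → E d) : E d :=
  gradient (fun y => R.f (Function.update x i y)) (x i)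

/-- `D_s F(γ) = ∑ᵢ (tᵢ ∧ s) (∇_{tᵢ} f)(γ)`. -/
def grad (γ : Omega d) (s : ℝ) : E d :=
  ∑ i, min (R.t i : ℝ) s • R.partialGrad i (R.pt γ)

end CylRep

/-- The space `Z` of cylindrical functions. -/
def Z (d : ℕ) : Set (Omega d → ℝ) := Set.range CylRep.toFun

open Classical in
/-- The gradient `D_s F(γ)` of a cylindrical function, computed from any of its representations
(see `D_toFun`); it is `0` by convention if `F` is not cylindrical. -/
def D {d : ℕ} (F : Omega d → ℝ) (γ : Omega d) (s : ℝ) : E d :=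
  if h : ∃ R : CylRep d, R.toFun = F then h.choose.grad γ s else 0

/-- The path `u ↦ (s ∧ u) v`. -/
def ray {d : ℕ} (s : unitInterval) (v : E d) : Omega d :=
  ⟨⟨fun u => min (s : ℝ) (u : ℝ) • v, by fun_prop⟩, by
    show min (s : ℝ) ((0 : unitInterval) : ℝ) • v = 0
    simp [s.2.1]⟩

theorem CylRep.hasDerivAt_toFun {d : ℕ} (R : CylRep d) (γ : Omega d) (s : unitInterval) (v : E d) :
    HasDerivAt (fun r : ℝ => R.toFun (γ + r • ray s v)) (inner ℝ (R.grad γ s) v) 0 := by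
  classical
  have hf : Differentiable ℝ R.f := R.f_smooth.1.differentiable (by simp)
  set x := R.pt γ with hx
  set w : Fin (R.k + 1) → E d := fun i => min (R.t i : ℝ) s • v with hw
  have hpart : ∀ i, inner ℝ (R.partialGrad i x) v = fderiv ℝ R.f x (Pi.single i v) := by
    intro i
    have h1 : HasFDerivAt (fun y => R.f (Function.update x i y))
        ((fderiv ℝ R.f x).comp (ContinuousLinearMap.pi (Pi.single i (.id ℝ (E d))))) (x i) := by
      refine HasFDerivAt.comp (x i) ?_ (hasFDerivAt_update x (x i))
      rw [Function.update_eq_self]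
      exact (hf x).hasFDerivAt
    have h2 : (R.partialGrad i x) = (InnerProductSpace.toDual ℝ (E d)).symm
        ((fderiv ℝ R.f x).comp (ContinuousLinearMap.pi (Pi.single i (.id ℝ (E d))))) := by
      unfold CylRep.partialGrad gradient
      rw [h1.fderiv]
    rw [h2, InnerProductSpace.toDual_symm_apply]
    simp only [ContinuousLinearMap.comp_apply]
    congr 1
    funext l
    by_cases hl : l = i
    · subst hl; simp
    · simp [hl]
  have hval : inner ℝ (R.grad γ s) v = fderiv ℝ R.f x w := by
    have hwsum : w = ∑ i, min (R.t i : ℝ) s • Pi.single i v := by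
      funext l
      simp [hw, Finset.sum_apply, Pi.single_apply]
    rw [hwsum, map_sum]
    unfold CylRep.grad
    rw [sum_inner]
    refine Finset.sum_congr rfl fun i _ => ?_
    rw [map_smul, inner_smul_left, ← hx, hpart i]
    simp
  rw [hval]
  have hcurve : (fun r : ℝ => R.toFun (γ + r • ray s v)) = fun r => R.f (x + r • w) := by
    funext r
    unfold CylRep.toFun
    congr 1
    funext i
    simp [CylRep.pt, hx, hw, ray, min_comm]
  rw [hcurve]
  have h3 : HasDerivAt (fun r : ℝ => x + r • w) w 0 := by
    simpa using ((hasDerivAt_id (0 : ℝ)).smul_const w).const_add x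
  have h4 : HasFDerivAt R.f (fderiv ℝ R.f x) (x + (0 : ℝ) • w) := by
    simpa using (hf x).hasFDerivAt
  exact h4.comp_hasDerivAt (0 : ℝ) h3

/-- The gradient does not depend on the representation. -/
theorem D_toFun {d : ℕ} (R : CylRep d) (γ : Omega d) (s : ℝ) (hs : s ∈ Set.Icc (0 : ℝ) 1) :
    D R.toFun γ s = R.grad γ s := by
  have h : ∃ R' : CylRep d, R'.toFun = R.toFun := ⟨R, rfl⟩
  unfold D
  rw [dif_pos h]
  refine ext_inner_right ℝ fun v => ?_
  have h1 := h.choose.hasDerivAt_toFun γ ⟨s, hs⟩ v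
  rw [h.choose_spec] at h1
  exact h1.unique (R.hasDerivAt_toFun γ ⟨s, hs⟩ v)

/-- The inner product of the Cameron-Martin space. -/
def cmInner {d : ℕ} (f g : ℝ → E d) : ℝ := ∫ x in (0 : ℝ)..1, inner ℝ (deriv f x) (deriv g x)

/-- The Haar function `H_{2^m + k}`, `1 ≤ k ≤ 2^m`. -/
def haarLevel (m k : ℕ) (t : ℝ) : ℝ :=
  if ((k : ℝ) - 1) / 2 ^ m ≤ t ∧ t < (2 * (k : ℝ) - 1) / 2 ^ (m + 1) then √(2 ^ m)
  else if (2 * (k : ℝ) - 1) / 2 ^ (m + 1) ≤ t ∧ t < (k : ℝ) / 2 ^ m then -√(2 ^ m)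
  else 0

/-- The Haar functions `H_n`, `n ≥ 1`: `H_1 = 1`, and `n = 2^m + k` with `1 ≤ k ≤ 2^m` if `n ≥ 2`. -/
def haar (n : ℕ) (t : ℝ) : ℝ :=
  if n ≤ 1 then 1 else haarLevel (Nat.log 2 (n - 1)) (n - 2 ^ Nat.log 2 (n - 1)) t

/-- `g_{d(r-1)+j} = H_r e_j` for `r ≥ 1` and `1 ≤ j ≤ d` (the coordinates being numbered from `0`
in Lean, `e_j` is the basis vector with index `j - 1`). -/
def g (d : ℕ) [NeZero d] (n : ℕ) (t : ℝ) : E d :=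
  haar ((n - 1) / d + 1) t • EuclideanSpace.single (Fin.ofNat d (n - 1)) (1 : ℝ)

/-- The Schauder functions `S_n`, `n ≥ 1`. -/
def S (d : ℕ) [NeZero d] (n : ℕ) (s : ℝ) : E d := ∫ u in (0 : ℝ)..s, g d n u

/-- The weighted measure `φν`. -/
def weighted {d : ℕ} (ν : Measure (Omega d)) (φ : Omega d → ℝ) : Measure (Omega d) :=
  ν.withDensity fun γ => ENNReal.ofReal (φ γ)

/-- `ℰ(F,G) = ∑_{n ≥ 1} λ_n ∫ ⟨S_n, DF⟩ ⟨S_n, DG⟩ dm`. -/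
def energy {d : ℕ} [NeZero d] (lam : ℕ → ℝ) (m : Measure (Omega d)) (F G : Omega d → ℝ) : ℝ :=
  ∑' n : ℕ, lam (n + 1) *
    ∫ γ, cmInner (S d (n + 1)) (D F γ) * cmInner (S d (n + 1)) (D G γ) ∂m

/-- The integrals and the series that define `ℰ(F,F)` converge. -/
def FiniteEnergy {d : ℕ} [NeZero d] (lam : ℕ → ℝ) (m : Measure (Omega d)) (F : Omega d → ℝ) :
    Prop :=
  (∀ n : ℕ, Integrable (fun γ => cmInner (S d (n + 1)) (D F γ) ^ 2) m) ∧
    Summable fun n : ℕ => lam (n + 1) * ∫ γ, cmInner (S d (n + 1)) (D F γ) ^ 2 ∂m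

/-- The index `i_{p,j} = 2^{p-1}(d+j-1) + 1 + ∑_{q=0}^{p-1} c_q 2^{p-q-1}`, for `p ≥ 1` and
`1 ≤ j ≤ d`. -/
def idx (d : ℕ) (c : ℕ → ℕ) (p j : ℕ) : ℕ :=
  2 ^ (p - 1) * (d + j - 1) + 1 + ∑ q ∈ Finset.range p, c q * 2 ^ (p - q - 1)

end WienerForm

end

open MeasureTheory ProbabilityTheory Filter Topology DirForm

noncomputable section

/-! The energy of `F` is the squared norm of `(√λₙ ∂F/∂Sₙ)ₙ` in `ℓ²(L²(φν))`: each Schauder function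
is a finite combination of paths `u ↦ (τ ∧ u) v`, so `⟨Sₙ, DF⟩` is the derivative of `F` in the
direction `Sₙ` (`cmInner_S_D`). All assertions become statements about the closure of the graph of
this gradient.

Finite energy. The summability condition gives `∑ λₙ |Sₙ(s)|² ≤ M₀` uniformly in `s`
(`exists_sum_norm_sq_S_le`), because at dyadic level `m` at most `d` Schauder functions are nonzero
at `s`, each with square at most `2⁻ᵐ`. A cylindrical function sees a direction only at finitely
many times.

Closability. For cylindrical `G` the quotient `G/φ` lies in `L²(φν)`, since its squared norm is `∫
G²/φ dν`, and pairing with it cancels the weight. Gaussian integration by parts for `ν` then reads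
`⟨∂F, G/φ⟩ = ⟨F, (W G - ∂G)/φ⟩`, and the functions `G/φ` are total
(`snd_eq_zero_of_mem_closure_gradGraph`).

Markov property. Smooth approximations of the unit contraction do not increase the energy of
cylindrical functions. The limit is taken with lower semicontinuity of the norm, for which convex
combinations replace weak compactness.

Quasi-regularity. Let `V(γ) = ∑ 2ˡ |Δ|⁸` over the dyadic increments `Δ` of level `l`. It is finite
almost surely, and its sublevel sets consist of paths with a common Hölder bound of exponent `1/8`,
so they are compact (`isCompact_besovLevel`). The partial sums `V_M` are cylindrical, and by the
bound `M₀` their gradients are controlled by a functional with uniformly bounded fourth moment.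
Hence `F η_j(V_M)`, with cut-offs `η_j`, has energy bounded in `j` and `M`. Letting `M → ∞`, then `j
→ ∞` along convex combinations, approximates `F` in the graph norm by elements supported on sublevel
sets (`mem_closure_supportedGraph`). Cylindrical functions are continuous and separate points, which
gives the remaining conditions. -/

/-! ### Convex combinations in place of weak compactness -/

/-- A sequence in `H × K` whose first components converge and whose second components are bounded
has convex combinations of its tails that converge. -/
theorem exists_convexHull_tendsto_of_bounded_snd {H K : Type*} [NormedAddCommGroup H]
    [NormedSpace ℝ H] [NormedAddCommGroup K] [InnerProductSpace ℝ K] [CompleteSpace K]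
    {p : ℕ → H × K} {u : H} {M : ℝ} (hu : Tendsto (fun k => (p k).1) atTop (𝓝 u))
    (hM : ∀ k, ‖(p k).2‖ ≤ M) :
    ∃ (y : K) (q : ℕ → H × K), (∀ k, q k ∈ convexHull ℝ (p '' Set.Ici k)) ∧
      Tendsto q atTop (𝓝 (u, y)) ∧ ‖y‖ ≤ M := by
  have hM0 : 0 ≤ M := (norm_nonneg _).trans (hM 0)
  set C : ℕ → Set (H × K) := fun k => convexHull ℝ (p '' Set.Ici k) with hC
  have hCanti : ∀ {k l}, k ≤ l → C l ⊆ C k := fun {k l} h =>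
    convexHull_mono (Set.image_mono (Set.Ici_subset_Ici.2 h))
  have hpC : ∀ k, p k ∈ C k := fun k => subset_convexHull _ _ ⟨k, Set.mem_Ici.2 le_rfl, rfl⟩
  have hCM : ∀ k, ∀ x ∈ C k, ‖x.2‖ ≤ M := by
    intro k x hx
    have : C k ⊆ (LinearMap.snd ℝ H K) ⁻¹' Metric.closedBall 0 M := by
      refine convexHull_min ?_ ((convex_closedBall 0 M).linear_preimage _)
      rintro _ ⟨j, -, rfl⟩
      simpa using hM j
    simpa using this hx
  -- The infima of the squared norm over the shrinking hulls increase to a finite limit, so almost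
  -- minimizers form a Cauchy sequence, as in the projection theorem.
  set a : ℕ → ℝ := fun k => sInf ((fun x : H × K => ‖x.2‖ ^ 2) '' C k) with ha
  have hbdd : ∀ k, BddBelow ((fun x : H × K => ‖x.2‖ ^ 2) '' C k) := fun k =>
    ⟨0, by rintro _ ⟨x, -, rfl⟩; positivity⟩
  have hne : ∀ k, ((fun x : H × K => ‖x.2‖ ^ 2) '' C k).Nonempty := fun k => ⟨_, p k, hpC k, rfl⟩
  have hale : ∀ k, ∀ x ∈ C k, a k ≤ ‖x.2‖ ^ 2 := fun k x hx => csInf_le (hbdd k) ⟨x, hx, rfl⟩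
  have hamono : Monotone a := fun k l h => csInf_le_csInf (hbdd k) (hne l)
    (Set.image_mono (hCanti h))
  have habdd : BddAbove (Set.range a) := ⟨M ^ 2, by
    rintro _ ⟨k, rfl⟩
    exact (hale k _ (hpC k)).trans (pow_le_pow_left₀ (norm_nonneg _) (hM k) 2)⟩
  have hatend := tendsto_atTop_ciSup hamono habdd
  have hex : ∀ k, ∃ x ∈ C k, ‖x.2‖ ^ 2 < a k + 1 / ((k : ℝ) + 1) := by
    intro k
    obtain ⟨_, ⟨x, hx, rfl⟩, h⟩ := exists_lt_of_csInf_lt (hne k)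
      (lt_add_of_pos_right (a k) (by positivity : 0 < 1 / ((k : ℝ) + 1)))
    exact ⟨x, hx, h⟩
  choose q hqC hq using hex
  have hdiff : ∀ k l, k ≤ l → ‖(q k).2 - (q l).2‖ ^ 2 ≤
      2 * ((⨆ i, a i) - a k) + 4 / ((k : ℝ) + 1) := by
    intro k l hkl
    -- The midpoint stays in the larger hull, so its squared norm is at least `a k`; the
    -- parallelogram law turns this into a bound on the difference.
    have hmid : (1 / 2 : ℝ) • q k + (1 / 2 : ℝ) • q l ∈ C k :=
      (convex_convexHull ℝ _) (hqC k) (hCanti hkl (hqC l)) (by norm_num) (by norm_num) (by norm_num)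
    have h1 := hale k _ hmid
    have h2 : ‖((1 / 2 : ℝ) • q k + (1 / 2 : ℝ) • q l).2‖ ^ 2 = ‖(q k).2 + (q l).2‖ ^ 2 / 4 := by
      rw [← smul_add, Prod.smul_snd, norm_smul, mul_pow, Prod.snd_add]
      norm_num
      ring
    have h3 := parallelogram_law_with_norm ℝ (q k).2 (q l).2
    have h4 := le_ciSup habdd l
    have h5 := hq k
    have h6 := hq l
    have h7 : 1 / ((l : ℝ) + 1) ≤ 1 / ((k : ℝ) + 1) := by gcongr
    have h8 : 4 / ((k : ℝ) + 1) = 4 * (1 / ((k : ℝ) + 1)) := by ring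
    rw [h8]
    nlinarith
  have hlim0 : Tendsto (fun k : ℕ => 2 * ((⨆ i, a i) - a k) + 4 / ((k : ℝ) + 1)) atTop (𝓝 0) := by
    have h1 : Tendsto (fun k : ℕ => 4 * (1 / ((k : ℝ) + 1))) atTop (𝓝 (4 * 0)) :=
      tendsto_one_div_add_atTop_nhds_zero_nat.const_mul 4
    have h2 := ((hatend.const_sub (⨆ i, a i)).const_mul 2).add h1
    simp only [sub_self, mul_zero, add_zero] at h2
    exact h2.congr fun k => by ring
  have hcau : CauchySeq fun k => (q k).2 := by
    refine Metric.cauchySeq_iff'.2 fun ε hε => ?_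
    obtain ⟨N, hN⟩ := (hlim0.eventually (gt_mem_nhds (by positivity : (0 : ℝ) < ε ^ 2))).exists
    refine ⟨N, fun n hn => ?_⟩
    rw [dist_comm, dist_eq_norm]
    exact lt_of_pow_lt_pow_left₀ 2 hε.le ((hdiff N n hn).trans_lt hN)
  obtain ⟨y, hy⟩ := cauchySeq_tendsto_of_complete hcau
  refine ⟨y, q, hqC, ?_, le_of_tendsto hy.norm (Eventually.of_forall fun k => hCM k _ (hqC k))⟩
  refine Tendsto.prodMk_nhds ?_ hy
  refine Metric.tendsto_atTop.2 fun ε hε => ?_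
  obtain ⟨N, hN⟩ := Metric.tendsto_atTop.1 hu ε hε
  refine ⟨N, fun n hn => ?_⟩
  have : C N ⊆ (LinearMap.fst ℝ H K) ⁻¹' Metric.ball u ε := by
    refine convexHull_min ?_ ((convex_ball u ε).linear_preimage _)
    rintro _ ⟨j, hj, rfl⟩
    exact hN j hj
  exact this (hCanti hn (hqC n))

/-! ### Cylindrical functions: algebra and directional derivatives -/

theorem Function.HasTemperateGrowth.fderiv_apply {V W : Type*} [NormedAddCommGroup V]
    [NormedSpace ℝ V] [NormedAddCommGroup W] [NormedSpace ℝ W] {f : V → W}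
    (hf : f.HasTemperateGrowth) (v : V) : (fun x => fderiv ℝ f x v).HasTemperateGrowth := by
  have h : (fderiv ℝ f).HasTemperateGrowth := by
    refine ⟨hf.1.fderiv_right (by simp), fun n => ?_⟩
    obtain ⟨k, C, h⟩ := hf.2 (n + 1)
    exact ⟨k, C, fun x => by rw [norm_iteratedFDeriv_fderiv]; exact h x⟩
  exact ((ContinuousLinearMap.apply ℝ W v).hasTemperateGrowth).comp h

namespace WienerForm

variable {d : ℕ}

/-- The evaluation of a path at a family of times. -/
def evalFamily {ι : Type*} [Fintype ι] (t : ι → unitInterval) : Omega d →L[ℝ] (ι → E d) :=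
  ContinuousLinearMap.pi fun i => (ContinuousMap.evalCLM ℝ (t i)).comp (paths d).subtypeL

@[simp]
theorem evalFamily_apply {ι : Type*} [Fintype ι] (t : ι → unitInterval) (γ : Omega d) (i : ι) :
    evalFamily t γ i = γ.1 (t i) := rfl

/-- Frees cylindrical functions from the normalization of `CylRep`: times may repeat, be unordered,
or equal `0`. The time `1` is adjoined, `0` is deleted because `γ(0) = 0`, and `f` is precomposed
with the linear map that restores the original coordinates. -/
theorem comp_evalFamily_mem_Z {ι : Type*} [Fintype ι] (t : ι → unitInterval)
    {f : (ι → E d) → ℝ} (hf : f.HasTemperateGrowth) : (fun γ => f (evalFamily t γ)) ∈ Z d := by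
  classical
  set J : Finset unitInterval := (insert 1 (Finset.univ.image t)).erase 0 with hJ
  have h1J : (1 : unitInterval) ∈ J := by simp [hJ]
  obtain ⟨k, hk⟩ : ∃ k, J.card = k + 1 :=
    ⟨J.card - 1, (Nat.succ_pred_eq_of_pos (Finset.card_pos.2 ⟨1, h1J⟩)).symm⟩
  set e := J.orderEmbOfFin hk with he
  have hpos : ∀ i, 0 < e i := fun i => by
    have := (Finset.mem_erase.1 (J.orderEmbOfFin_mem hk i)).1
    exact unitInterval.pos_iff_ne_zero.2 this
  have hsurj : ∀ s ∈ J, ∃ i, e i = s := fun s hs => by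
    have : s ∈ Set.range e := by rw [he, Finset.range_orderEmbOfFin]; exact hs
    exact this
  have hidx : ∀ i, ∃ l, t i ≠ 0 → e l = t i := fun i => by
    by_cases h : t i = 0
    · exact ⟨0, fun h' => (h' h).elim⟩
    · obtain ⟨l, hl⟩ := hsurj (t i) (by simp [hJ, h])
      exact ⟨l, fun _ => hl⟩
  choose idx hidx using hidx
  let A : (Fin (k + 1) → E d) →L[ℝ] (ι → E d) :=
    ContinuousLinearMap.pi fun i => if t i = 0 then 0 else ContinuousLinearMap.proj (idx i)
  refine ⟨⟨k, e, hpos 0, e.strictMono, ?_, f ∘ A, hf.comp A.hasTemperateGrowth⟩, ?_⟩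
  · obtain ⟨i, hi⟩ := hsurj 1 h1J
    exact le_antisymm unitInterval.le_one' (hi ▸ e.monotone (Fin.le_last i))
  · funext γ
    simp only [CylRep.toFun, Function.comp_apply]
    congr 1
    funext i
    by_cases h : t i = 0
    · have h0 : γ.1 0 = 0 := γ.2
      simp [A, h, h0]
    · simp [A, h, CylRep.pt, hidx i h]

theorem mem_Z_iff {F : Omega d → ℝ} : F ∈ Z d ↔ ∃ (n : ℕ) (t : Fin n → unitInterval)
    (f : (Fin n → E d) → ℝ), f.HasTemperateGrowth ∧ F = fun γ => f (evalFamily t γ) := by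
  constructor
  · rintro ⟨R, rfl⟩
    exact ⟨R.k + 1, R.t, R.f, R.f_smooth, rfl⟩
  · rintro ⟨n, t, f, hf, rfl⟩
    exact comp_evalFamily_mem_Z t hf

theorem comp_mem_Z {F : Omega d → ℝ} (hF : F ∈ Z d) {η : ℝ → ℝ} (hη : η.HasTemperateGrowth) :
    (fun γ => η (F γ)) ∈ Z d := by
  obtain ⟨n, t, f, hf, rfl⟩ := mem_Z_iff.1 hF
  exact comp_evalFamily_mem_Z t (hη.comp hf)

/-- Two cylindrical functions depend on a common family of times. -/
theorem exists_common_of_mem_Z {F G : Omega d → ℝ} (hF : F ∈ Z d) (hG : G ∈ Z d) :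
    ∃ (n k : ℕ) (t : Fin n ⊕ Fin k → unitInterval) (f g : (Fin n ⊕ Fin k → E d) → ℝ),
      f.HasTemperateGrowth ∧ g.HasTemperateGrowth ∧ F = (fun γ => f (evalFamily t γ)) ∧
      G = fun γ => g (evalFamily t γ) := by
  obtain ⟨n, t, f, hf, rfl⟩ := mem_Z_iff.1 hF
  obtain ⟨k, s, g, hg, rfl⟩ := mem_Z_iff.1 hG
  let A : (Fin n ⊕ Fin k → E d) →L[ℝ] (Fin n → E d) :=
    ContinuousLinearMap.pi fun i => ContinuousLinearMap.proj (Sum.inl i)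
  let B : (Fin n ⊕ Fin k → E d) →L[ℝ] (Fin k → E d) :=
    ContinuousLinearMap.pi fun i => ContinuousLinearMap.proj (Sum.inr i)
  exact ⟨n, k, Sum.elim t s, f ∘ A, g ∘ B, hf.comp A.hasTemperateGrowth,
    hg.comp B.hasTemperateGrowth, rfl, rfl⟩

theorem add_mem_Z {F G : Omega d → ℝ} (hF : F ∈ Z d) (hG : G ∈ Z d) : F + G ∈ Z d := by
  obtain ⟨n, k, t, f, g, hf, hg, rfl, rfl⟩ := exists_common_of_mem_Z hF hG
  exact comp_evalFamily_mem_Z t (hf.add hg)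

theorem mul_mem_Z {F G : Omega d → ℝ} (hF : F ∈ Z d) (hG : G ∈ Z d) :
    (fun γ => F γ * G γ) ∈ Z d := by
  obtain ⟨n, k, t, f, g, hf, hg, rfl, rfl⟩ := exists_common_of_mem_Z hF hG
  exact comp_evalFamily_mem_Z t (hf.mul hg)

theorem const_mem_Z (c : ℝ) : (fun _ => c) ∈ Z d :=
  comp_evalFamily_mem_Z (ι := Fin 0) Fin.elim0 (.const c)

theorem smul_mem_Z (c : ℝ) {F : Omega d → ℝ} (hF : F ∈ Z d) : c • F ∈ Z d :=
  mul_mem_Z (const_mem_Z c) hF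

theorem sub_mem_Z {F G : Omega d → ℝ} (hF : F ∈ Z d) (hG : G ∈ Z d) : F - G ∈ Z d := by
  have h : F - G = F + (-1 : ℝ) • G := by simp [sub_eq_add_neg]
  exact h ▸ add_mem_Z hF (smul_mem_Z _ hG)

theorem pow_mem_Z {F : Omega d → ℝ} (hF : F ∈ Z d) (k : ℕ) : (fun γ => F γ ^ k) ∈ Z d :=
  comp_mem_Z hF (η := fun x => x ^ k) (Function.HasTemperateGrowth.id'.pow k)

theorem sum_mem_Z {ι : Type*} (s : Finset ι) {F : ι → Omega d → ℝ} (hF : ∀ i ∈ s, F i ∈ Z d) :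
    (fun γ => ∑ i ∈ s, F i γ) ∈ Z d := by
  classical
  induction s using Finset.induction_on with
  | empty => simpa using const_mem_Z 0
  | insert i s hi ih =>
    simp only [Finset.sum_insert hi]
    exact add_mem_Z (hF i (by simp)) (ih fun j hj => hF j (by simp [hj]))

/-- The path evaluated at one time, paired with a vector, is cylindrical. -/
theorem inner_eval_mem_Z (t : unitInterval) (v : E d) :
    (fun γ : Omega d => inner ℝ v (γ.1 t)) ∈ Z d :=
  comp_evalFamily_mem_Z (ι := Fin 1) (fun _ => t)
    (f := fun x => inner ℝ v (x 0))
    ((Function.hasTemperateGrowth_inner_right v).comp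
      (ContinuousLinearMap.proj (R := ℝ) (φ := fun _ : Fin 1 => E d) 0).hasTemperateGrowth)

theorem norm_sub_sq_mem_Z (s t : unitInterval) :
    (fun γ : Omega d => ‖γ.1 t - γ.1 s‖ ^ 2) ∈ Z d :=
  comp_evalFamily_mem_Z (ι := Fin 2) ![s, t]
    (f := fun x => ‖x 1 - x 0‖ ^ 2)
    ((Function.hasTemperateGrowth_norm_sq (H := E d)).comp
      (ContinuousLinearMap.proj (R := ℝ) (φ := fun _ : Fin 2 => E d) 1 -
        ContinuousLinearMap.proj (R := ℝ) (φ := fun _ : Fin 2 => E d) 0).hasTemperateGrowth)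

theorem differentiable_of_mem_Z {F : Omega d → ℝ} (hF : F ∈ Z d) : Differentiable ℝ F := by
  obtain ⟨n, t, f, hf, rfl⟩ := mem_Z_iff.1 hF
  have h1 : Differentiable ℝ f := hf.1.differentiable (by simp)
  have h2 : Differentiable ℝ (evalFamily (d := d) t) := ContinuousLinearMap.differentiable _
  intro γ
  exact DifferentiableAt.comp γ (h1 _) (h2 γ)

theorem continuous_of_mem_Z {F : Omega d → ℝ} (hF : F ∈ Z d) : Continuous F :=
  (differentiable_of_mem_Z hF).continuous

theorem fderiv_comp_evalFamily {ι : Type*} [Fintype ι] (t : ι → unitInterval)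
    {f : (ι → E d) → ℝ} (hf : f.HasTemperateGrowth) (γ h : Omega d) :
    fderiv ℝ (fun γ => f (evalFamily t γ)) γ h = fderiv ℝ f (evalFamily t γ) (evalFamily t h) := by
  have h1 : HasFDerivAt f (fderiv ℝ f (evalFamily t γ)) (evalFamily t γ) :=
    ((hf.1.differentiable (by simp)) _).hasFDerivAt
  have h2 : HasFDerivAt (evalFamily (d := d) t) (evalFamily t) γ :=
    ContinuousLinearMap.hasFDerivAt _
  have h3 : HasFDerivAt (fun γ => f (evalFamily t γ)) _ γ := HasFDerivAt.comp γ h1 h2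
  rw [h3.fderiv, ContinuousLinearMap.comp_apply]

/-- Reduction to one real variable: the sum, product and chain rules below follow from uniqueness of
the derivative along a line. -/
theorem hasDerivAt_line {F : Omega d → ℝ} (hF : F ∈ Z d) (γ h : Omega d) :
    HasDerivAt (fun r : ℝ => F (γ + r • h)) (fderiv ℝ F γ h) 0 := by
  obtain ⟨n, t, f, hf, rfl⟩ := mem_Z_iff.1 hF
  rw [fderiv_comp_evalFamily t hf]
  have h1 : HasDerivAt (fun r : ℝ => evalFamily t γ + r • evalFamily t h) (evalFamily t h) 0 := by
    simpa using ((hasDerivAt_id (0 : ℝ)).smul_const (evalFamily t h)).const_add (evalFamily t γ)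
  have h2 : HasFDerivAt f (fderiv ℝ f (evalFamily t γ))
      (evalFamily t γ + (0 : ℝ) • evalFamily t h) := by
    simpa using ((hf.1.differentiable (by simp)) (evalFamily t γ)).hasFDerivAt
  refine (h2.comp_hasDerivAt (0 : ℝ) h1).congr_of_eventuallyEq (Eventually.of_forall fun r => ?_)
  simp

theorem fderiv_add_apply_of_mem_Z {F G : Omega d → ℝ} (hF : F ∈ Z d) (hG : G ∈ Z d)
    (γ h : Omega d) : fderiv ℝ (F + G) γ h = fderiv ℝ F γ h + fderiv ℝ G γ h :=
  (hasDerivAt_line (add_mem_Z hF hG) γ h).unique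
    ((hasDerivAt_line hF γ h).add (hasDerivAt_line hG γ h))

theorem fderiv_smul_apply_of_mem_Z {F : Omega d → ℝ} (hF : F ∈ Z d) (c : ℝ)
    (γ h : Omega d) : fderiv ℝ (c • F) γ h = c * fderiv ℝ F γ h :=
  (hasDerivAt_line (smul_mem_Z c hF) γ h).unique ((hasDerivAt_line hF γ h).const_mul c)

theorem fderiv_mul_apply_of_mem_Z {F G : Omega d → ℝ} (hF : F ∈ Z d) (hG : G ∈ Z d)
    (γ h : Omega d) : fderiv ℝ (fun γ => F γ * G γ) γ h =
      fderiv ℝ F γ h * G γ + F γ * fderiv ℝ G γ h := by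
  have h1 := (hasDerivAt_line hF γ h).mul (hasDerivAt_line hG γ h)
  simp only [zero_smul, add_zero] at h1
  exact (hasDerivAt_line (mul_mem_Z hF hG) γ h).unique h1

theorem fderiv_comp_apply_of_mem_Z {F : Omega d → ℝ} (hF : F ∈ Z d) {η : ℝ → ℝ}
    (hη : η.HasTemperateGrowth) (γ h : Omega d) :
    fderiv ℝ (fun γ => η (F γ)) γ h = deriv η (F γ) * fderiv ℝ F γ h := by
  have h0 : HasDerivAt η (deriv η (F γ)) (F (γ + (0 : ℝ) • h)) := by
    simpa using ((hη.1.differentiable (by simp)) (F γ)).hasDerivAt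
  exact (hasDerivAt_line (comp_mem_Z hF hη) γ h).unique
    (h0.comp (0 : ℝ) (hasDerivAt_line hF γ h))

theorem fderiv_mem_Z {F : Omega d → ℝ} (hF : F ∈ Z d) (h : Omega d) :
    (fun γ => fderiv ℝ F γ h) ∈ Z d := by
  obtain ⟨n, t, f, hf, rfl⟩ := mem_Z_iff.1 hF
  simp_rw [fderiv_comp_evalFamily t hf]
  exact comp_evalFamily_mem_Z t (hf.fderiv_apply _)

/-- The directional derivatives of a cylindrical function are controlled by the values of the
direction at finitely many times. -/
theorem exists_sq_fderiv_le {F : Omega d → ℝ} (hF : F ∈ Z d) :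
    ∃ (n : ℕ) (t : Fin n → unitInterval) (G : Omega d → ℝ), G ∈ Z d ∧ (∀ γ, 0 ≤ G γ) ∧
      ∀ γ h, fderiv ℝ F γ h ^ 2 ≤ (∑ i, ‖h.1 (t i)‖ ^ 2) * G γ := by
  classical
  obtain ⟨n, t, f, hf, rfl⟩ := mem_Z_iff.1 hF
  let e : Fin n → Fin d → (Fin n → E d) := fun i j => Pi.single i (EuclideanSpace.single j 1)
  refine ⟨n, t, fun γ => ∑ p : Fin n × Fin d, fderiv ℝ f (evalFamily t γ) (e p.1 p.2) ^ 2,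
    sum_mem_Z _ fun p _ => pow_mem_Z (comp_evalFamily_mem_Z t (hf.fderiv_apply _)) 2,
    fun γ => Finset.sum_nonneg fun p _ => sq_nonneg _, fun γ h => ?_⟩
  rw [fderiv_comp_evalFamily t hf]
  have hdec : evalFamily t h = ∑ p : Fin n × Fin d, (h.1 (t p.1)) p.2 • e p.1 p.2 := by
    funext i
    ext j
    simp [e, Fintype.sum_prod_type, Finset.sum_apply, Pi.single_apply]
  rw [hdec, map_sum]
  simp only [map_smul, smul_eq_mul]
  -- Cauchy-Schwarz in the coordinates separates the direction `h` from the partial derivatives,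
  -- whose sum of squares is the cylindrical function `G`.
  refine (Finset.sum_mul_sq_le_sq_mul_sq _ _ _).trans_eq ?_
  congr 1
  rw [Fintype.sum_prod_type]
  refine Finset.sum_congr rfl fun i _ => ?_
  rw [EuclideanSpace.norm_sq_eq]
  simp

end WienerForm

/-! ### Schauder functions as directions of differentiation -/

namespace WienerForm

variable {d : ℕ}

/-- The indicator function of `(-∞, τ)`. -/
def stepFun (τ x : ℝ) : ℝ := if x < τ then 1 else 0

theorem measurable_stepFun (τ : ℝ) : Measurable (stepFun τ) :=
  Measurable.ite measurableSet_Iio measurable_const measurable_const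

theorem abs_stepFun_le (τ x : ℝ) : |stepFun τ x| ≤ 1 := by
  unfold stepFun
  split_ifs <;> simp

theorem intervalIntegrable_stepFun (τ a b : ℝ) : IntervalIntegrable (stepFun τ) volume a b := by
  refine (intervalIntegrable_const (c := (1 : ℝ))).mono_fun
    (measurable_stepFun τ).aestronglyMeasurable (Eventually.of_forall fun x => ?_)
  simpa using abs_stepFun_le τ x

theorem stepFun_mul_stepFun (σ τ x : ℝ) : stepFun σ x * stepFun τ x = stepFun (min σ τ) x := by
  unfold stepFun
  by_cases h1 : x < σ <;> by_cases h2 : x < τ <;> simp [h1, h2]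

theorem integral_stepFun {τ s : ℝ} (hτ : 0 ≤ τ) (hs : 0 ≤ s) :
    ∫ x in (0 : ℝ)..s, stepFun τ x = min τ s := by
  have h1 : ∀ r, 0 ≤ r → r ≤ τ → ∫ x in (0 : ℝ)..r, stepFun τ x = r := by
    intro r hr hrτ
    have : ∫ x in (0 : ℝ)..r, stepFun τ x = ∫ x in (0 : ℝ)..r, (1 : ℝ) := by
      refine intervalIntegral.integral_congr_ae ?_
      filter_upwards [Measure.ae_ne volume τ] with x hx hx'
      rw [Set.uIoc_of_le hr] at hx'
      simp [stepFun, lt_of_le_of_ne (hx'.2.trans hrτ) hx]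
    simp [this]
  rcases le_total s τ with h | h
  · rw [h1 s hs h, min_eq_right h]
  · rw [min_eq_left h, ← intervalIntegral.integral_add_adjacent_intervals
      (intervalIntegrable_stepFun τ 0 τ) (intervalIntegrable_stepFun τ τ s), h1 τ hτ le_rfl]
    have : ∫ x in τ..s, stepFun τ x = ∫ x in τ..s, (0 : ℝ) := by
      refine intervalIntegral.integral_congr_ae (Eventually.of_forall fun x hx' => ?_)
      rw [Set.uIoc_of_le h] at hx'
      simp [stepFun, not_lt.2 hx'.1.le]
    simp [this]

theorem hasDerivAt_min_left {τ x : ℝ} (hx : x ≠ τ) :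
    HasDerivAt (fun s => min τ s) (stepFun τ x) x := by
  rcases lt_or_gt_of_ne hx with h | h
  · have : stepFun τ x = 1 := by simp [stepFun, h]
    rw [this]
    refine (hasDerivAt_id x).congr_of_eventuallyEq ?_
    filter_upwards [Iio_mem_nhds h] with s hs
    exact min_eq_right (le_of_lt hs)
  · have : stepFun τ x = 0 := by simp [stepFun, h.le]
    rw [this]
    refine (hasDerivAt_const x τ).congr_of_eventuallyEq ?_
    filter_upwards [Ioi_mem_nhds h] with s hs
    exact min_eq_left (le_of_lt hs)

theorem ae_deriv_eq_sum_stepFun {ι : Type*} [Fintype ι] {τ : ι → ℝ} {v : ι → E d} {f : ℝ → E d}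
    (hf : Set.EqOn f (fun s => ∑ i, min (τ i) s • v i) (Set.Icc 0 1)) :
    ∀ᵐ x, x ∈ Set.uIoc (0 : ℝ) 1 → deriv f x = ∑ i, stepFun (τ i) x • v i := by
  have h : ∀ᵐ x : ℝ, ∀ i, x ≠ τ i := ae_all_iff.2 fun i => Measure.ae_ne volume (τ i)
  filter_upwards [h, Measure.ae_ne volume (1 : ℝ)] with x hx hx1 hx'
  rw [Set.uIoc_of_le zero_le_one] at hx'
  have hD : HasDerivAt (fun s => ∑ i, min (τ i) s • v i) (∑ i, stepFun (τ i) x • v i) x :=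
    HasDerivAt.fun_sum fun i _ => (hasDerivAt_min_left (hx i)).smul_const (v i)
  refine (hD.congr_of_eventuallyEq ?_).deriv
  filter_upwards [Icc_mem_nhds hx'.1 (lt_of_le_of_ne hx'.2 hx1)] with s hs
  exact hf hs

/-- The Cameron-Martin inner product of two functions that are piecewise linear on `[0,1]`. -/
theorem cmInner_eq_sum {ι κ : Type*} [Fintype ι] [Fintype κ] {τ : ι → unitInterval} {v : ι → E d}
    {σ : κ → unitInterval} {w : κ → E d} {f g : ℝ → E d}
    (hf : Set.EqOn f (fun s => ∑ i, min (τ i : ℝ) s • v i) (Set.Icc 0 1))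
    (hg : Set.EqOn g (fun s => ∑ j, min (σ j : ℝ) s • w j) (Set.Icc 0 1)) :
    cmInner f g = ∑ j, inner ℝ (f (σ j)) (w j) := by
  -- Derivatives of `τ ∧ ·` are indicators and products of indicators are indicators, so `⟨τ ∧ ·, σ
  -- ∧ ·⟩ = τ ∧ σ`: the reproducing property of the Cameron-Martin space.
  have h1 : cmInner f g = ∫ x in (0 : ℝ)..1, ∑ j, ∑ i,
      stepFun (min (τ i) (σ j)) x * inner ℝ (v i) (w j) := by
    refine intervalIntegral.integral_congr_ae ?_
    filter_upwards [ae_deriv_eq_sum_stepFun hf, ae_deriv_eq_sum_stepFun hg] with x hx hy hx'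
    rw [hx hx', hy hx']
    simp only [sum_inner, inner_sum, real_inner_smul_left, real_inner_smul_right,
      ← stepFun_mul_stepFun]
    refine Finset.sum_congr rfl fun j _ => Finset.sum_congr rfl fun i _ => ?_
    ring
  rw [h1, intervalIntegral.integral_finsetSum fun j _ => ?_]
  · refine Finset.sum_congr rfl fun j _ => ?_
    rw [intervalIntegral.integral_finsetSum fun i _ => ?_, hf (σ j).2, sum_inner]
    · refine Finset.sum_congr rfl fun i _ => ?_
      rw [intervalIntegral.integral_mul_const, integral_stepFun (le_min (τ i).2.1 (σ j).2.1)
        zero_le_one, min_eq_left (min_le_of_left_le (τ i).2.2), inner_smul_left]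
      simp
    · exact (intervalIntegrable_stepFun _ _ _).mul_const _
  · simpa only [Finset.sum_fn] using IntervalIntegrable.sum (f := fun i x =>
      stepFun (min (τ i) (σ j)) x * inner ℝ (v i) (w j)) Finset.univ
      fun i _ => (intervalIntegrable_stepFun _ _ _).mul_const _

theorem CylRep.inner_partialGrad (R : CylRep d) (i : Fin (R.k + 1)) (x : Fin (R.k + 1) → E d)
    (v : E d) : inner ℝ v (R.partialGrad i x) = fderiv ℝ R.f x (Pi.single i v) := by
  have hf : Differentiable ℝ R.f := R.f_smooth.1.differentiable (by simp)
  have h1 : HasFDerivAt (fun y => R.f (Function.update x i y))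
      ((fderiv ℝ R.f x).comp (ContinuousLinearMap.pi (Pi.single i (.id ℝ (E d))))) (x i) := by
    refine HasFDerivAt.comp (x i) ?_ (hasFDerivAt_update x (x i))
    rw [Function.update_eq_self]
    exact (hf x).hasFDerivAt
  have h2 : R.partialGrad i x = (InnerProductSpace.toDual ℝ (E d)).symm
      ((fderiv ℝ R.f x).comp (ContinuousLinearMap.pi (Pi.single i (.id ℝ (E d))))) := by
    unfold CylRep.partialGrad gradient
    rw [h1.fderiv]
  rw [real_inner_comm, h2, InnerProductSpace.toDual_symm_apply]
  simp only [ContinuousLinearMap.comp_apply]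
  congr 1
  funext l
  by_cases hl : l = i
  · subst hl; simp
  · simp [hl]

/-- The Cameron-Martin inner product of a piecewise linear path with `D F` is the directional
derivative of `F`. -/
theorem cmInner_D_eq_fderiv {ι : Type*} [Fintype ι] {τ : ι → unitInterval} {v : ι → E d}
    {f : ℝ → E d} (hf : Set.EqOn f (fun s => ∑ i, min (τ i : ℝ) s • v i) (Set.Icc 0 1))
    (h : Omega d) (hh : ∀ s : unitInterval, h.1 s = f s)
    {F : Omega d → ℝ} (hF : F ∈ Z d) (γ : Omega d) :
    cmInner f (D F γ) = fderiv ℝ F γ h := by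
  obtain ⟨R, rfl⟩ := hF
  have h2 : fderiv ℝ R.toFun γ h = fderiv ℝ R.f (R.pt γ) (evalFamily R.t h) :=
    fderiv_comp_evalFamily R.t R.f_smooth γ h
  rw [cmInner_eq_sum hf fun s hs => D_toFun R γ s hs, h2]
  simp only [CylRep.inner_partialGrad]
  rw [← map_sum]
  congr 1
  funext l
  simp [Finset.sum_apply, Pi.single_apply, hh]

/-- The difference of the indicators of `[a, b)` and `[b, c)` is `2·1_{x<b} - 1_{x<a} - 1_{x<c}`.
After integration, a Schauder function is a combination of three functions `τ ∧ s`. -/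
theorem haarLevel_eq (m k : ℕ) (x : ℝ) : haarLevel m k x =
    √(2 ^ m) * (2 * stepFun ((2 * (k : ℝ) - 1) / 2 ^ (m + 1)) x - stepFun (((k : ℝ) - 1) / 2 ^ m) x
      - stepFun ((k : ℝ) / 2 ^ m) x) := by
  have hab : ((k : ℝ) - 1) / 2 ^ m ≤ (2 * (k : ℝ) - 1) / 2 ^ (m + 1) := by
    rw [pow_succ, div_le_div_iff₀ (by positivity) (by positivity)]
    nlinarith [pow_pos (two_pos : (0 : ℝ) < 2) m]
  have hbc : (2 * (k : ℝ) - 1) / 2 ^ (m + 1) ≤ (k : ℝ) / 2 ^ m := by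
    rw [pow_succ, div_le_div_iff₀ (by positivity) (by positivity)]
    nlinarith [pow_pos (two_pos : (0 : ℝ) < 2) m]
  unfold haarLevel stepFun
  by_cases ha : x < ((k : ℝ) - 1) / 2 ^ m
  · simp [ha, not_le.2 ha, ha.trans_le hab, (ha.trans_le hab).trans_le hbc,
      not_le.2 (ha.trans_le hab)]
    norm_num
  · by_cases hb : x < (2 * (k : ℝ) - 1) / 2 ^ (m + 1)
    · simp [ha, not_lt.1 ha, hb, hb.trans_le hbc]
      norm_num
    · by_cases hc : x < (k : ℝ) / 2 ^ m
      · simp [ha, hb, hc, not_lt.1 hb]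
      · simp [ha, hb, hc]

/-- The integral of the Haar function `H_{2^m + k}`. -/
def tent (m k : ℕ) (s : ℝ) : ℝ :=
  √(2 ^ m) * (2 * min ((2 * (k : ℝ) - 1) / 2 ^ (m + 1)) s - min (((k : ℝ) - 1) / 2 ^ m) s
      - min ((k : ℝ) / 2 ^ m) s)

theorem integral_haarLevel {m k : ℕ} (hk : 1 ≤ k) {s : ℝ} (hs : 0 ≤ s) :
    ∫ x in (0 : ℝ)..s, haarLevel m k x = tent m k s := by
  have hk' : (1 : ℝ) ≤ k := by exact_mod_cast hk
  simp only [haarLevel_eq]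
  rw [intervalIntegral.integral_const_mul, intervalIntegral.integral_sub,
    intervalIntegral.integral_sub, intervalIntegral.integral_const_mul, integral_stepFun _ hs,
    integral_stepFun _ hs, integral_stepFun _ hs]
  · rfl
  · positivity
  · exact div_nonneg (by linarith) (by positivity)
  · exact div_nonneg (by linarith) (by positivity)
  · exact (intervalIntegrable_stepFun _ _ _).const_mul _
  · exact intervalIntegrable_stepFun _ _ _
  · exact ((intervalIntegrable_stepFun _ _ _).const_mul _).sub (intervalIntegrable_stepFun _ _ _)
  · exact intervalIntegrable_stepFun _ _ _

theorem tent_sq_le (m k : ℕ) (s : ℝ) : tent m k s ^ 2 ≤ (2 ^ m)⁻¹ := by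
  have hp : (0 : ℝ) < 2 ^ m := by positivity
  have h : |2 * min ((2 * (k : ℝ) - 1) / 2 ^ (m + 1)) s - min (((k : ℝ) - 1) / 2 ^ m) s
      - min ((k : ℝ) / 2 ^ m) s| ≤ (2 ^ m)⁻¹ := by
    have hb : (2 * (k : ℝ) - 1) / 2 ^ (m + 1) = (k : ℝ) / 2 ^ m - (2 ^ m)⁻¹ / 2 := by
      rw [pow_succ]; field_simp
    have ha : ((k : ℝ) - 1) / 2 ^ m = (k : ℝ) / 2 ^ m - (2 ^ m)⁻¹ := by field_simp
    rw [ha, hb]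
    have hq : (0 : ℝ) < (2 ^ m)⁻¹ := by positivity
    generalize (k : ℝ) / 2 ^ m = c
    generalize ((2 : ℝ) ^ m)⁻¹ = q at *
    rw [abs_le]
    constructor <;> (simp only [min_def]; split_ifs <;> linarith)
  unfold tent
  rw [mul_pow, Real.sq_sqrt hp.le, ← sq_abs]
  calc _ ≤ (2 ^ m : ℝ) * ((2 ^ m)⁻¹) ^ 2 := by gcongr
    _ = _ := by field_simp

theorem tent_eq_zero {m k : ℕ} {s : ℝ} (h : s ≤ ((k : ℝ) - 1) / 2 ^ m ∨ (k : ℝ) / 2 ^ m ≤ s) :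
    tent m k s = 0 := by
  have hb : (2 * (k : ℝ) - 1) / 2 ^ (m + 1) = (k : ℝ) / 2 ^ m - (2 ^ m)⁻¹ / 2 := by
    rw [pow_succ]; field_simp
  have ha : ((k : ℝ) - 1) / 2 ^ m = (k : ℝ) / 2 ^ m - (2 ^ m)⁻¹ := by field_simp
  unfold tent
  rw [ha] at h
  rw [ha, hb]
  have hq : (0 : ℝ) < (2 ^ m)⁻¹ := by positivity
  generalize (k : ℝ) / 2 ^ m = c at *
  generalize ((2 : ℝ) ^ m)⁻¹ = q at *
  rcases h with h | h
  · rw [min_eq_right (by linarith), min_eq_right (by linarith), min_eq_right (by linarith)]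
    ring
  · rw [min_eq_left (by linarith), min_eq_left (by linarith), min_eq_left (by linarith)]
    ring

variable [NeZero d]

theorem S_of_le {n : ℕ} (hn : (n - 1) / d = 0) {s : ℝ} :
    S d n s = s • EuclideanSpace.single (Fin.ofNat d (n - 1)) (1 : ℝ) := by
  simp [S, g, haar, hn]

theorem S_of_pos {n : ℕ} (hn : 0 < (n - 1) / d) {s : ℝ} (hs : 0 ≤ s) :
    S d n s = tent (Nat.log 2 ((n - 1) / d)) ((n - 1) / d + 1 - 2 ^ Nat.log 2 ((n - 1) / d)) s •
      EuclideanSpace.single (Fin.ofNat d (n - 1)) (1 : ℝ) := by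
  have hk : 1 ≤ (n - 1) / d + 1 - 2 ^ Nat.log 2 ((n - 1) / d) := by
    have := Nat.pow_log_le_self 2 hn.ne'
    omega
  rw [← integral_haarLevel hk hs, ← intervalIntegral.integral_smul_const]
  refine intervalIntegral.integral_congr fun x _ => ?_
  have : ¬ ((n - 1) / d + 1 ≤ 1) := by omega
  simp only [g, haar, this, if_false, Nat.add_sub_cancel]

/-- The kinks of a tent are the three times. For the linear Schauder functions one time suffices,
and the other two vectors are zero. Both the computation of `⟨Sₙ, DF⟩` and integration by parts
reduce to single rays through this form. -/
theorem exists_S_eq_sum (n : ℕ) : ∃ (τ : Fin 3 → unitInterval) (v : Fin 3 → E d),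
    Set.EqOn (S d n) (fun s => ∑ i, min (τ i : ℝ) s • v i) (Set.Icc 0 1) := by
  set e : E d := EuclideanSpace.single (Fin.ofNat d (n - 1)) (1 : ℝ) with he
  rcases Nat.eq_zero_or_pos ((n - 1) / d) with hn | hn
  · refine ⟨fun _ => 1, ![e, 0, 0], fun s hs => ?_⟩
    simp only [S_of_le hn, Fin.sum_univ_three]
    simp [he, hs.2]
  · set m := Nat.log 2 ((n - 1) / d) with hm
    set k := (n - 1) / d + 1 - 2 ^ m with hk
    have h1 : 2 ^ m ≤ (n - 1) / d := Nat.pow_log_le_self 2 hn.ne'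
    have h2 : (n - 1) / d < 2 ^ (m + 1) := Nat.lt_pow_succ_log_self one_lt_two _
    have hk1 : (1 : ℝ) ≤ k := by
      have : 1 ≤ k := by omega
      exact_mod_cast this
    have hk2 : (k : ℝ) ≤ 2 ^ m := by
      have : k ≤ 2 ^ m := by rw [pow_succ] at h2; omega
      exact_mod_cast this
    have hp : (0 : ℝ) < 2 ^ m := by positivity
    refine ⟨![⟨(2 * (k : ℝ) - 1) / 2 ^ (m + 1), div_nonneg (by linarith) (by positivity), ?_⟩,
      ⟨((k : ℝ) - 1) / 2 ^ m, div_nonneg (by linarith) (by positivity), ?_⟩,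
      ⟨(k : ℝ) / 2 ^ m, by positivity, ?_⟩],
      ![(√(2 ^ m) * 2) • e, -√(2 ^ m) • e, -√(2 ^ m) • e], fun s hs => ?_⟩
    · rw [div_le_one (by positivity), pow_succ]; linarith
    · rw [div_le_one (by positivity)]; linarith
    · rwa [div_le_one (by positivity)]
    · simp only [S_of_pos hn hs.1, Fin.sum_univ_three, ← hm, ← hk, ← he]
      simp only [Matrix.cons_val_zero, Matrix.cons_val_one, Matrix.cons_val, smul_smul,
        ← add_smul]
      congr 1
      unfold tent
      ring

/-- The Schauder function `S_n` as an element of `Ω`. -/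
def schauder (d : ℕ) [NeZero d] (n : ℕ) : Omega d :=
  ⟨⟨fun s => S d n s, by
    obtain ⟨τ, v, h⟩ := exists_S_eq_sum (d := d) n
    have : (fun s : unitInterval => S d n s) = fun s : unitInterval =>
        ∑ i, min (τ i : ℝ) (s : ℝ) • v i :=
      funext fun s => h s.2
    rw [this]
    fun_prop⟩, by
    show S d n ((0 : unitInterval) : ℝ) = 0
    simp [S]⟩

theorem schauder_apply (n : ℕ) (s : unitInterval) : (schauder d n).1 s = S d n s := rfl

theorem exists_schauder_eq_sum_ray (n : ℕ) : ∃ (τ : Fin 3 → unitInterval) (v : Fin 3 → E d),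
    schauder d n = ∑ i, ray (τ i) (v i) := by
  obtain ⟨τ, v, h⟩ := exists_S_eq_sum (d := d) n
  refine ⟨τ, v, Subtype.ext (ContinuousMap.ext fun s => ?_)⟩
  rw [schauder_apply, h s.2]
  simp [ray]

/-- From here on, the energy is expressed through directional derivatives alone, independently of
the representation of `F`. -/
theorem cmInner_S_D {F : Omega d → ℝ} (hF : F ∈ Z d) (n : ℕ) (γ : Omega d) :
    cmInner (S d n) (D F γ) = fderiv ℝ F γ (schauder d n) := by
  obtain ⟨τ, v, h⟩ := exists_S_eq_sum (d := d) n
  exact cmInner_D_eq_fderiv h _ (fun s => rfl) hF γ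

/-! ### The uniform bound on `∑ₙ λₙ |Sₙ(s)|²` -/

/-- The indices with a given quotient by `d` are the `d` coordinate directions attached to one Haar
function. -/
theorem sum_Ico_ite_div_eq_le (a b q : ℕ) {A : ℝ} (hA : 0 ≤ A) :
    ∑ i ∈ Finset.Ico a b, (if i / d = q then A else 0) ≤ d * A := by
  rw [← Finset.sum_filter, Finset.sum_const, nsmul_eq_mul]
  gcongr
  have hd : 0 < d := NeZero.pos d
  calc _ ≤ (Finset.Ico (d * q) (d * q + d)).card := by
        refine Finset.card_le_card fun i hi => ?_
        rw [Finset.mem_filter] at hi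
        rw [Finset.mem_Ico, ← hi.2]
        exact ⟨Nat.mul_div_le i d, Nat.lt_mul_div_succ i hd |>.trans_eq (by ring)⟩
    _ = d := by simp

/-- The tents of level `m` have disjoint supports, so only the one over the dyadic interval
containing `s` can be nonzero. Its position is read off from `⌊2^m s⌋`; the quotient `i / d` is the
Haar index minus one. -/
theorem norm_sq_S_le {m i : ℕ} (h1 : d * 2 ^ m ≤ i) (h2 : i < d * 2 ^ (m + 1)) {s : ℝ}
    (hs : 0 ≤ s) : ‖S d (i + 1) s‖ ^ 2 ≤
      if i / d = 2 ^ m + ⌊2 ^ m * s⌋₊ then ((2 : ℝ) ^ m)⁻¹ else 0 := by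
  have hd : 0 < d := NeZero.pos d
  have h1' : 2 ^ m ≤ i / d := (Nat.le_div_iff_mul_le hd).2 (by rwa [mul_comm])
  have h2' : i / d < 2 ^ (m + 1) := (Nat.div_lt_iff_lt_mul hd).2 (by rwa [mul_comm])
  have hpos : 0 < i / d := (pow_pos two_pos m).trans_le h1'
  have hlog : Nat.log 2 (i / d) = m := Nat.log_eq_of_pow_le_of_lt_pow h1' h2'
  have hS := S_of_pos (d := d) (n := i + 1) (s := s) (by simpa using hpos) hs
  simp only [Nat.add_sub_cancel, hlog] at hS
  rw [hS, norm_smul]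
  simp only [PiLp.norm_single, norm_one, mul_one, Real.norm_eq_abs, sq_abs]
  split_ifs with h
  · exact tent_sq_le _ _ _
  · rw [tent_eq_zero, zero_pow two_ne_zero]
    by_contra! hcon
    refine h ?_
    have hp : (0 : ℝ) < 2 ^ m := by positivity
    rw [div_lt_iff₀ hp, lt_div_iff₀ hp] at hcon
    have hle : 2 ^ m ≤ i / d + 1 := by omega
    have hcast : ((i / d + 1 - 2 ^ m : ℕ) : ℝ) = ((i / d - 2 ^ m : ℕ) : ℝ) + 1 := by
      rw [Nat.sub_add_comm h1']
      push_cast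
      ring
    rw [hcast] at hcon
    have : ⌊2 ^ m * s⌋₊ = i / d - 2 ^ m := by
      rw [Nat.floor_eq_iff (by positivity)]
      constructor <;> linarith
    omega

/-- The condition on the weights bounds `∑ₙ λₙ |Sₙ(s)|²` uniformly in `s`. -/
theorem exists_sum_norm_sq_S_le {lam : ℕ → ℝ} (hlam_pos : ∀ n, 1 ≤ n → 0 < lam n)
    (hlam_mono : ∀ k n, 1 ≤ k → k ≤ n → lam k ≤ lam n) {c : ℕ → ℕ}
    (hlam_sum : Summable fun p : ℕ => lam (idx d c (p + 1) 1) / 2 ^ (p + 1)) :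
    ∃ M : ℝ, 0 ≤ M ∧ ∀ (s : unitInterval) (N : ℕ),
      ∑ n ∈ Finset.range N, lam (n + 1) * ‖S d (n + 1) s‖ ^ 2 ≤ M := by
  have hd : 0 < d := NeZero.pos d
  set b : ℕ → ℝ := fun p => lam (idx d c (p + 1) 1) / 2 ^ (p + 1) with hb
  have hb0 : ∀ p, 0 ≤ b p := fun p => by
    have := hlam_pos (idx d c (p + 1) 1) (by unfold idx; omega)
    positivity
  have hblock : ∀ (s : unitInterval) (m : ℕ), ∑ n ∈ Finset.Ico (d * 2 ^ m) (d * 2 ^ (m + 1)),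
      lam (n + 1) * ‖S d (n + 1) s‖ ^ 2 ≤ d * (4 * b (m + 1)) := by
    intro s m
    refine le_trans (Finset.sum_le_sum fun n hn => ?_)
      (sum_Ico_ite_div_eq_le (d * 2 ^ m) (d * 2 ^ (m + 1)) (2 ^ m + ⌊2 ^ m * (s : ℝ)⌋₊)
        (mul_nonneg (by norm_num) (hb0 (m + 1))))
    rw [Finset.mem_Ico] at hn
    have h1 := norm_sq_S_le hn.1 hn.2 s.2.1
    -- The index with `p = m + 2`, `j = 1` is at least `2^(m+1) d + 1`, which lies past the whole
    -- block of level `m`. The shift from `2^(m+2)` to `2^m` accounts for the factor `4` in front of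
    -- `b (m + 1)`.
    have h2 : lam (n + 1) ≤ lam (idx d c (m + 1 + 1) 1) := by
      refine hlam_mono _ _ (by omega) ?_
      unfold idx
      simp only [Nat.add_sub_cancel]
      calc n + 1 ≤ 2 ^ (m + 1) * d + 1 := by rw [mul_comm]; omega
        _ ≤ _ := Nat.le_add_right _ _
    have h3 : 0 < lam (n + 1) := hlam_pos _ (by omega)
    split_ifs at h1 ⊢ with h
    · calc lam (n + 1) * ‖S d (n + 1) s‖ ^ 2
          ≤ lam (idx d c (m + 1 + 1) 1) * ((2 : ℝ) ^ m)⁻¹ :=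
            mul_le_mul h2 h1 (sq_nonneg _) (h3.le.trans h2)
        _ = _ := by
          simp only [hb]
          rw [pow_succ, pow_succ]
          field_simp
          norm_num
    · nlinarith
  refine ⟨d * lam d + ∑' m, d * (4 * b (m + 1)), ?_, fun s N => ?_⟩
  · have := hlam_pos d hd
    have : 0 ≤ ∑' m, d * (4 * b (m + 1)) := tsum_nonneg fun m => by
      have := hb0 (m + 1)
      positivity
    positivity
  have hsum : Summable fun m => d * (4 * b (m + 1)) :=
    (((summable_nat_add_iff 1).2 hlam_sum).mul_left 4).mul_left (d : ℝ)
  have hterm0 : ∀ n, 0 ≤ lam (n + 1) * ‖S d (n + 1) s‖ ^ 2 := fun n => by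
    have := hlam_pos (n + 1) (by omega)
    positivity
  -- The first `d` terms belong to `H₁ = 1` and give `d λ_d`; after that, the Haar levels are added
  -- one by one.
  have hL : ∀ L, ∑ n ∈ Finset.range (d * 2 ^ L), lam (n + 1) * ‖S d (n + 1) s‖ ^ 2 ≤
      d * lam d + ∑ m ∈ Finset.range L, d * (4 * b (m + 1)) := by
    intro L
    induction L with
    | zero =>
      simp only [pow_zero, mul_one, Finset.range_zero, Finset.sum_empty, add_zero]
      calc _ ≤ ∑ n ∈ Finset.range d, lam d := by
            refine Finset.sum_le_sum fun n hn => ?_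
            rw [Finset.mem_range] at hn
            have h1 : lam (n + 1) ≤ lam d := hlam_mono _ _ (by omega) hn
            have h3 := hlam_pos (n + 1) (by omega)
            rw [S_of_le (by simpa using Nat.div_eq_of_lt hn), norm_smul]
            simp only [PiLp.norm_single, norm_one, mul_one, Real.norm_eq_abs, sq_abs]
            have := s.2.1
            have := s.2.2
            have : (s : ℝ) ^ 2 ≤ 1 := by nlinarith
            nlinarith
        _ = _ := by simp
    | succ L ih =>
      have hle : d * 2 ^ L ≤ d * 2 ^ (L + 1) :=
        Nat.mul_le_mul_left _ (Nat.pow_le_pow_right two_pos (by omega))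
      rw [Finset.range_eq_Ico, ← Finset.sum_Ico_consecutive _ (Nat.zero_le _) hle,
        ← Finset.range_eq_Ico, Finset.sum_range_succ _ L]
      have := hblock s L
      linarith
  calc _ ≤ ∑ n ∈ Finset.range (d * 2 ^ N), lam (n + 1) * ‖S d (n + 1) s‖ ^ 2 := by
        refine Finset.sum_le_sum_of_subset_of_nonneg (Finset.range_mono ?_) fun n _ _ => hterm0 n
        exact (Nat.lt_two_pow_self (n := N)).le.trans (Nat.le_mul_of_pos_left _ hd)
    _ ≤ _ := (hL N).trans (by
        gcongr
        exact hsum.sum_le_tsum _ fun m _ => by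
          have := hb0 (m + 1)
          positivity)

end WienerForm

/-! ### Gaussian integration by parts -/

/-- Integration by parts for a centred Gaussian measure on the line. -/
theorem integral_deriv_gaussianReal {V : NNReal} (hV : V ≠ 0) {f f' : ℝ → ℝ}
    (hf : ∀ x, HasDerivAt f (f' x) x) (h0 : Integrable f (gaussianReal 0 V))
    (h1 : Integrable f' (gaussianReal 0 V))
    (h2 : Integrable (fun x => f x * x) (gaussianReal 0 V)) :
    V * ∫ x, f' x ∂gaussianReal 0 V = ∫ x, f x * x ∂gaussianReal 0 V := by
  have hV' : (V : ℝ) ≠ 0 := by exact_mod_cast hV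
  set p := gaussianPDFReal 0 V with hp
  have hpd : ∀ x, HasDerivAt p (-(x / V) * p x) x := by
    intro x
    have h3 : HasDerivAt (fun x : ℝ => -(x - 0) ^ 2 / (2 * V)) (-(x / V)) x := by
      have := (((hasDerivAt_id x).pow 2).neg).div_const (2 * (V : ℝ))
      simp only [sub_zero]
      refine this.congr_deriv ?_
      simp only [id]
      field_simp
      norm_num
    have := (h3.exp).const_mul (√(2 * Real.pi * V))⁻¹
    refine this.congr_deriv ?_
    simp only [hp, gaussianPDFReal]
    ring
  have hInt : ∀ {g : ℝ → ℝ}, Integrable g (gaussianReal 0 V) → Integrable fun x => p x * g x := by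
    intro g hg
    rw [gaussianReal_of_var_ne_zero 0 hV] at hg
    have := (integrable_withDensity_iff_integrable_smul' (measurable_gaussianPDF 0 V)
      (ae_of_all _ fun x => gaussianPDF_lt_top)).1 hg
    simpa [toReal_gaussianPDF, smul_eq_mul, hp] using this
  -- The density satisfies `p' = -(x/V) p`, and the derivative of the integrable function `p f` has
  -- integral zero.
  have key := integral_eq_zero_of_hasDerivAt_of_integrable
    (f := fun x => p x * f x) (f' := fun x => -(x / V) * p x * f x + p x * f' x)
    (fun x => (hpd x).mul (hf x)) ?_ (hInt h0)
  · rw [integral_gaussianReal_eq_integral_smul hV, integral_gaussianReal_eq_integral_smul hV]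
    simp only [smul_eq_mul, ← hp]
    have e : (fun x => -(x / V) * p x * f x + p x * f' x) =
        fun x => p x * f' x - (V : ℝ)⁻¹ * (p x * (f x * x)) := by
      funext x
      field_simp
      ring
    rw [e, integral_sub (hInt h1) ((hInt h2).const_mul _), integral_const_mul] at key
    have h3 : ∫ x, p x * f' x = (V : ℝ)⁻¹ * ∫ x, p x * (f x * x) := by linarith
    rw [h3, ← mul_assoc, mul_inv_cancel₀ hV', one_mul]
  · have e : (fun x => -(x / V) * p x * f x + p x * f' x) =
        fun x => p x * f' x - (V : ℝ)⁻¹ * (p x * (f x * x)) := by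
      funext x
      field_simp
      ring
    rw [e]
    exact (hInt h1).sub ((hInt h2).const_mul _)

namespace WienerForm

variable {d : ℕ} {ν : Measure (Omega d)}

theorem continuous_eval (t : unitInterval) : Continuous fun γ : Omega d => γ.1 t :=
  ((ContinuousMap.evalCLM ℝ t).comp (paths d).subtypeL).continuous

namespace IsWienerMeasure

theorem hasGaussianLaw_eval (hν : IsWienerMeasure ν) (t : unitInterval) :
    HasGaussianLaw (fun γ : Omega d => γ.1 t) ν where
  isGaussian_map := by
    have h := hν.gauss 0 t t.2.1
    have h0 : (fun γ : Omega d => γ.1 t - γ.1 0) = fun γ => γ.1 t := by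
      funext γ
      have : γ.1 0 = 0 := γ.2
      simp [this]
    rw [h0] at h
    rw [h]
    exact isGaussian_map (μ := stdGaussian (E d))
      ((√((t : ℝ) - ((0 : unitInterval) : ℝ))) • ContinuousLinearMap.id ℝ (E d))

theorem isGaussianProcess (hν : IsWienerMeasure ν) :
    IsGaussianProcess (fun (t : unitInterval) (γ : Omega d) => γ.1 t) ν :=
  HasIndepIncrements.isGaussianProcess hν.hasGaussianLaw_eval
    (ae_of_all _ fun γ => γ.2) hν.indep

theorem memLp_inner_eval (hν : IsWienerMeasure ν) (t : unitInterval) (x : E d) :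
    MemLp (fun γ : Omega d => inner ℝ x (γ.1 t)) 2 ν :=
  ((hν.hasGaussianLaw_eval t).map (innerSL ℝ x)).memLp_two

theorem covariance_increment (hν : IsWienerMeasure ν) {s t : unitInterval} (hst : s ≤ t)
    (x y : E d) : cov[fun γ : Omega d => inner ℝ x (γ.1 t - γ.1 s),
      fun γ => inner ℝ y (γ.1 t - γ.1 s); ν] = ((t : ℝ) - s) * inner ℝ x y := by
  have h0 : (0 : ℝ) ≤ (t : ℝ) - s := sub_nonneg.2 hst
  have hm : Measurable fun γ : Omega d => γ.1 t - γ.1 s :=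
    ((continuous_eval t).sub (continuous_eval s)).measurable
  have h1 := covariance_map_fun (μ := ν) (Z := fun γ : Omega d => γ.1 t - γ.1 s)
    (X := fun u => inner ℝ x u) (Y := fun u => inner ℝ y u)
    (by fun_prop) (by fun_prop) hm.aemeasurable
  rw [← h1, hν.gauss s t hst, covariance_map_fun (by fun_prop) (by fun_prop) (by fun_prop)]
  simp only [inner_smul_right]
  rw [covariance_const_mul_left, covariance_const_mul_right,
    ← covarianceBilin_apply_eq_cov IsGaussian.memLp_two_id, covarianceBilin_stdGaussian,
    ← mul_assoc, Real.mul_self_sqrt h0]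
  rfl

theorem integral_inner_eval (hν : IsWienerMeasure ν) (t : unitInterval) (x : E d) :
    ∫ γ : Omega d, inner ℝ x (γ.1 t) ∂ν = 0 := by
  have h := hν.gauss 0 t t.2.1
  have h0 : (fun γ : Omega d => γ.1 t - γ.1 0) = fun γ => γ.1 t := by
    funext γ
    have : γ.1 0 = 0 := γ.2
    simp [this]
  rw [h0] at h
  have h1 := integral_map (μ := ν) (φ := fun γ : Omega d => γ.1 t) (f := fun u => inner ℝ x u)
    (continuous_eval t).measurable.aemeasurable (by fun_prop)
  rw [← h1, h, integral_map (by fun_prop) (by fun_prop)]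
  simp only [inner_smul_right]
  rw [integral_const_mul]
  have := integral_strongDual_stdGaussian (innerSL ℝ x)
  simp only [innerSL_apply_apply] at this
  rw [this, mul_zero]

theorem covariance_eval (hν : IsWienerMeasure ν) (s t : unitInterval) (x y : E d) :
    cov[fun γ : Omega d => inner ℝ x (γ.1 s), fun γ => inner ℝ y (γ.1 t); ν] =
      min (s : ℝ) t * inner ℝ x y := by
  have := hν.prob
  have key : ∀ (s t : unitInterval) (x y : E d), s ≤ t →
      cov[fun γ : Omega d => inner ℝ x (γ.1 s), fun γ => inner ℝ y (γ.1 t); ν] =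
        (s : ℝ) * inner ℝ x y := by
    intro s t x y hst
    have hz : ∀ γ : Omega d, γ.1 0 = 0 := fun γ => γ.2
    have h1 : (fun γ : Omega d => inner ℝ y (γ.1 t)) =
        (fun γ => inner ℝ y (γ.1 s)) + fun γ => inner ℝ y (γ.1 t - γ.1 s) := by
      funext γ
      simp [inner_sub_right]
    have hsub : MemLp (fun γ : Omega d => inner ℝ y (γ.1 t - γ.1 s)) 2 ν := by
      simp only [inner_sub_right]
      exact (hν.memLp_inner_eval t y).sub (hν.memLp_inner_eval s y)
    rw [h1, covariance_add_right (hν.memLp_inner_eval s x) (hν.memLp_inner_eval s y) hsub]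
    have h2 := hν.covariance_increment (s := 0) (t := s) s.2.1 x y
    simp only [hz, sub_zero] at h2
    rw [h2]
    have hind : IndepFun (fun γ : Omega d => γ.1 s) (fun γ : Omega d => γ.1 t - γ.1 s) ν :=
      hν.indep.indepFun_eval_sub s.2.1 hst (ae_of_all _ hz)
    have hind2 := hind.comp (φ := fun u => inner ℝ x u) (ψ := fun u => inner ℝ y u)
      (by fun_prop) (by fun_prop)
    have h3 := hind2.covariance_eq_zero (hν.memLp_inner_eval s x) hsub
    simp only [Function.comp_def] at h3
    rw [h3]
    simp
  rcases le_total s t with h | h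
  · rw [key s t x y h, min_eq_left (by exact_mod_cast h)]
  · rw [covariance_comm, key t s y x h, min_eq_right (by exact_mod_cast h), real_inner_comm]

/-- Under the Wiener measure, `γ - σ⁻² ⟨v, γ(τ)⟩ ray τ v`, with `σ² = τ |v|²`, is independent of
`⟨v, γ(τ)⟩`. -/
theorem indepFun_sub_ray (hν : IsWienerMeasure ν) {n : ℕ} (t : Fin n → unitInterval)
    (τ : unitInterval) (v : E d) (hσ : 0 < (τ : ℝ) * ‖v‖ ^ 2) :
    IndepFun (fun γ : Omega d => evalFamily t γ -
        (inner ℝ v (γ.1 τ) / ((τ : ℝ) * ‖v‖ ^ 2)) • evalFamily t (ray τ v))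
      (fun γ => inner ℝ v (γ.1 τ)) ν := by
  have := hν.prob
  set σ := (τ : ℝ) * ‖v‖ ^ 2 with hσdef
  let X : Fin n → Omega d → E d := fun i γ =>
    γ.1 (t i) - (inner ℝ v (γ.1 τ) / σ) • (ray τ v).1 (t i)
  -- The scalar `⟨v, γ(τ)⟩` is carried by the vector `⟨v, γ(τ)⟩ v`, so that both families take
  -- values in the same space and form one Gaussian process. It is recovered at the end by pairing
  -- with `v` and dividing by `|v|²`.
  let Y : Unit → Omega d → E d := fun _ γ => inner ℝ v (γ.1 τ) • v
  have hX : ∀ i, Continuous (X i) := fun i => (continuous_eval (t i)).sub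
    (((continuous_const.inner (continuous_eval τ)).div_const σ).smul continuous_const)
  have hY : ∀ i, Continuous (Y i) := fun i =>
    Continuous.smul (f := fun γ : Omega d => inner ℝ v (γ.1 τ))
      (continuous_const.inner (continuous_eval τ)) continuous_const
  have hjoint : IsGaussianProcess (Sum.elim X Y) ν := by
    classical
    refine hν.isGaussianProcess.of_isGaussianProcess fun p => ?_
    rcases p with i | u
    · refine ⟨{t i, τ}, ContinuousLinearMap.proj (R := ℝ) (φ := fun _ => E d)
        (⟨t i, by simp⟩ : ({t i, τ} : Finset unitInterval)) -
        ContinuousLinearMap.smulRight ((σ⁻¹ • innerSL ℝ v).comp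
          (ContinuousLinearMap.proj (R := ℝ) (φ := fun _ => E d)
          (⟨τ, by simp⟩ : ({t i, τ} : Finset unitInterval)))) ((ray τ v).1 (t i)), fun γ => ?_⟩
      simp [X, div_eq_inv_mul]
    · refine ⟨{τ}, ContinuousLinearMap.smulRight ((innerSL ℝ v).comp
          (ContinuousLinearMap.proj (R := ℝ) (φ := fun _ => E d)
          (⟨τ, by simp⟩ : ({τ} : Finset unitInterval)))) v, fun γ => ?_⟩
      simp [Y]
  have hcov : ∀ i u x y, cov[fun γ => inner ℝ x (X i γ), fun γ => inner ℝ y (Y u γ); ν] = 0 := by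
    intro i u x y
    have e1 : (fun γ => inner ℝ x (X i γ)) = (fun γ : Omega d => inner ℝ x (γ.1 (t i))) -
        fun γ : Omega d => (inner ℝ x ((ray τ v).1 (t i)) / σ) * inner ℝ v (γ.1 τ) := by
      funext γ
      simp only [X, inner_sub_right, inner_smul_right, Pi.sub_apply]
      ring
    have e2 : (fun γ => inner ℝ y (Y u γ)) = fun γ : Omega d => inner ℝ y v * inner ℝ v (γ.1 τ) := by
      funext γ
      simp only [Y, inner_smul_right]
      ring
    rw [e1, e2, covariance_const_mul_right, covariance_sub_left (hν.memLp_inner_eval _ _)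
      ((hν.memLp_inner_eval τ v).const_mul _) (hν.memLp_inner_eval τ v),
      covariance_const_mul_left, hν.covariance_eval, hν.covariance_eval, min_self,
      real_inner_self_eq_norm_sq, ← hσdef, div_mul_cancel₀ _ hσ.ne']
    have : inner ℝ x ((ray τ v).1 (t i)) = min (t i : ℝ) τ * inner ℝ x v := by
      simp [ray, inner_smul_right, min_comm]
    rw [this, sub_self, mul_zero]
  have h := hjoint.indepFun_of_covariance_inner (fun i => (hX i).measurable.aemeasurable)
    (fun u => (hY u).measurable.aemeasurable) hcov
  have hv : ‖v‖ ^ 2 ≠ 0 := fun h => by simp [hσdef, h] at hσ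
  have h2 := h.comp (φ := id) (ψ := fun y : Unit → E d => inner ℝ v (y ()) / ‖v‖ ^ 2)
    measurable_id (by fun_prop)
  have e3 : ((fun y : Unit → E d => inner ℝ v (y ()) / ‖v‖ ^ 2) ∘ fun γ u => Y u γ) =
      fun γ : Omega d => inner ℝ v (γ.1 τ) := by
    funext γ
    simp only [Function.comp_apply, Y, inner_smul_right, real_inner_self_eq_norm_sq]
    exact mul_div_cancel_right₀ _ hv
  rw [e3] at h2
  exact h2

/-- Integration by parts for the Wiener measure in the direction of `u ↦ (τ ∧ u) v`. -/
theorem integral_fderiv_ray (hν : IsWienerMeasure ν) (hInt : ∀ F ∈ Z d, Integrable F ν)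
    {F : Omega d → ℝ} (hF : F ∈ Z d) (τ : unitInterval) (v : E d) :
    ∫ γ, fderiv ℝ F γ (ray τ v) ∂ν = ∫ γ, F γ * inner ℝ v (γ.1 τ) ∂ν := by
  have := hν.prob
  have hσ0 : 0 ≤ (τ : ℝ) * ‖v‖ ^ 2 := mul_nonneg τ.2.1 (sq_nonneg _)
  -- If the variance vanishes, then `τ = 0` or `v = 0`: the direction and the pairing are both zero.
  rcases hσ0.eq_or_lt with hσ | hσ
  · have h1 : ray τ v = 0 ∧ ∀ γ : Omega d, inner ℝ v (γ.1 τ) = (0 : ℝ) := by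
      rcases mul_eq_zero.1 hσ.symm with h | h
      · have hτ : τ = 0 := Subtype.ext h
        subst hτ
        refine ⟨Subtype.ext (ContinuousMap.ext fun s => ?_), fun γ => ?_⟩
        · simp [ray, s.2.1]
        · have : γ.1 0 = 0 := γ.2
          simp [this]
      · have hv : v = 0 := by simpa using h
        subst hv
        refine ⟨Subtype.ext (ContinuousMap.ext fun s => ?_), fun γ => by simp⟩
        simp [ray]
    simp [h1.1, h1.2]
  have hFd := fderiv_mem_Z hF (ray τ v)
  have hFW := mul_mem_Z hF (inner_eval_mem_Z τ v)
  obtain ⟨n, t, f, hf, rfl⟩ := mem_Z_iff.1 hF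
  set σ := (τ : ℝ) * ‖v‖ ^ 2 with hσdef
  set h := evalFamily t (ray τ v) with hh
  set W : Omega d → ℝ := fun γ => inner ℝ v (γ.1 τ) with hW
  set Y : Omega d → (Fin n → E d) := fun γ => evalFamily t γ - (W γ / σ) • h with hY
  have hWm : Measurable W := (continuous_const.inner (continuous_eval τ)).measurable
  have hYm : Measurable Y := ((evalFamily t).continuous.sub
    (((continuous_const.inner (continuous_eval τ)).div_const σ).smul continuous_const)).measurable
  have hind : IndepFun Y W ν := hν.indepFun_sub_ray t τ v hσ
  have hfd : Differentiable ℝ f := hf.1.differentiable (by simp)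
  let V : NNReal := ⟨σ, hσ0⟩
  have hV : V ≠ 0 := fun h0 => hσ.ne' (congrArg NNReal.toReal h0)
  have hlaw : ν.map W = gaussianReal 0 V := by
    have := ((hν.hasGaussianLaw_eval τ).map (innerSL ℝ v)).map_eq_gaussianReal
    have e : (innerSL ℝ v) ∘ (fun γ : Omega d => γ.1 τ) = W := rfl
    rw [e] at this
    rw [this, hν.integral_inner_eval τ v, ← covariance_self hWm.aemeasurable,
      hν.covariance_eval τ τ v v, min_self, real_inner_self_eq_norm_sq]
    congr 1
    exact NNReal.eq (Real.coe_toNNReal _ hσ0)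
  obtain ⟨μ, hμ⟩ : ∃ μ, μ = ν.map Y := ⟨_, rfl⟩
  have hμp : IsProbabilityMeasure μ := hμ ▸ Measure.isProbabilityMeasure_map hYm.aemeasurable
  have hprod : ν.map (fun γ => (Y γ, W γ)) = μ.prod (gaussianReal 0 V) := by
    rw [← hlaw, hμ]
    exact (indepFun_iff_map_prod_eq_prod_map_map hYm.aemeasurable hWm.aemeasurable).1 hind
  -- The path is moved along the ray by `W/σ` while the independent part `Y` is frozen. Fubini
  -- leaves a one-dimensional Gaussian integration by parts in `W`, whose variance `σ` cancels the
  -- `σ⁻¹` produced by the chain rule.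
  have hrec : ∀ γ, evalFamily t γ = Y γ + (W γ / σ) • h := fun γ => by simp [hY]
  have hpair : Measurable fun γ => (Y γ, W γ) := hYm.prodMk hWm
  have tr : ∀ {G : (Fin n → E d) × ℝ → ℝ}, Continuous G →
      Integrable (fun γ => G (Y γ, W γ)) ν →
      Integrable G (μ.prod (gaussianReal 0 V)) ∧
      ∫ γ, G (Y γ, W γ) ∂ν = ∫ y, ∫ w, G (y, w) ∂gaussianReal 0 V ∂μ := by
    intro G hG hi
    have h1 : Integrable G (μ.prod (gaussianReal 0 V)) := by
      rw [← hprod]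
      exact (integrable_map_measure hG.aestronglyMeasurable hpair.aemeasurable).2 hi
    refine ⟨h1, ?_⟩
    rw [← integral_prod _ h1, ← hprod, integral_map hpair.aemeasurable hG.aestronglyMeasurable]
  have hcd : Continuous fun x => fderiv ℝ f x h := (hf.fderiv_apply h).1.continuous
  have hcc : Continuous fun p : (Fin n → E d) × ℝ => p.1 + (p.2 / σ) • h := by fun_prop
  obtain ⟨i0, -⟩ := tr (G := fun p => f (p.1 + (p.2 / σ) • h)) (hfd.continuous.comp hcc) (by
    simpa only [← hrec] using hInt _ hF)
  obtain ⟨i1, e1⟩ := tr (G := fun p => fderiv ℝ f (p.1 + (p.2 / σ) • h) h) (hcd.comp hcc) (by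
    simp_rw [fderiv_comp_evalFamily t hf] at hFd
    simpa only [← hrec] using hInt _ hFd)
  obtain ⟨i2, e2⟩ := tr (G := fun p => f (p.1 + (p.2 / σ) • h) * p.2)
    ((hfd.continuous.comp hcc).mul continuous_snd) (by
    simpa only [← hrec] using hInt _ hFW)
  simp only [← hrec] at e1 e2
  simp_rw [fderiv_comp_evalFamily t hf]
  rw [← hh, e1, e2]
  refine integral_congr_ae ?_
  filter_upwards [i0.prod_right_ae, i1.prod_right_ae, i2.prod_right_ae] with y h0 h1 h2
  have hder : ∀ w, HasDerivAt (fun w : ℝ => f (y + (w / σ) • h))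
      (σ⁻¹ * fderiv ℝ f (y + (w / σ) • h) h) w := by
    intro w
    have h3 : HasDerivAt (fun w : ℝ => y + (w / σ) • h) ((1 / σ) • h) w :=
      (((hasDerivAt_id w).div_const σ).smul_const h).const_add y
    have := (hfd (y + (w / σ) • h)).hasFDerivAt.comp_hasDerivAt w h3
    refine this.congr_deriv ?_
    simp
  have := integral_deriv_gaussianReal hV hder h0 (h1.const_mul _) h2
  rw [integral_const_mul, ← mul_assoc] at this
  have hVσ : (V : ℝ) * σ⁻¹ = 1 := mul_inv_cancel₀ hσ.ne'
  rw [hVσ, one_mul] at this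
  exact this

/-- Integration by parts in the direction of a Schauder function. -/
theorem exists_integral_fderiv_schauder [NeZero d] (hν : IsWienerMeasure ν)
    (hInt : ∀ F ∈ Z d, Integrable F ν) (n : ℕ) : ∃ W ∈ Z d, ∀ F ∈ Z d,
      ∫ γ, fderiv ℝ F γ (schauder d n) ∂ν = ∫ γ, F γ * W γ ∂ν := by
  obtain ⟨τ, v, h⟩ := exists_schauder_eq_sum_ray (d := d) n
  refine ⟨fun γ => ∑ i, inner ℝ (v i) (γ.1 (τ i)),
    sum_mem_Z _ fun i _ => inner_eval_mem_Z (τ i) (v i), fun F hF => ?_⟩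
  simp_rw [h, map_sum, Finset.mul_sum]
  rw [integral_finsetSum _ fun i _ => hInt _ (fderiv_mem_Z hF _),
    integral_finsetSum _ fun i _ => hInt _ (mul_mem_Z hF (inner_eval_mem_Z (τ i) (v i)))]
  exact Finset.sum_congr rfl fun i _ => hν.integral_fderiv_ray hInt hF (τ i) (v i)

end IsWienerMeasure
end WienerForm

/-! ### Cylindrical functions determine integrable functions -/

open scoped ContDiff in
/-- If `ψ` is orthogonal to the smooth compactly supported functions of `e`, it has integral zero
over the preimages under `e`. -/
theorem setIntegral_preimage_eq_zero {X V : Type*} [MeasurableSpace X] [NormedAddCommGroup V]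
    [NormedSpace ℝ V] [FiniteDimensional ℝ V] [MeasurableSpace V] [BorelSpace V]
    {μ : Measure X} [IsFiniteMeasure μ] {e : X → V} (he : Measurable e) {ψ : X → ℝ}
    (hψ : Integrable ψ μ)
    (h : ∀ g : V → ℝ, ContDiff ℝ ∞ g → HasCompactSupport g → ∫ x, g (e x) * ψ x ∂μ = 0)
    {B : Set V} (hB : MeasurableSet B) : ∫ x in e ⁻¹' B, ψ x ∂μ = 0 := by
  have hm := he.comap_le
  -- The conditional expectation of `ψ` given `e` factors as `k ∘ e`. The hypothesis makes `k`
  -- orthogonal to all test functions under the law of `e`, so `k` vanishes almost everywhere.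
  obtain ⟨k, hk, hkeq⟩ := (stronglyMeasurable_condExp (f := ψ) (μ := μ)
    (m := MeasurableSpace.comap e inferInstance)).exists_eq_measurable_comp
  have hkint : Integrable k (μ.map e) := by
    rw [integrable_map_measure hk.aestronglyMeasurable he.aemeasurable, ← hkeq]
    exact integrable_condExp
  have hk0 : ∀ᵐ x ∂μ.map e, k x = 0 := by
    refine ae_eq_zero_of_integral_contDiff_smul_eq_zero hkint.locallyIntegrable
      fun g hg hgs => ?_
    rw [integral_map (f := fun x => g x • k x) he.aemeasurable
      (hg.continuous.aestronglyMeasurable.smul hk.aestronglyMeasurable)]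
    have hsm : StronglyMeasurable[MeasurableSpace.comap e inferInstance] (fun x => g (e x)) :=
      (hg.continuous.measurable.comp (comap_measurable _)).stronglyMeasurable
    obtain ⟨C, hC⟩ : ∃ C, ∀ x, ‖g x‖ ≤ C := hg.continuous.bounded_above_of_compact_support hgs
    have hgi : Integrable (fun x => g (e x) * ψ x) μ :=
      hψ.bdd_mul (hg.continuous.measurable.comp he).aestronglyMeasurable
        (ae_of_all _ fun x => hC _)
    have h1 := condExp_mul_of_stronglyMeasurable_left hsm hgi hψ
    have h2 : ∫ x, g (e x) • k (e x) ∂μ =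
        ∫ x, (μ[fun x => g (e x) * ψ x | MeasurableSpace.comap e inferInstance]) x ∂μ := by
      refine integral_congr_ae ?_
      refine EventuallyEq.trans (ae_of_all _ fun x => ?_) h1.symm
      simp [hkeq]
    rw [h2, integral_condExp hm]
    exact h g hg hgs
  rw [← setIntegral_condExp hm hψ ⟨B, hB, rfl⟩, hkeq]
  have : k ∘ e =ᵐ[μ] 0 := ae_of_ae_map he.aemeasurable hk0
  rw [setIntegral_congr_ae (g := fun _ => 0) (he hB) (this.mono fun γ hγ _ => hγ)]
  simp

namespace WienerForm

variable {d : ℕ}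

theorem isClosed_paths (d : ℕ) : IsClosed (paths d : Set C(unitInterval, E d)) :=
  isClosed_eq (ContinuousMap.evalCLM ℝ (0 : unitInterval)).continuous continuous_const

instance instCompleteSpaceOmega (d : ℕ) : CompleteSpace (Omega d) :=
  (isClosed_paths d).completeSpace_coe

theorem setIntegral_evalFamily_preimage_eq_zero {μ : Measure (Omega d)} [IsFiniteMeasure μ]
    {ψ : Omega d → ℝ} (hψ : Integrable ψ μ) (h : ∀ G ∈ Z d, ∫ γ, G γ * ψ γ ∂μ = 0)
    {ι : Type*} [Fintype ι] (t : ι → unitInterval) {B : Set (ι → E d)} (hB : MeasurableSet B) :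
    ∫ γ in evalFamily t ⁻¹' B, ψ γ ∂μ = 0 :=
  setIntegral_preimage_eq_zero (evalFamily t).continuous.measurable hψ
    (fun _ hg hgs => h _ (comp_evalFamily_mem_Z t (hgs.hasTemperateGrowth hg))) hB

/-- The cylindrical functions determine integrable functions. -/
theorem ae_eq_zero_of_forall_integral_Z_eq_zero {μ : Measure (Omega d)} [IsFiniteMeasure μ]
    {ψ : Omega d → ℝ} (hψ : Integrable ψ μ) (h : ∀ G ∈ Z d, ∫ γ, G γ * ψ γ ∂μ = 0) :
    ψ =ᵐ[μ] 0 := by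
  refine hψ.ae_eq_zero_of_forall_setIntegral_eq_zero fun A hA _ => ?_
  let e : Omega d → (ℕ → E d) := fun γ n => γ.1 (TopologicalSpace.denseSeq unitInterval n)
  have hec : Continuous e := continuous_pi fun n => continuous_eval _
  have hei : Function.Injective e := by
    intro γ γ' hγ
    refine Subtype.ext (ContinuousMap.ext fun s => ?_)
    have : (γ.1 : unitInterval → E d) = γ'.1 :=
      (TopologicalSpace.denseRange_denseSeq unitInterval).equalizer γ.1.continuous
        γ'.1.continuous (funext fun n => congrFun hγ n)
    exact congrFun this s
  -- Lusin-Souslin: a continuous injection of the Polish space `Ω` is a measurable embedding. Every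
  -- Borel set is thus a preimage under evaluation at countably many times, and a π-λ argument
  -- reduces it to cylinders.
  have hem := hec.measurableEmbedding hei
  have hB : ∀ B : Set (ℕ → E d), MeasurableSet B → ∫ γ in e ⁻¹' B, ψ γ ∂μ = 0 := by
    intro B hB
    induction B, hB using MeasurableSpace.induction_on_inter
      (generateFrom_measurableCylinders (α := fun _ : ℕ => E d)).symm
      isPiSystem_measurableCylinders with
    | empty => simp
    | basic B hB =>
      obtain ⟨s, S, hS, rfl⟩ := (mem_measurableCylinders _).1 hB
      exact setIntegral_evalFamily_preimage_eq_zero hψ h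
        (fun i : s => TopologicalSpace.denseSeq unitInterval i) hS
    | compl B hB ih =>
      have h1 := integral_add_compl (hec.measurable hB) hψ
      have h2 := h _ (const_mem_Z 1)
      simp only [one_mul] at h2
      rw [ih, h2, zero_add] at h1
      exact h1
    | iUnion f hdisj hf ih =>
      rw [Set.preimage_iUnion, integral_iUnion (fun i => hec.measurable (hf i))
        (fun i j hij => (hdisj hij).preimage e) hψ.integrableOn]
      simp [ih]
  have hAe : e ⁻¹' (e '' A) = A := hei.preimage_image A
  rw [← hAe]
  exact hB _ (hem.measurableSet_image.2 hA)

end WienerForm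

/-! ### Closed forms from closed graphs -/

namespace DirForm

variable {X : Type*} [MeasurableSpace X] {m : Measure X} {K : Type*} [NormedAddCommGroup K]
  [InnerProductSpace ℝ K]

/-- The form `⟨T u, T v⟩` of a linear operator `T` from `L²(m)` to `K`, given by its graph. -/
def formOfGraph (G : Submodule ℝ (Lp ℝ 2 m × K)) : SymmForm m where
  -- `toLinearPMap` takes the value zero if `G` is not single-valued; the hypothesis `hG` of the
  -- lemmas below excludes this.
  dom := G.toLinearPMap.domain
  form := (innerₗ K).compl₁₂ G.toLinearPMap.toFun G.toLinearPMap.toFun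
  symm u v := by simp [LinearMap.compl₁₂_apply, real_inner_comm]
  nonneg u := by simp [LinearMap.compl₁₂_apply]

variable {G : Submodule ℝ (Lp ℝ 2 m × K)}

/-- The values of the operator with graph `G`. -/
def graphValue (G : Submodule ℝ (Lp ℝ 2 m × K)) (u : (formOfGraph G).dom) : K := G.toLinearPMap u

theorem formOfGraph_form (u v : (formOfGraph G).dom) :
    (formOfGraph G).form u v = inner ℝ (graphValue G u) (graphValue G v) := rfl

theorem formOfGraph_form_self (u : (formOfGraph G).dom) :
    (formOfGraph G).form u u = ‖graphValue G u‖ ^ 2 := by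
  rw [formOfGraph_form, real_inner_self_eq_norm_sq]

theorem mem_dom_formOfGraph {p : Lp ℝ 2 m × K} (hp : p ∈ G) : p.1 ∈ (formOfGraph G).dom :=
  Submodule.mem_map.2 ⟨p, hp, rfl⟩

theorem graphValue_sub (u v : (formOfGraph G).dom) :
    graphValue G (u - v) = graphValue G u - graphValue G v :=
  map_sub G.toLinearPMap.toFun u v

theorem E1_sub (u v : (formOfGraph G).dom) : (formOfGraph G).E1 (u - v) =
    ‖graphValue G u - graphValue G v‖ ^ 2 + ‖(u : Lp ℝ 2 m) - v‖ ^ 2 := by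
  rw [SymmForm.E1, formOfGraph_form_self, graphValue_sub]
  rfl

theorem mk_graphValue_mem (hG : ∀ p ∈ G, p.1 = 0 → p.2 = 0)
    (u : (formOfGraph G).dom) :
    ((u : Lp ℝ 2 m), graphValue G u) ∈ G :=
  G.mem_graph_toLinearPMap (fun p hp h => hG p hp h) u

theorem graphValue_eq (hG : ∀ p ∈ G, p.1 = 0 → p.2 = 0)
    {p : Lp ℝ 2 m × K} (hp : p ∈ G) (u : (formOfGraph G).dom)
    (hu : (u : Lp ℝ 2 m) = p.1) : graphValue G u = p.2 := by
  have h := hG _ (G.sub_mem (mk_graphValue_mem hG u) hp) (by simp [hu])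
  exact sub_eq_zero.1 h

theorem tendsto_E1_sub (hG : ∀ p ∈ G, p.1 = 0 → p.2 = 0)
    {u : ℕ → (formOfGraph G).dom} {v : (formOfGraph G).dom}
    {p : ℕ → Lp ℝ 2 m × K} (hp : ∀ n, p n ∈ G) (hu : ∀ n, (u n : Lp ℝ 2 m) = (p n).1)
    (hlim : Tendsto p atTop (𝓝 ((v : Lp ℝ 2 m), graphValue G v))) :
    Tendsto (fun n => (formOfGraph G).E1 (u n - v)) atTop (𝓝 0) := by
  have h1 : Tendsto (fun n => (p n).1 - (v : Lp ℝ 2 m)) atTop (𝓝 0) := by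
    simpa using (hlim.fst_nhds.sub_const (v : Lp ℝ 2 m))
  have h2 : Tendsto (fun n => (p n).2 - graphValue G v) atTop (𝓝 0) := by
    simpa using (hlim.snd_nhds.sub_const (graphValue G v))
  have h3 := (h2.norm.pow 2).add (h1.norm.pow 2)
  simp only [norm_zero, ne_eq, OfNat.ofNat_ne_zero, not_false_eq_true, zero_pow, add_zero] at h3
  refine h3.congr fun n => ?_
  rw [E1_sub, hu n, graphValue_eq hG (hp n) (u n) (hu n)]

/-- `ℰ₁^{1/2}` is equivalent to the product norm on the graph, so density in the domain can be
checked by closures in the product space. -/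
theorem isE1Dense_of_forall_tendsto (hG : ∀ p ∈ G, p.1 = 0 → p.2 = 0)
    {A : Set (formOfGraph G).dom}
    (h : ∀ v : (formOfGraph G).dom, ((v : Lp ℝ 2 m), graphValue G v) ∈
      closure {p | p ∈ G ∧ ∃ u ∈ A, (u : Lp ℝ 2 m) = p.1}) : (formOfGraph G).IsE1Dense A := by
  intro v ε hε
  obtain ⟨p, hp, hlim⟩ := mem_closure_iff_seq_limit.1 (h v)
  choose hpG u hu hup using hp
  obtain ⟨n, hn⟩ := ((tendsto_E1_sub hG hpG hup hlim).eventually (gt_mem_nhds hε)).exists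
  refine ⟨u n, hu n, ?_⟩
  have : (formOfGraph G).E1 (v - u n) = (formOfGraph G).E1 (u n - v) := by
    rw [E1_sub, E1_sub, norm_sub_rev, norm_sub_rev (v : Lp ℝ 2 m)]
  rwa [this]

variable [CompleteSpace K]

theorem isClosedForm_formOfGraph (hG : ∀ p ∈ G, p.1 = 0 → p.2 = 0)
    (hGc : IsClosed (G : Set (Lp ℝ 2 m × K))) : (formOfGraph G).IsClosedForm := by
  intro u hu
  have hcau : CauchySeq fun n => ((u n : Lp ℝ 2 m), graphValue G (u n)) := by
    refine Metric.cauchySeq_iff.2 fun ε hε => ?_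
    obtain ⟨N, hN⟩ := hu (ε ^ 2) (by positivity)
    refine ⟨N, fun k hk l hl => ?_⟩
    have h := hN k hk l hl
    rw [E1_sub] at h
    rw [dist_eq_norm, Prod.norm_def, max_lt_iff]
    constructor
    · refine lt_of_pow_lt_pow_left₀ 2 hε.le (lt_of_le_of_lt ?_ h)
      exact le_add_of_nonneg_left (sq_nonneg _)
    · refine lt_of_pow_lt_pow_left₀ 2 hε.le (lt_of_le_of_lt ?_ h)
      exact le_add_of_nonneg_right (sq_nonneg _)
  obtain ⟨p, hp⟩ := cauchySeq_tendsto_of_complete hcau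
  have hpG : p ∈ G := hGc.mem_of_tendsto hp (Eventually.of_forall fun n => mk_graphValue_mem hG _)
  refine ⟨⟨p.1, mem_dom_formOfGraph hpG⟩, tendsto_E1_sub hG
    (fun n => mk_graphValue_mem hG (u n)) (fun n => rfl) ?_⟩
  rwa [graphValue_eq hG hpG _ rfl]

/-- Lower semicontinuity of the energy. -/
theorem exists_mem_graph_of_tendsto (hGc : IsClosed (G : Set (Lp ℝ 2 m × K)))
    {p : ℕ → Lp ℝ 2 m × K} (hp : ∀ k, p k ∈ G) {u : Lp ℝ 2 m} {M : ℝ}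
    (hu : Tendsto (fun k => (p k).1) atTop (𝓝 u)) (hM : ∀ k, ‖(p k).2‖ ≤ M) :
    ∃ y, (u, y) ∈ G ∧ ‖y‖ ≤ M := by
  obtain ⟨y, q, hq, hlim, hy⟩ := exists_convexHull_tendsto_of_bounded_snd hu hM
  refine ⟨y, hGc.mem_of_tendsto hlim (Eventually.of_forall fun k => ?_), hy⟩
  refine convexHull_min ?_ G.convex (hq k)
  rintro _ ⟨j, -, rfl⟩
  exact hp j

/-- Lower semicontinuity of the energy along a sequence with convergent energy bounds. -/
theorem exists_mem_graph_of_tendsto_norm (hG : ∀ p ∈ G, p.1 = 0 → p.2 = 0)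
    (hGc : IsClosed (G : Set (Lp ℝ 2 m × K))) {p : ℕ → Lp ℝ 2 m × K}
    (hp : ∀ k, p k ∈ G) {u : Lp ℝ 2 m} {b : ℕ → ℝ} {M : ℝ}
    (hu : Tendsto (fun k => (p k).1) atTop (𝓝 u))
    (hb : ∀ k, ‖(p k).2‖ ≤ b k) (hM : Tendsto b atTop (𝓝 M)) :
    ∃ y, (u, y) ∈ G ∧ ‖y‖ ≤ M := by
  have key : ∀ δ > 0, ∃ y, (u, y) ∈ G ∧ ‖y‖ ≤ M + δ := by
    intro δ hδ
    obtain ⟨N, hN⟩ := eventually_atTop.1 (hM.eventually (ge_mem_nhds (lt_add_of_pos_right M hδ)))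
    exact exists_mem_graph_of_tendsto hGc (p := fun k => p (k + N)) (fun k => hp _)
      (hu.comp (tendsto_add_atTop_nat N)) (fun k => (hb _).trans (hN _ (by omega)))
  -- The values found for different `δ` coincide because the graph is single-valued.
  obtain ⟨y, hy, -⟩ := key 1 one_pos
  refine ⟨y, hy, le_of_forall_pos_le_add fun δ hδ => ?_⟩
  obtain ⟨z, hz, hzM⟩ := key δ hδ
  have : y - z = 0 := hG _ (G.sub_mem hy hz) (by simp)
  rwa [sub_eq_zero.1 this]

end DirForm

/-! ### The weight, the gradient graph and closability -/

namespace WienerForm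

variable {d : ℕ} {ν : Measure (Omega d)} {φ : Omega d → ℝ} {C : ℝ}

/-- The conditions on the density `φ`: it is bounded, positive, and `F / φ` is integrable for all
cylindrical functions `F`. -/
structure IsAdmissibleWeight (ν : Measure (Omega d)) (φ : Omega d → ℝ) (C : ℝ) : Prop where
  aemeasurable : AEMeasurable φ ν
  bound : ∀ᵐ γ ∂ν, 0 < φ γ ∧ φ γ ≤ C
  integrable_div : ∀ F ∈ Z d, Integrable (fun γ => F γ / φ γ) ν

namespace IsAdmissibleWeight

/-- Integrability of cylindrical functions under `ν` is read off from the hypothesis on the weight;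
no Gaussian moment estimate enters. -/
theorem integrable (h : IsAdmissibleWeight ν φ C) {F : Omega d → ℝ} (hF : F ∈ Z d) :
    Integrable F ν := by
  have h1 := (h.integrable_div F hF).mul_bdd (c := |C|) h.aemeasurable.aestronglyMeasurable (by
    filter_upwards [h.bound] with γ hγ
    rw [Real.norm_eq_abs]
    exact abs_le_abs_of_nonneg hγ.1.le hγ.2)
  refine h1.congr ?_
  filter_upwards [h.bound] with γ hγ
  exact div_mul_cancel₀ _ hγ.1.ne'

theorem aemeasurable_ofReal (h : IsAdmissibleWeight ν φ C) :
    AEMeasurable (fun γ => ENNReal.ofReal (φ γ)) ν := h.aemeasurable.ennreal_ofReal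

theorem weighted_le (h : IsAdmissibleWeight ν φ C) : weighted ν φ ≤ ENNReal.ofReal C • ν := by
  have h1 : weighted ν φ ≤ ν.withDensity fun _ => ENNReal.ofReal C :=
    withDensity_mono (h.bound.mono fun γ hγ => ENNReal.ofReal_le_ofReal hγ.2)
  rwa [withDensity_const] at h1

theorem ae_weighted_iff (h : IsAdmissibleWeight ν φ C) {p : Omega d → Prop} :
    (∀ᵐ γ ∂weighted ν φ, p γ) ↔ ∀ᵐ γ ∂ν, p γ := by
  refine ⟨fun hp => ?_, fun hp => (withDensity_absolutelyContinuous ν _).ae_le hp⟩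
  refine (withDensity_absolutelyContinuous' h.aemeasurable_ofReal ?_).ae_le hp
  filter_upwards [h.bound] with γ hγ
  simpa using hγ.1

theorem isFiniteMeasure_weighted [IsFiniteMeasure ν] (h : IsAdmissibleWeight ν φ C) :
    IsFiniteMeasure (weighted ν φ) := by
  have : IsFiniteMeasure (ENNReal.ofReal C • ν) := Measure.smul_finite ν ENNReal.ofReal_ne_top
  exact isFiniteMeasure_of_le _ h.weighted_le

theorem integrable_weighted (h : IsAdmissibleWeight ν φ C) {G : Omega d → ℝ}
    (hG : Integrable G ν) : Integrable G (weighted ν φ) :=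
  (hG.smul_measure ENNReal.ofReal_ne_top).mono_measure h.weighted_le

theorem integral_weighted_le (h : IsAdmissibleWeight ν φ C) {G : Omega d → ℝ}
    (hG : Integrable G ν) (hG0 : ∀ γ, 0 ≤ G γ) :
    ∫ γ, G γ ∂weighted ν φ ≤ |C| * ∫ γ, G γ ∂ν := by
  calc ∫ γ, G γ ∂weighted ν φ ≤ ∫ γ, G γ ∂(ENNReal.ofReal C • ν) :=
        integral_mono_measure h.weighted_le (ae_of_all _ hG0)
          (hG.smul_measure ENNReal.ofReal_ne_top)
    _ = (ENNReal.ofReal C).toReal * ∫ γ, G γ ∂ν := by rw [integral_smul_measure, smul_eq_mul]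
    _ ≤ _ := by
      refine mul_le_mul_of_nonneg_right ?_ (integral_nonneg hG0)
      rw [ENNReal.toReal_ofReal']
      exact max_le (le_abs_self C) (abs_nonneg C)

theorem integral_weighted (h : IsAdmissibleWeight ν φ C) (G : Omega d → ℝ) :
    ∫ γ, G γ ∂weighted ν φ = ∫ γ, φ γ * G γ ∂ν := by
  rw [weighted, integral_withDensity_eq_integral_toReal_smul₀ h.aemeasurable_ofReal
    (ae_of_all _ fun γ => ENNReal.ofReal_lt_top)]
  refine integral_congr_ae ?_
  filter_upwards [h.bound] with γ hγ
  simp [ENNReal.toReal_ofReal hγ.1.le]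

theorem integrable_weighted_iff (h : IsAdmissibleWeight ν φ C) {G : Omega d → ℝ} :
    Integrable G (weighted ν φ) ↔ Integrable (fun γ => φ γ * G γ) ν := by
  rw [weighted, integrable_withDensity_iff_integrable_smul₀' h.aemeasurable_ofReal
    (ae_of_all _ fun γ => ENNReal.ofReal_lt_top)]
  refine integrable_congr ?_
  filter_upwards [h.bound] with γ hγ
  simp [ENNReal.toReal_ofReal hγ.1.le]

/-- `(F/φ)² φ = F²/φ`, and `F²` is again cylindrical. -/
theorem memLp_div (h : IsAdmissibleWeight ν φ C) {F : Omega d → ℝ} (hF : F ∈ Z d) :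
    MemLp (fun γ => F γ / φ γ) 2 (weighted ν φ) := by
  have hm : AEStronglyMeasurable (fun γ => F γ / φ γ) (weighted ν φ) :=
    ((continuous_of_mem_Z hF).measurable.aemeasurable.div
      (h.aemeasurable.mono_ac (withDensity_absolutelyContinuous ν _))).aestronglyMeasurable
  rw [memLp_two_iff_integrable_sq hm, h.integrable_weighted_iff]
  refine (h.integrable_div _ (pow_mem_Z hF 2)).congr ?_
  filter_upwards [h.bound] with γ hγ
  have := hγ.1.ne'
  field_simp

theorem integral_mul_div (h : IsAdmissibleWeight ν φ C) (u F : Omega d → ℝ) :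
    ∫ γ, u γ * (F γ / φ γ) ∂weighted ν φ = ∫ γ, F γ * u γ ∂ν := by
  rw [h.integral_weighted]
  refine integral_congr_ae ?_
  filter_upwards [h.bound] with γ hγ
  have := hγ.1.ne'
  field_simp

/-- Testing against `F/φ` cancels the weight, so integration by parts is needed only for `ν` and no
derivative of `φ` appears. -/
theorem inner_toLp_div (h : IsAdmissibleWeight ν φ C) {F : Omega d → ℝ} (hF : F ∈ Z d)
    (u : Lp ℝ 2 (weighted ν φ)) :
    inner ℝ u ((h.memLp_div hF).toLp _) = ∫ γ, F γ * u γ ∂ν := by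
  rw [← h.integral_mul_div, L2.inner_def]
  refine integral_congr_ae ?_
  filter_upwards [(h.memLp_div hF).coeFn_toLp] with γ hγ
  rw [hγ]
  simp [mul_comm]

/-- The functions `F / φ`, with `F` cylindrical, are total in `L²(φν)`. -/
theorem eq_zero_of_forall_inner_div [IsFiniteMeasure ν] (h : IsAdmissibleWeight ν φ C)
    {u : Lp ℝ 2 (weighted ν φ)}
    (hu : ∀ F, ∀ hF : F ∈ Z d, inner ℝ u ((h.memLp_div hF).toLp _) = 0) : u = 0 := by
  have hInt : Integrable (u : Omega d → ℝ) ν := by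
    -- `u` and `1/φ` both lie in `L²(φν)`, so `u = u · (1/φ) · φ` is integrable with respect to `ν`.
    have h1 : Integrable (fun γ => u γ * ((1 : ℝ) / φ γ)) (weighted ν φ) :=
      (Lp.memLp u).integrable_mul (h.memLp_div (const_mem_Z 1))
    rw [h.integrable_weighted_iff] at h1
    refine h1.congr ?_
    filter_upwards [h.bound] with γ hγ
    have := hγ.1.ne'
    field_simp
  have h0 := ae_eq_zero_of_forall_integral_Z_eq_zero hInt fun F hF => by
    rw [← h.inner_toLp_div hF, hu F hF]
  rw [Lp.eq_zero_iff_ae_eq_zero]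
  exact h.ae_weighted_iff.2 h0

end IsAdmissibleWeight

variable [NeZero d] {m : Measure (Omega d)} {lam : ℕ → ℝ}

/-- The graph of `F ↦ (√λₙ ⟨Sₙ, D F⟩)ₙ` on the cylindrical functions. -/
def gradGraph (lam : ℕ → ℝ) (m : Measure (Omega d)) :
    Submodule ℝ (Lp ℝ 2 m × lp (fun _ : ℕ => Lp ℝ 2 m) 2) where
  carrier := {p | ∃ F ∈ Z d, p.1 =ᵐ[m] F ∧
    ∀ n, p.2 n =ᵐ[m] fun γ => √(lam (n + 1)) * fderiv ℝ F γ (schauder d (n + 1))}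
  add_mem' := by
    rintro p q ⟨F, hF, hp1, hp2⟩ ⟨G, hG, hq1, hq2⟩
    refine ⟨F + G, add_mem_Z hF hG, ?_, fun n => ?_⟩
    · exact (Lp.coeFn_add _ _).trans (hp1.add hq1)
    · refine (Lp.coeFn_add _ _).trans (((hp2 n).add (hq2 n)).trans (ae_of_all _ fun γ => ?_))
      simp only [Pi.add_apply]
      rw [fderiv_add_apply_of_mem_Z hF hG, mul_add]
  zero_mem' := by
    refine ⟨fun _ => 0, const_mem_Z 0, Lp.coeFn_zero _ _ _, fun n => ?_⟩
    refine (Lp.coeFn_zero _ _ _).trans (ae_of_all _ fun γ => ?_)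
    simp
  smul_mem' := by
    rintro c p ⟨F, hF, hp1, hp2⟩
    refine ⟨c • F, smul_mem_Z c hF, ?_, fun n => ?_⟩
    · exact (Lp.coeFn_smul _ _).trans (hp1.const_smul c)
    · refine (Lp.coeFn_smul _ _).trans (((hp2 n).const_smul c).trans (ae_of_all _ fun γ => ?_))
      simp only [Pi.smul_apply]
      rw [fderiv_smul_apply_of_mem_Z hF, smul_eq_mul, mul_left_comm]

/-- The uniform bound on the Schauder functions: `∑ₙ λₙ |Sₙ(s)|² ≤ M` for all `s`. -/
def SchauderBound (d : ℕ) [NeZero d] (lam : ℕ → ℝ) (M : ℝ) : Prop :=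
  ∀ (s : unitInterval) (N : ℕ), ∑ n ∈ Finset.range N, lam (n + 1) * ‖S d (n + 1) s‖ ^ 2 ≤ M

/-- The derivative in direction `Sₙ` is controlled by the values of `Sₙ` at the `k` times of `F`,
and the Schauder bound is summed over those times. -/
theorem finiteEnergy_of_mem_Z (hlam : ∀ n, 0 < lam (n + 1)) {M : ℝ}
    (hM : SchauderBound d lam M) (hm : ∀ F ∈ Z d, Integrable F m) {F : Omega d → ℝ}
    (hF : F ∈ Z d) : FiniteEnergy lam m F := by
  simp only [FiniteEnergy, cmInner_S_D hF]
  have hInt : ∀ n, Integrable (fun γ => fderiv ℝ F γ (schauder d (n + 1)) ^ 2) m := fun n =>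
    hm _ (pow_mem_Z (fderiv_mem_Z hF _) 2)
  refine ⟨hInt, ?_⟩
  obtain ⟨k, t, G, hG, hG0, hFG⟩ := exists_sq_fderiv_le hF
  refine summable_of_sum_range_le (c := k * M * ∫ γ, G γ ∂m) (fun n => ?_) fun N => ?_
  · exact mul_nonneg (hlam n).le (integral_nonneg fun γ => sq_nonneg _)
  · have hI : 0 ≤ ∫ γ, G γ ∂m := integral_nonneg hG0
    calc ∑ n ∈ Finset.range N, lam (n + 1) * ∫ γ, fderiv ℝ F γ (schauder d (n + 1)) ^ 2 ∂m
        ≤ ∑ n ∈ Finset.range N, lam (n + 1) *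
          ((∑ i, ‖S d (n + 1) (t i)‖ ^ 2) * ∫ γ, G γ ∂m) := by
          refine Finset.sum_le_sum fun n _ => mul_le_mul_of_nonneg_left ?_ (hlam n).le
          rw [← integral_const_mul]
          exact integral_mono (hInt n) ((hm G hG).const_mul _) fun γ => hFG γ _
      _ = (∑ i, ∑ n ∈ Finset.range N, lam (n + 1) * ‖S d (n + 1) (t i)‖ ^ 2) * ∫ γ, G γ ∂m := by
          rw [Finset.sum_comm, Finset.sum_mul]
          refine Finset.sum_congr rfl fun n _ => ?_
          rw [← mul_assoc, Finset.mul_sum]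
      _ ≤ (∑ i : Fin k, M) * ∫ γ, G γ ∂m :=
          mul_le_mul_of_nonneg_right (Finset.sum_le_sum fun i _ => hM (t i) N) hI
      _ = _ := by simp

theorem exists_mem_gradGraph (hlam : ∀ n, 0 < lam (n + 1)) (hm : ∀ F ∈ Z d, Integrable F m)
    {F : Omega d → ℝ} (hF : F ∈ Z d) (hE : FiniteEnergy lam m F) :
    ∃ p ∈ gradGraph lam m, p.1 =ᵐ[m] F ∧
      ∀ n, p.2 n =ᵐ[m] fun γ => √(lam (n + 1)) * fderiv ℝ F γ (schauder d (n + 1)) := by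
  have hL2 : ∀ G ∈ Z d, MemLp G 2 m := fun G hG =>
    (memLp_two_iff_integrable_sq (continuous_of_mem_Z hG).aestronglyMeasurable).2
      (hm _ (pow_mem_Z hG 2))
  have hc : ∀ n, MemLp (fun γ => √(lam (n + 1)) * fderiv ℝ F γ (schauder d (n + 1))) 2 m :=
    fun n => (hL2 _ (fderiv_mem_Z hF _)).const_mul _
  have hmem : Memℓp (fun n => (hc n).toLp _) 2 := by
    rw [memℓp_gen_iff (by norm_num)]
    refine hE.2.congr fun n => ?_
    have h1 : ‖(hc n).toLp _‖ ^ 2 = lam (n + 1) *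
        ∫ γ, fderiv ℝ F γ (schauder d (n + 1)) ^ 2 ∂m := by
      rw [← real_inner_self_eq_norm_sq, L2.inner_def, ← integral_const_mul]
      refine integral_congr_ae ?_
      filter_upwards [(hc n).coeFn_toLp] with γ hγ
      rw [hγ]
      simp only [real_inner_self_eq_norm_sq, Real.norm_eq_abs, sq_abs, mul_pow,
        Real.sq_sqrt (hlam n).le]
    simp only [cmInner_S_D hF]
    rw [← h1]
    norm_num
  refine ⟨((hL2 F hF).toLp F, ⟨_, hmem⟩), ?_, ?_, ?_⟩
  · exact ⟨F, hF, (hL2 F hF).coeFn_toLp, fun n => (hc n).coeFn_toLp⟩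
  · exact (hL2 F hF).coeFn_toLp
  · exact fun n => (hc n).coeFn_toLp

/-- The inner product of two gradients is the energy. -/
theorem inner_eq_energy (hlam : ∀ n, 0 < lam (n + 1)) {F G : Omega d → ℝ} (hF : F ∈ Z d)
    (hG : G ∈ Z d) {x y : lp (fun _ : ℕ => Lp ℝ 2 m) 2}
    (hx : ∀ n, x n =ᵐ[m] fun γ => √(lam (n + 1)) * fderiv ℝ F γ (schauder d (n + 1)))
    (hy : ∀ n, y n =ᵐ[m] fun γ => √(lam (n + 1)) * fderiv ℝ G γ (schauder d (n + 1))) :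
    inner ℝ x y = energy lam m F G := by
  rw [lp.inner_eq_tsum, energy]
  refine tsum_congr fun n => ?_
  rw [L2.inner_def, ← integral_const_mul]
  refine integral_congr_ae ?_
  filter_upwards [hx n, hy n] with γ h1 h2
  rw [h1, h2, cmInner_S_D hF, cmInner_S_D hG]
  have := Real.mul_self_sqrt (hlam n).le
  simp only [RCLike.inner_apply, conj_trivial]
  linear_combination (fderiv ℝ F γ (schauder d (n + 1)) * fderiv ℝ G γ (schauder d (n + 1))) * this

theorem norm_sq_eq_energy (hlam : ∀ n, 0 < lam (n + 1)) {F : Omega d → ℝ} (hF : F ∈ Z d)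
    {x : lp (fun _ : ℕ => Lp ℝ 2 m) 2}
    (hx : ∀ n, x n =ᵐ[m] fun γ => √(lam (n + 1)) * fderiv ℝ F γ (schauder d (n + 1))) :
    ‖x‖ ^ 2 = energy lam m F F := by
  rw [← real_inner_self_eq_norm_sq, inner_eq_energy hlam hF hF hx hx]

/-- The closed graph is the graph of an operator: closability by integration by parts. -/
theorem snd_eq_zero_of_mem_closure_gradGraph (hν : IsWienerMeasure ν)
    (h : IsAdmissibleWeight ν φ C)
    {p : Lp ℝ 2 (weighted ν φ) × lp (fun _ : ℕ => Lp ℝ 2 (weighted ν φ)) 2}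
    (hp : p ∈ (gradGraph lam (weighted ν φ)).topologicalClosure) (h1 : p.1 = 0) : p.2 = 0 := by
  have := hν.prob
  have hInt : ∀ F ∈ Z d, Integrable F ν := fun F hF => h.integrable hF
  ext1
  funext n
  refine h.eq_zero_of_forall_inner_div fun G hG => ?_
  obtain ⟨W, hW, hIBP⟩ := hν.exists_integral_fderiv_schauder hInt (n + 1)
  -- Divided by `φ`, this is the adjoint of differentiation along `Sₙ₊₁` applied to `G/φ`. The
  -- resulting identity is continuous in the graph norm, so it persists on the closure, where a zero
  -- first component forces a zero second one.
  have hG' : (fun γ => W γ * G γ) - (fun γ => fderiv ℝ G γ (schauder d (n + 1))) ∈ Z d :=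
    sub_mem_Z (mul_mem_Z hW hG) (fderiv_mem_Z hG _)
  have key : ∀ q ∈ (gradGraph lam (weighted ν φ)).topologicalClosure,
      inner ℝ (q.2 n) ((h.memLp_div hG).toLp _) =
        √(lam (n + 1)) * inner ℝ q.1 ((h.memLp_div hG').toLp _) := by
    intro q hq
    have hcl : IsClosed {q : Lp ℝ 2 (weighted ν φ) × lp (fun _ : ℕ => Lp ℝ 2 (weighted ν φ)) 2 |
        inner ℝ (q.2 n) ((h.memLp_div hG).toLp _) =
        √(lam (n + 1)) * inner ℝ q.1 ((h.memLp_div hG').toLp _)} := by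
      have hcn : Continuous fun q : Lp ℝ 2 (weighted ν φ) ×
          lp (fun _ : ℕ => Lp ℝ 2 (weighted ν φ)) 2 => q.2 n :=
        ((lp.evalCLM ℝ (fun _ : ℕ => Lp ℝ 2 (weighted ν φ)) 2 n).continuous).comp continuous_snd
      exact isClosed_eq (hcn.inner continuous_const)
        (continuous_const.mul (continuous_fst.inner continuous_const))
    refine closure_minimal (fun q hq => ?_) hcl hq
    obtain ⟨F, hF, hq1, hq2⟩ := hq
    show inner ℝ (q.2 n) ((h.memLp_div hG).toLp _) =
        √(lam (n + 1)) * inner ℝ q.1 ((h.memLp_div hG').toLp _)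
    rw [h.inner_toLp_div hG, h.inner_toLp_div hG']
    rw [integral_congr_ae (g := fun γ => √(lam (n + 1)) *
        (G γ * fderiv ℝ F γ (schauder d (n + 1)))) (by
          filter_upwards [h.ae_weighted_iff.1 (hq2 n)] with γ hγ
          rw [hγ]; ring), integral_const_mul]
    congr 1
    have hR : ∫ γ, ((fun γ => W γ * G γ) - fun γ => fderiv ℝ G γ (schauder d (n + 1))) γ *
        q.1 γ ∂ν = ∫ γ, (F γ * G γ) * W γ - F γ * fderiv ℝ G γ (schauder d (n + 1)) ∂ν := by
      refine integral_congr_ae ?_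
      filter_upwards [h.ae_weighted_iff.1 hq1] with γ hγ
      rw [hγ, Pi.sub_apply]
      ring
    rw [hR]
    have hFG := mul_mem_Z hF hG
    rw [integral_sub (hInt _ (mul_mem_Z hFG hW)) (hInt _ (mul_mem_Z hF (fderiv_mem_Z hG _))),
      ← hIBP _ hFG, ← integral_sub (hInt _ (fderiv_mem_Z hFG _))
        (hInt _ (mul_mem_Z hF (fderiv_mem_Z hG _)))]
    refine integral_congr_ae (ae_of_all _ fun γ => ?_)
    simp only [fderiv_mul_apply_of_mem_Z hF hG]
    ring
  rw [key p hp, h1]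
  simp

end WienerForm

/-! ### The closure is a Dirichlet form -/

open scoped ContDiff in
/-- Smooth approximations of the unit contraction. -/
theorem exists_smooth_unitContraction {ε : ℝ} (hε : 0 < ε) : ∃ η : ℝ → ℝ, η.HasTemperateGrowth ∧
    (∀ x, |η x - min (max x 0) 1| ≤ ε) ∧ ∀ x, |deriv η x| ≤ 1 := by
  -- A bump equal to `1` on `[0, 1]` and vanishing outside `[-ε, 1 + ε]`. Its primitive from `0` has
  -- slope between `0` and `1` and differs from the contraction by at most `ε`.
  let θ : ContDiffBump (1 / 2 : ℝ) := ⟨1 / 2, 1 / 2 + ε, by norm_num, by linarith⟩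
  have hθs : ContDiff ℝ ∞ θ := θ.contDiff
  have hθc : Continuous θ := hθs.continuous
  have hθi : ∀ a b, IntervalIntegrable θ volume a b := fun a b => hθc.intervalIntegrable a b
  set η : ℝ → ℝ := fun x => ∫ y in (0 : ℝ)..x, θ y with hη
  have hder : ∀ x, HasDerivAt η (θ x) x := fun x =>
    intervalIntegral.integral_hasDerivAt_right (hθi _ _)
      hθc.aestronglyMeasurable.stronglyMeasurableAtFilter hθc.continuousAt
  have hθ0 : ∀ y, y ≤ -ε ∨ 1 + ε ≤ y → θ y = 0 := by
    intro y hy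
    refine θ.zero_of_le_dist ?_
    show 1 / 2 + ε ≤ dist y (1 / 2)
    rw [Real.dist_eq]
    rcases hy with hy | hy
    · rw [abs_of_nonpos (by linarith)]; linarith
    · rw [abs_of_nonneg (by linarith)]; linarith
  have hθ1 : ∀ y, 0 ≤ y → y ≤ 1 → θ y = 1 := by
    intro y h0 h1
    refine θ.one_of_mem_closedBall ?_
    rw [Metric.mem_closedBall, Real.dist_eq]
    show |y - 1 / 2| ≤ 1 / 2
    rw [abs_le]
    constructor <;> linarith
  have hbound : ∀ x, |η x - min (max x 0) 1| ≤ ε := by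
    intro x
    rcases le_total 0 x with hx | hx
    · have h1 : min 1 x ≤ η x := by
        rw [← WienerForm.integral_stepFun zero_le_one hx]
        refine intervalIntegral.integral_mono_on hx
          (WienerForm.intervalIntegrable_stepFun _ _ _) (hθi _ _) fun y hy => ?_
        unfold WienerForm.stepFun
        split_ifs with h
        · exact (hθ1 y hy.1 h.le).ge
        · exact θ.nonneg
      have h2 : η x ≤ min (1 + ε) x := by
        rw [← WienerForm.integral_stepFun (by linarith) hx]
        refine intervalIntegral.integral_mono_on hx (hθi _ _)
          (WienerForm.intervalIntegrable_stepFun _ _ _) fun y hy => ?_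
        unfold WienerForm.stepFun
        split_ifs with h
        · exact θ.le_one
        · exact (hθ0 y (Or.inr (not_lt.1 h))).le
      rw [max_eq_left hx, min_comm, abs_le]
      have h3 : min (1 + ε) x ≤ min 1 x + ε := by
        rw [min_def, min_def]
        split_ifs <;> linarith
      constructor <;> linarith
    · have e : η x = -∫ y in (0 : ℝ)..(-x), θ (-y) := by
        simp only [hη]
        rw [intervalIntegral.integral_comp_neg, neg_neg, neg_zero,
          intervalIntegral.integral_symm]
      have hx' : 0 ≤ -x := by linarith
      have h1 : 0 ≤ ∫ y in (0 : ℝ)..(-x), θ (-y) :=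
        intervalIntegral.integral_nonneg hx' fun y _ => θ.nonneg
      have h2 : ∫ y in (0 : ℝ)..(-x), θ (-y) ≤ min ε (-x) := by
        rw [← WienerForm.integral_stepFun hε.le hx']
        refine intervalIntegral.integral_mono_on hx'
          ((hθc.comp continuous_neg).intervalIntegrable _ _)
          (WienerForm.intervalIntegrable_stepFun _ _ _) fun y hy => ?_
        unfold WienerForm.stepFun
        split_ifs with h
        · exact θ.le_one
        · exact (hθ0 (-y) (Or.inl (by linarith))).le
      rw [max_eq_right hx, min_eq_left zero_le_one, sub_zero, e, abs_neg, abs_of_nonneg h1]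
      exact h2.trans (min_le_left _ _)
  refine ⟨η, ?_, hbound, fun x => ?_⟩
  · have hf : fderiv ℝ η = fun x => ContinuousLinearMap.lsmul ℝ ℝ (θ x) := by
      funext x
      rw [(hder x).hasFDerivAt.fderiv]
      ext
      simp
    refine Function.HasTemperateGrowth.of_fderiv (k := 0) (C := 1 + ε) ?_
      (fun x => (hder x).differentiableAt) fun x => ?_
    · rw [hf]
      exact (ContinuousLinearMap.lsmul ℝ ℝ : ℝ →L[ℝ] ℝ →L[ℝ] ℝ).hasTemperateGrowth.comp
        (θ.hasCompactSupport.hasTemperateGrowth hθs)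
    · have h1 := abs_le.1 (hbound x)
      have h2 : 0 ≤ min (max x 0) 1 := le_min (le_max_right _ _) zero_le_one
      have h3 : min (max x 0) 1 ≤ 1 := min_le_right _ _
      rw [pow_zero, mul_one, Real.norm_eq_abs, abs_le]
      constructor <;> linarith
  · rw [(hder x).deriv, abs_of_nonneg θ.nonneg]
    exact θ.le_one

theorem lipschitzWith_unitContraction : LipschitzWith 1 fun x : ℝ => min (max x 0) 1 :=
  (LipschitzWith.id.max_const 0).min_const 1

theorem norm_le_of_forall_abs_le {X : Type*} [MeasurableSpace X] {m : Measure X}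
    {x y : lp (fun _ : ℕ => Lp ℝ 2 m) 2}
    (hxy : ∀ n, ∀ᵐ γ ∂m, |x n γ| ≤ |y n γ|) : ‖x‖ ≤ ‖y‖ := by
  refine lp.norm_le_of_forall_sum_le (by norm_num) (norm_nonneg _) fun s => ?_
  refine le_trans (Finset.sum_le_sum fun n _ => ?_) (lp.sum_rpow_le_norm_rpow (by norm_num) y s)
  exact Real.rpow_le_rpow (norm_nonneg _) (Lp.norm_le_norm_of_ae_le (hxy n)) (by norm_num)

namespace WienerForm

variable {d : ℕ} [NeZero d] {m : Measure (Omega d)} {lam : ℕ → ℝ}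

/-- The closure of the form `(ℰ, Z)`. -/
def energyForm (lam : ℕ → ℝ) (m : Measure (Omega d)) : SymmForm m :=
  formOfGraph (gradGraph lam m).topologicalClosure

/-- The standing properties of the form: positive weights, integrability of the cylindrical
functions, finite energies, and closability. -/
structure IsRegularData (lam : ℕ → ℝ) (m : Measure (Omega d)) : Prop where
  lam_pos : ∀ n, 0 < lam (n + 1)
  integrable : ∀ F ∈ Z d, Integrable F m
  finiteEnergy : ∀ F ∈ Z d, FiniteEnergy lam m F
  injective : ∀ p ∈ (gradGraph lam m).topologicalClosure, p.1 = 0 → p.2 = 0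

namespace IsRegularData

theorem exists_mem (h : IsRegularData lam m) {F : Omega d → ℝ} (hF : F ∈ Z d) :
    ∃ p ∈ gradGraph lam m, p.1 =ᵐ[m] F ∧
      ∀ n, p.2 n =ᵐ[m] fun γ => √(lam (n + 1)) * fderiv ℝ F γ (schauder d (n + 1)) :=
  exists_mem_gradGraph h.lam_pos h.integrable hF (h.finiteEnergy F hF)

theorem isClosable (h : IsRegularData lam m) : IsClosable m (Z d) (energy lam m) := by
  intro F hF hF0 hcau
  choose p hp hp1 hp2 using fun n => h.exists_mem (hF n)
  have hdiff : ∀ k l, ‖(p k).2 - (p l).2‖ ^ 2 = energy lam m (F k - F l) (F k - F l) := by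
    intro k l
    refine norm_sq_eq_energy h.lam_pos (sub_mem_Z (hF k) (hF l)) fun n => ?_
    refine (Lp.coeFn_sub _ _).trans (((hp2 k n).sub (hp2 l n)).trans (ae_of_all _ fun γ => ?_))
    have e : F k - F l = F k + (-1 : ℝ) • F l := by simp [sub_eq_add_neg]
    simp only [Pi.sub_apply]
    rw [e, fderiv_add_apply_of_mem_Z (hF k) (smul_mem_Z _ (hF l)),
      fderiv_smul_apply_of_mem_Z (hF l)]
    ring
  have hc : CauchySeq fun n => (p n).2 := by
    refine Metric.cauchySeq_iff.2 fun ε hε => ?_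
    obtain ⟨N, hN⟩ := hcau (ε ^ 2) (by positivity)
    refine ⟨N, fun k hk l hl => ?_⟩
    rw [dist_eq_norm]
    refine lt_of_pow_lt_pow_left₀ 2 hε.le ?_
    rw [hdiff]
    exact hN k hk l hl
  obtain ⟨y, hy⟩ := cauchySeq_tendsto_of_complete hc
  have h1 : Tendsto (fun n => (p n).1) atTop (𝓝 0) := by
    rw [tendsto_zero_iff_norm_tendsto_zero]
    have := (ENNReal.tendsto_toReal ENNReal.zero_ne_top).comp hF0
    refine this.congr fun n => ?_
    rw [Function.comp_apply, Lp.norm_def, eLpNorm_congr_ae (hp1 n)]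
  have hy0 : y = 0 := h.injective (0, y)
    (mem_closure_of_tendsto (h1.prodMk_nhds hy) (Eventually.of_forall hp)) rfl
  have h3 := (hy.norm).pow 2
  rw [hy0] at h3
  simp only [norm_zero, ne_eq, OfNat.ofNat_ne_zero, not_false_eq_true, zero_pow] at h3
  exact h3.congr fun n => norm_sq_eq_energy h.lam_pos (hF n) (hp2 n)

theorem graphValue_ae_eq (h : IsRegularData lam m) {F : Omega d → ℝ} (hF : F ∈ Z d)
    (u : (energyForm lam m).dom) (hu : u.1 =ᵐ[m] F) (n : ℕ) :
    graphValue (gradGraph lam m).topologicalClosure u n =ᵐ[m]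
      fun γ => √(lam (n + 1)) * fderiv ℝ F γ (schauder d (n + 1)) := by
  obtain ⟨p, hp, hp1, hp2⟩ := h.exists_mem hF
  have hup : u.1 = p.1 := Lp.ext (hu.trans hp1.symm)
  rw [graphValue_eq h.injective (Submodule.le_topologicalClosure _ hp) u hup]
  exact hp2 n

theorem isE1Dense_Z (h : IsRegularData lam m) :
    (energyForm lam m).IsE1Dense {u | ∃ F ∈ Z d, u.1 =ᵐ[m] F} := by
  refine isE1Dense_of_forall_tendsto h.injective fun v => ?_
  refine closure_mono ?_ (mk_graphValue_mem h.injective v)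
  intro p hp
  have hp' := Submodule.le_topologicalClosure _ hp
  obtain ⟨F, hF, hp1, -⟩ := hp
  exact ⟨hp', ⟨p.1, mem_dom_formOfGraph hp'⟩, ⟨F, hF, hp1⟩, rfl⟩

theorem isClosureOf (h : IsRegularData lam m) :
    (energyForm lam m).IsClosureOf (Z d) (energy lam m) where
  mem_dom F hF := by
    obtain ⟨p, hp, hp1, -⟩ := h.exists_mem hF
    exact ⟨⟨p.1, mem_dom_formOfGraph (Submodule.le_topologicalClosure _ hp)⟩, hp1⟩
  form_eq F hF G hG u v hu hv :=
    inner_eq_energy h.lam_pos hF hG (h.graphValue_ae_eq hF u hu) (h.graphValue_ae_eq hG v hv)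
  closed := isClosedForm_formOfGraph h.injective (Submodule.isClosed_topologicalClosure _)
  dense := h.isE1Dense_Z

theorem dense_dom [IsFiniteMeasure m] (h : IsRegularData lam m) :
    Dense ((energyForm lam m).dom : Set (Lp ℝ 2 m)) := by
  rw [Submodule.dense_iff_topologicalClosure_eq_top, Submodule.topologicalClosure_eq_top_iff,
    Submodule.eq_bot_iff]
  intro u hu
  rw [Lp.eq_zero_iff_ae_eq_zero]
  refine ae_eq_zero_of_forall_integral_Z_eq_zero
    ((Lp.memLp u).integrable (by norm_num)) fun F hF => ?_
  obtain ⟨p, hp, hp1, -⟩ := h.exists_mem hF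
  have h1 := (Submodule.mem_orthogonal _ _).1 hu p.1
    (mem_dom_formOfGraph (Submodule.le_topologicalClosure _ hp))
  rw [L2.inner_def] at h1
  rw [← h1]
  refine integral_congr_ae ?_
  filter_upwards [hp1] with γ hγ
  rw [hγ]
  simp [mul_comm]

/-- Approximate `u` in the graph by cylindrical `F k` and compose with smooth contractions `η k`. By
the chain rule each gradient component decreases pointwise, the functions converge in `L²`, and
lower semicontinuity bounds the energy of the limit by that of `u`. -/
theorem markov [IsFiniteMeasure m] (h : IsRegularData lam m) (u : (energyForm lam m).dom) :
    ∃ v : (energyForm lam m).dom,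
      (v.1 =ᵐ[m] fun x => min (max (u.1 x) 0) 1) ∧
      (energyForm lam m).form v v ≤ (energyForm lam m).form u u := by
  obtain ⟨p, hp, hlim⟩ := mem_closure_iff_seq_limit.1 (mk_graphValue_mem h.injective u)
  choose F hF hp1 hp2 using hp
  have hε : ∀ k : ℕ, 0 < 1 / ((k : ℝ) + 1) := fun k => by positivity
  choose η hη hηc hηd using fun k : ℕ => exists_smooth_unitContraction (hε k)
  choose q hq hq1 hq2 using fun k => h.exists_mem (comp_mem_Z (hF k) (hη k))
  have c0 : (fun x : ℝ => min (max x 0) 1) 0 = 0 := by simp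
  set c := lipschitzWith_unitContraction.compLp (p := 2) (μ := m) c0 with hc
  have hclose : Tendsto (fun k => (q k).1 - c (p k).1) atTop (𝓝 0) := by
    refine squeeze_zero_norm (a := fun k : ℕ => (measureUnivNNReal m : ℝ) ^ (2 : ENNReal).toReal⁻¹ *
      (1 / ((k : ℝ) + 1))) (fun k => ?_) ?_
    · refine Lp.norm_le_of_ae_bound (hε k).le ?_
      filter_upwards [Lp.coeFn_sub (q k).1 (c (p k).1), hq1 k, hp1 k,
        lipschitzWith_unitContraction.coeFn_compLp c0 (p k).1] with γ h1 h2 h3 h4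
      rw [h1, Pi.sub_apply, h2, h4, Function.comp_apply, h3]
      exact hηc k _
    · simpa using tendsto_one_div_add_atTop_nhds_zero_nat.const_mul
        ((measureUnivNNReal m : ℝ) ^ (2 : ENNReal).toReal⁻¹)
  have hcu : Tendsto (fun k => c (p k).1) atTop (𝓝 (c u.1)) :=
    ((lipschitzWith_unitContraction.continuous_compLp c0).tendsto _).comp hlim.fst_nhds
  have hqu : Tendsto (fun k => (q k).1) atTop (𝓝 (c u.1)) := by
    simpa using hclose.add hcu
  have hbound : ∀ k, ‖(q k).2‖ ≤ ‖(p k).2‖ := by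
    intro k
    refine norm_le_of_forall_abs_le fun n => ?_
    filter_upwards [hp2 k n, hq2 k n] with γ h1 h2
    rw [h1, h2, fderiv_comp_apply_of_mem_Z (hF k) (hη k), abs_mul, abs_mul, abs_mul]
    have := mul_le_mul_of_nonneg_right (hηd k (F k γ))
      (abs_nonneg (fderiv ℝ (F k) γ (schauder d (n + 1))))
    rw [one_mul] at this
    gcongr
  obtain ⟨y, hy, hyM⟩ := exists_mem_graph_of_tendsto_norm h.injective
    (Submodule.isClosed_topologicalClosure _)
    (fun k => Submodule.le_topologicalClosure _ (hq k)) hqu hbound hlim.snd_nhds.norm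
  have hv := graphValue_eq h.injective hy ⟨c u.1, mem_dom_formOfGraph hy⟩ rfl
  refine ⟨⟨c u.1, mem_dom_formOfGraph hy⟩, lipschitzWith_unitContraction.coeFn_compLp c0 u.1, ?_⟩
  refine (formOfGraph_form_self (G := (gradGraph lam m).topologicalClosure)
    ⟨c u.1, mem_dom_formOfGraph hy⟩).trans_le (le_trans ?_
      (formOfGraph_form_self (G := (gradGraph lam m).topologicalClosure) u).ge)
  rw [hv]
  gcongr

theorem isDirichletForm [IsFiniteMeasure m] (h : IsRegularData lam m) :
    (energyForm lam m).IsDirichletForm where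
  dense := h.dense_dom
  closed := h.isClosureOf.closed
  markov := h.markov

end IsRegularData
end WienerForm

/-! ### Dyadic increments and compact sets of paths -/

/-- The dyadic point `k / 2^l`. -/
def dyadicPt (l k : ℕ) : unitInterval := Set.projIcc 0 1 zero_le_one (k / 2 ^ l)

theorem coe_dyadicPt {l k : ℕ} (h : k ≤ 2 ^ l) : (dyadicPt l k : ℝ) = k / 2 ^ l := by
  have h' : (k : ℝ) ≤ 2 ^ l := by exact_mod_cast h
  have : (k : ℝ) / 2 ^ l ∈ Set.Icc (0 : ℝ) 1 :=
    ⟨by positivity, div_le_one_of_le₀ h' (by positivity)⟩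
  rw [dyadicPt, Set.projIcc_of_mem _ this]

theorem dyadicPt_succ (l k : ℕ) : dyadicPt (l + 1) (2 * k) = dyadicPt l k := by
  unfold dyadicPt
  congr 1
  push_cast
  rw [pow_succ']
  field_simp

/-- The index of the largest dyadic point of level `n` that is at most `t`. -/
def dyadicFloor (n : ℕ) (t : unitInterval) : ℕ := ⌊2 ^ n * (t : ℝ)⌋₊

theorem dyadicFloor_le (n : ℕ) (t : unitInterval) : dyadicFloor n t ≤ 2 ^ n := by
  refine Nat.floor_le_of_le ?_
  push_cast
  exact mul_le_of_le_one_right (by positivity) t.2.2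

theorem cast_dyadicFloor_le (n : ℕ) (t : unitInterval) : (dyadicFloor n t : ℝ) ≤ 2 ^ n * t :=
  Nat.floor_le (mul_nonneg (by positivity) t.2.1)

theorem lt_cast_dyadicFloor_add_one (n : ℕ) (t : unitInterval) :
    2 ^ n * (t : ℝ) < dyadicFloor n t + 1 := Nat.lt_floor_add_one _

theorem dyadicFloor_succ (n : ℕ) (t : unitInterval) :
    dyadicFloor (n + 1) t = 2 * dyadicFloor n t ∨
      dyadicFloor (n + 1) t = 2 * dyadicFloor n t + 1 := by
  have h1 := cast_dyadicFloor_le n t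
  have h2 := lt_cast_dyadicFloor_add_one n t
  have h3 := cast_dyadicFloor_le (n + 1) t
  have h4 := lt_cast_dyadicFloor_add_one (n + 1) t
  rw [pow_succ'] at h3 h4
  have h5 : ((2 * dyadicFloor n t : ℕ) : ℝ) < (dyadicFloor (n + 1) t + 1 : ℕ) := by
    push_cast; linarith
  have h6 : ((dyadicFloor (n + 1) t : ℕ) : ℝ) < (2 * dyadicFloor n t + 2 : ℕ) := by
    push_cast; linarith
  have h5 := Nat.cast_lt.1 h5
  have h6 := Nat.cast_lt.1 h6
  omega

theorem tendsto_dyadicPt_dyadicFloor (t : unitInterval) :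
    Tendsto (fun n => dyadicPt n (dyadicFloor n t)) atTop (𝓝 t) := by
  rw [tendsto_iff_dist_tendsto_zero]
  have h0 : Tendsto (fun n : ℕ => (1 / 2 : ℝ) ^ n) atTop (𝓝 0) :=
    tendsto_pow_atTop_nhds_zero_of_lt_one (by norm_num) (by norm_num)
  refine squeeze_zero (fun _ => dist_nonneg) (fun n => ?_) h0
  have h1 := cast_dyadicFloor_le n t
  have h2 := lt_cast_dyadicFloor_add_one n t
  have hp : (0 : ℝ) < 2 ^ n := by positivity
  rw [Subtype.dist_eq, coe_dyadicPt (dyadicFloor_le n t), Real.dist_eq, one_div, inv_pow, abs_le]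
  have e : (dyadicFloor n t : ℝ) / 2 ^ n - t = (dyadicFloor n t - 2 ^ n * t) * (2 ^ n)⁻¹ := by
    field_simp
  have hi : (0 : ℝ) < (2 ^ n)⁻¹ := by positivity
  rw [e]
  constructor <;> nlinarith

/-- A modulus of continuity from the increments over dyadic intervals. -/
theorem dist_le_of_dyadic {β : Type*} [PseudoMetricSpace β] {g : unitInterval → β}
    (hg : Continuous g) {R r : ℝ} (hR : 0 ≤ R) (hr0 : 0 ≤ r) (hr1 : r < 1)
    (h : ∀ l k, k < 2 ^ l → dist (g (dyadicPt l k)) (g (dyadicPt l (k + 1))) ≤ R * r ^ l)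
    {n : ℕ} {s t : unitInterval} (hst : dist s t ≤ 1 / 2 ^ n) :
    dist (g s) (g t) ≤ (2 * (R * r / (1 - r)) + R) * r ^ n := by
  have hstep : ∀ (u : unitInterval) (n : ℕ), dist (g (dyadicPt n (dyadicFloor n u)))
      (g (dyadicPt (n + 1) (dyadicFloor (n + 1) u))) ≤ R * r * r ^ n := by
    intro u n
    rw [← dyadicPt_succ n]
    have hle := dyadicFloor_le (n + 1) u
    rcases dyadicFloor_succ n u with e | e
    · rw [e, dist_self]; positivity
    · rw [e] at hle ⊢
      exact (h (n + 1) _ (by omega)).trans_eq (by ring)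
  -- Chaining: passing from a dyadic floor to the next level costs at most one increment, and the
  -- geometric series bounds the distance to `g u`. Two such tails and one increment at level `n`
  -- give the constant.
  have hfloor : ∀ u : unitInterval,
      dist (g (dyadicPt n (dyadicFloor n u))) (g u) ≤ R * r * r ^ n / (1 - r) := fun u =>
    dist_le_of_le_geometric_of_tendsto r (R * r) hr1 (hstep u)
      ((hg.tendsto u).comp (tendsto_dyadicPt_dyadicFloor u)) n
  have hadj : ∀ a b : unitInterval, a ≤ b → dist a b ≤ 1 / 2 ^ n →
      dist (g (dyadicPt n (dyadicFloor n a))) (g (dyadicPt n (dyadicFloor n b))) ≤ R * r ^ n := by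
    intro a b hab hd
    have hab' : (a : ℝ) ≤ b := hab
    have h1 := cast_dyadicFloor_le n a
    have h2 := lt_cast_dyadicFloor_add_one n a
    have h3 := cast_dyadicFloor_le n b
    have h4 := lt_cast_dyadicFloor_add_one n b
    have hp : (0 : ℝ) < 2 ^ n := by positivity
    rw [Subtype.dist_eq, Real.dist_eq, abs_sub_comm, abs_of_nonneg (by linarith),
      le_div_iff₀ hp] at hd
    have h5 : (2 : ℝ) ^ n * a ≤ 2 ^ n * b := by gcongr
    have h6 : (dyadicFloor n a : ℝ) < (dyadicFloor n b + 1 : ℕ) := by push_cast; linarith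
    have h7 : (dyadicFloor n b : ℝ) < (dyadicFloor n a + 2 : ℕ) := by push_cast; nlinarith
    have h6 := Nat.cast_lt.1 h6
    have h7 := Nat.cast_lt.1 h7
    rcases (by omega : dyadicFloor n b = dyadicFloor n a ∨
      dyadicFloor n b = dyadicFloor n a + 1) with e | e
    · rw [e, dist_self]; positivity
    · have hle := dyadicFloor_le n b
      rw [e] at hle ⊢
      exact h n _ (by omega)
  have hmid : dist (g (dyadicPt n (dyadicFloor n s))) (g (dyadicPt n (dyadicFloor n t))) ≤
      R * r ^ n := by
    rcases le_total s t with hle | hle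
    · exact hadj s t hle hst
    · rw [dist_comm]
      exact hadj t s hle (by rwa [dist_comm])
  have hs := hfloor s
  rw [dist_comm] at hs
  calc dist (g s) (g t) ≤ _ := dist_triangle4 _ _ _ _
    _ ≤ R * r * r ^ n / (1 - r) + R * r ^ n + R * r * r ^ n / (1 - r) :=
      add_le_add (add_le_add hs hmid) (hfloor t)
    _ = _ := by ring

namespace WienerForm

variable {d : ℕ}

/-- The paths whose dyadic increments satisfy a Hölder bound form a compact set. -/
theorem isCompact_of_dyadic_bound {K : Set (Omega d)} (hK : IsClosed K) {R r : ℝ} (hR : 0 ≤ R)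
    (hr0 : 0 ≤ r) (hr1 : r < 1)
    (h : ∀ γ ∈ K, ∀ l k, k < 2 ^ l →
      dist (γ.1 (dyadicPt l k)) (γ.1 (dyadicPt l (k + 1))) ≤ R * r ^ l) : IsCompact K := by
  set B := 2 * (R * r / (1 - r)) + R with hB
  have hmod : ∀ f : BoundedContinuousFunction unitInterval (E d), (∀ l k, k < 2 ^ l →
      dist (f (dyadicPt l k)) (f (dyadicPt l (k + 1))) ≤ R * r ^ l) → ∀ n s t,
      dist s t ≤ 1 / 2 ^ n → dist (f s) (f t) ≤ B * r ^ n := fun f hf n s t hst =>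
    dist_le_of_dyadic f.continuous hR hr0 hr1 hf hst
  let A : Set (BoundedContinuousFunction unitInterval (E d)) := {f | f 0 = 0 ∧ ∀ l k, k < 2 ^ l →
      dist (f (dyadicPt l k)) (f (dyadicPt l (k + 1))) ≤ R * r ^ l}
  have hev : ∀ t, Continuous fun f : BoundedContinuousFunction unitInterval (E d) => f t :=
    fun t => continuous_eval_const t
  have hAc : IsClosed A := by
    have e : A = {f | f 0 = 0} ∩ ⋂ l, ⋂ k, ⋂ (_ : k < 2 ^ l),
        {f | dist (f (dyadicPt l k)) (f (dyadicPt l (k + 1))) ≤ R * r ^ l} := by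
      ext f; simp [A]
    rw [e]
    refine (isClosed_eq (hev 0) continuous_const).inter ?_
    exact isClosed_iInter fun l => isClosed_iInter fun k => isClosed_iInter fun _ =>
      isClosed_le ((hev _).dist (hev _)) continuous_const
  have hA : IsCompact A := by
    -- The modulus at `n = 0`, together with `f 0 = 0`, confines the values to the ball of radius
    -- `B`; letting `n → ∞` gives equicontinuity.
    refine BoundedContinuousFunction.arzela_ascoli₂ (Metric.closedBall 0 B)
      (isCompact_closedBall 0 B) A hAc (fun f t hf => ?_) ?_
    · have := hmod f hf.2 0 t 0 (by
        rw [Subtype.dist_eq, Real.dist_eq]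
        simpa [abs_of_nonneg t.2.1] using t.2.2)
      rw [hf.1] at this
      simpa [Metric.mem_closedBall] using this
    · refine UniformEquicontinuous.equicontinuous (Metric.uniformEquicontinuous_iff.2 ?_)
      intro ε hε
      have hlim : Tendsto (fun n => B * r ^ n) atTop (𝓝 (B * 0)) :=
        (tendsto_pow_atTop_nhds_zero_of_lt_one hr0 hr1).const_mul B
      rw [mul_zero] at hlim
      obtain ⟨n, hn⟩ := (hlim.eventually (gt_mem_nhds hε)).exists
      exact ⟨1 / 2 ^ n, by positivity, fun s t hst f =>
        (hmod f.1 f.2.2 n s t hst.le).trans_lt hn⟩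
  have hiso : Isometry fun γ : Omega d => BoundedContinuousFunction.mkOfCompact γ.1 :=
    (ContinuousMap.isometryEquivBoundedOfCompact unitInterval (E d)).isometry.comp
      isometry_subtype_coe
  refine (hiso.isClosedEmbedding.isCompact_preimage hA).of_isClosed_subset hK fun γ hγ => ?_
  exact ⟨γ.2, h γ hγ⟩

end WienerForm

/-! ### The Besov functional and its gradient -/

/-- Weighted Cauchy-Schwarz applied twice, first to `a` and then to `a²/w`; the constant is `2² ·
2`. -/
theorem sum_pow_four_le {ι : Type*} (s : Finset ι) {a w : ι → ℝ} (hw : ∀ i ∈ s, 0 < w i)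
    (hw2 : ∑ i ∈ s, w i ≤ 2) : (∑ i ∈ s, a i) ^ 4 ≤ 8 * ∑ i ∈ s, a i ^ 4 / w i ^ 3 := by
  have hw0 : 0 ≤ ∑ i ∈ s, w i := Finset.sum_nonneg fun i hi => (hw i hi).le
  have key : ∀ b : ι → ℝ, (∑ i ∈ s, b i) ^ 2 ≤ 2 * ∑ i ∈ s, b i ^ 2 / w i := by
    intro b
    have hb0 : 0 ≤ ∑ i ∈ s, b i ^ 2 / w i :=
      Finset.sum_nonneg fun i hi => div_nonneg (sq_nonneg _) (hw i hi).le
    refine (Finset.sum_sq_le_sum_mul_sum_of_sq_le_mul s (fun i hi => (hw i hi).le)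
      (fun i hi => div_nonneg (sq_nonneg _) (hw i hi).le) fun i hi => le_of_eq ?_).trans
      (mul_le_mul_of_nonneg_right hw2 hb0)
    have := (hw i hi).ne'
    field_simp
  have h1 := key a
  have h2 := key fun i => a i ^ 2 / w i
  have h3 : ∑ i ∈ s, (a i ^ 2 / w i) ^ 2 / w i = ∑ i ∈ s, a i ^ 4 / w i ^ 3 := by
    refine Finset.sum_congr rfl fun i hi => ?_
    have := (hw i hi).ne'
    field_simp
  rw [h3] at h2
  calc (∑ i ∈ s, a i) ^ 4 = ((∑ i ∈ s, a i) ^ 2) ^ 2 := by ring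
    _ ≤ (2 * ∑ i ∈ s, a i ^ 2 / w i) ^ 2 := pow_le_pow_left₀ (sq_nonneg _) h1 2
    _ = 4 * (∑ i ∈ s, a i ^ 2 / w i) ^ 2 := by ring
    _ ≤ _ := by linarith

/-- The dyadic intervals of level less than `M`. -/
def dyadicIdx (M : ℕ) : Finset (Σ _ : ℕ, ℕ) := (Finset.range M).sigma fun l => Finset.range (2 ^ l)

theorem mem_dyadicIdx {M : ℕ} {i : Σ _ : ℕ, ℕ} :
    i ∈ dyadicIdx M ↔ i.1 < M ∧ i.2 < 2 ^ i.1 := by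
  simp [dyadicIdx]

theorem dyadicIdx_mono : Monotone dyadicIdx := fun _ _ h _ hi =>
  mem_dyadicIdx.2 ⟨(mem_dyadicIdx.1 hi).1.trans_le h, (mem_dyadicIdx.1 hi).2⟩

/-- There are `2ˡ` intervals of level `l`, so a bound `4⁻ˡ` per interval leaves the series of `2⁻ˡ`.
-/
theorem sum_dyadicIdx_le (M : ℕ) {a : ℕ → ℝ} {B : ℝ} (hB : 0 ≤ B)
    (ha : ∀ l, a l ≤ B * (1 / 4) ^ l) : ∑ i ∈ dyadicIdx M, a i.1 ≤ 2 * B := by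
  rw [dyadicIdx, Finset.sum_sigma]
  calc ∑ l ∈ Finset.range M, ∑ _k ∈ Finset.range (2 ^ l), a l
      ≤ ∑ l ∈ Finset.range M, B * (1 / 2) ^ l := by
        refine Finset.sum_le_sum fun l _ => ?_
        rw [Finset.sum_const, Finset.card_range, nsmul_eq_mul]
        push_cast
        calc (2 : ℝ) ^ l * a l ≤ 2 ^ l * (B * (1 / 4) ^ l) := by gcongr; exact ha l
          _ = B * (2 * (1 / 4)) ^ l := by rw [mul_pow]; ring
          _ = _ := by norm_num
    _ = B * ∑ l ∈ Finset.range M, (1 / 2 : ℝ) ^ l := by rw [Finset.mul_sum]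
    _ ≤ B * 2 := by
      gcongr
      exact sum_geometric_two_le M
    _ = _ := mul_comm _ _

namespace WienerForm

variable {d : ℕ} {ν : Measure (Omega d)}

/-- The increment of a path over a dyadic interval. -/
def dyadicIncr (i : Σ _ : ℕ, ℕ) (γ : Omega d) : E d :=
  γ.1 (dyadicPt i.1 (i.2 + 1)) - γ.1 (dyadicPt i.1 i.2)

theorem norm_dyadicIncr_pow_mem_Z (i : Σ _ : ℕ, ℕ) (p : ℕ) :
    (fun γ : Omega d => ‖dyadicIncr i γ‖ ^ (2 * p)) ∈ Z d := by
  simp_rw [pow_mul]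
  exact pow_mem_Z (norm_sub_sq_mem_Z _ _) p

theorem dyadicIncr_line (i : Σ _ : ℕ, ℕ) (γ h : Omega d) (r : ℝ) :
    dyadicIncr i (γ + r • h) = dyadicIncr i γ + r • dyadicIncr i h := by
  have e : ∀ t, (γ + r • h).1 t = γ.1 t + r • h.1 t := fun t => rfl
  simp only [dyadicIncr, e, smul_sub]
  abel

theorem continuous_norm_dyadicIncr (i : Σ _ : ℕ, ℕ) :
    Continuous fun γ : Omega d => ‖dyadicIncr i γ‖ :=
  ((continuous_eval _).sub (continuous_eval _)).norm

/-- A truncated Besov functional of the path. -/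
def besov (M : ℕ) (γ : Omega d) : ℝ := ∑ i ∈ dyadicIdx M, 2 ^ i.1 * ‖dyadicIncr i γ‖ ^ 8

/-- The functional controlling the derivatives of `besov M`. -/
def besovGrad (M : ℕ) (γ : Omega d) : ℝ := ∑ i ∈ dyadicIdx M, 8 * 2 ^ i.1 * ‖dyadicIncr i γ‖ ^ 7

theorem besov_mem_Z (M : ℕ) : besov M ∈ Z d :=
  sum_mem_Z _ fun i _ => mul_mem_Z (const_mem_Z _) (norm_dyadicIncr_pow_mem_Z i 4)

theorem besov_mono (γ : Omega d) : Monotone fun M => besov M γ := fun _ _ h =>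
  Finset.sum_le_sum_of_subset_of_nonneg (dyadicIdx_mono h) fun _ _ _ => by positivity

theorem besov_nonneg (M : ℕ) (γ : Omega d) : 0 ≤ besov M γ :=
  Finset.sum_nonneg fun _ _ => by positivity

theorem continuous_besovGrad (M : ℕ) : Continuous (besovGrad (d := d) M) :=
  continuous_finsetSum _ fun i _ => ((continuous_norm_dyadicIncr i).pow 7).const_mul _

theorem fderiv_besov (M : ℕ) (γ h : Omega d) : fderiv ℝ (besov M) γ h = ∑ i ∈ dyadicIdx M,
    2 ^ i.1 * (8 * ‖dyadicIncr i γ‖ ^ 6 * inner ℝ (dyadicIncr i γ) (dyadicIncr i h)) := by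
  refine (hasDerivAt_line (besov_mem_Z M) γ h).unique ?_
  simp only [besov]
  refine HasDerivAt.fun_sum fun i _ => HasDerivAt.const_mul _ ?_
  have h1 : HasDerivAt (fun r : ℝ => dyadicIncr i (γ + r • h)) (dyadicIncr i h) 0 := by
    simp only [dyadicIncr_line]
    simpa using ((hasDerivAt_id (0 : ℝ)).smul_const (dyadicIncr i h)).const_add (dyadicIncr i γ)
  have h2 := (h1.norm_sq).fun_pow 4
  simp only [zero_smul, add_zero] at h2
  convert h2 using 1
  · funext r; ring
  · push_cast; ring

theorem abs_fderiv_besov_le (M : ℕ) (γ h : Omega d) : |fderiv ℝ (besov M) γ h| ≤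
    ∑ i ∈ dyadicIdx M, 8 * 2 ^ i.1 * ‖dyadicIncr i γ‖ ^ 7 * ‖dyadicIncr i h‖ := by
  rw [fderiv_besov]
  refine (Finset.abs_sum_le_sum_abs _ _).trans (Finset.sum_le_sum fun i _ => ?_)
  rw [abs_mul, abs_mul, abs_of_nonneg (by positivity : (0 : ℝ) ≤ 2 ^ i.1),
    abs_of_nonneg (by positivity : 0 ≤ 8 * ‖dyadicIncr i γ‖ ^ 6)]
  calc 2 ^ i.1 * (8 * ‖dyadicIncr i γ‖ ^ 6 * |inner ℝ (dyadicIncr i γ) (dyadicIncr i h)|)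
      ≤ 2 ^ i.1 * (8 * ‖dyadicIncr i γ‖ ^ 6 * (‖dyadicIncr i γ‖ * ‖dyadicIncr i h‖)) := by
        gcongr
        exact abs_real_inner_le_norm _ _
    _ = _ := by ring

/-- Cauchy-Schwarz with weights `a i` extracts one factor `besovGrad M γ`. After exchanging the
sums, each dyadic increment of the Schauder functions contributes at most `4 M₀`, by the uniform
bound at its two endpoints, and the remaining sum of weights is the second factor. -/
theorem sum_sq_fderiv_besov_le [NeZero d] {lam : ℕ → ℝ} (hlam : ∀ n, 0 < lam (n + 1)) {M₀ : ℝ}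
    (hM : SchauderBound d lam M₀) (M : ℕ) (γ : Omega d) (N : ℕ) :
    ∑ n ∈ Finset.range N, lam (n + 1) * fderiv ℝ (besov M) γ (schauder d (n + 1)) ^ 2 ≤
      4 * M₀ * besovGrad M γ ^ 2 := by
  set a : (Σ _ : ℕ, ℕ) → ℝ := fun i => 8 * 2 ^ i.1 * ‖dyadicIncr i γ‖ ^ 7 with ha
  have ha0 : ∀ i, 0 ≤ a i := fun i => by positivity
  have hincr : ∀ i, ∑ n ∈ Finset.range N, lam (n + 1) * ‖dyadicIncr i (schauder d (n + 1))‖ ^ 2 ≤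
      4 * M₀ := by
    intro i
    have h1 := hM (dyadicPt i.1 (i.2 + 1)) N
    have h2 := hM (dyadicPt i.1 i.2) N
    calc ∑ n ∈ Finset.range N, lam (n + 1) * ‖dyadicIncr i (schauder d (n + 1))‖ ^ 2
        ≤ ∑ n ∈ Finset.range N, (2 * (lam (n + 1) * ‖S d (n + 1) (dyadicPt i.1 (i.2 + 1))‖ ^ 2) +
            2 * (lam (n + 1) * ‖S d (n + 1) (dyadicPt i.1 i.2)‖ ^ 2)) := by
          refine Finset.sum_le_sum fun n _ => ?_
          have h3 := norm_sub_le (S d (n + 1) (dyadicPt i.1 (i.2 + 1)))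
            (S d (n + 1) (dyadicPt i.1 i.2))
          have h4 : ‖dyadicIncr i (schauder d (n + 1))‖ ^ 2 ≤
              2 * ‖S d (n + 1) (dyadicPt i.1 (i.2 + 1))‖ ^ 2 +
              2 * ‖S d (n + 1) (dyadicPt i.1 i.2)‖ ^ 2 := by
            simp only [dyadicIncr, schauder_apply]
            refine (pow_le_pow_left₀ (norm_nonneg _) h3 2).trans ?_
            linarith [sq_nonneg (‖S d (n + 1) (dyadicPt i.1 (i.2 + 1))‖ -
              ‖S d (n + 1) (dyadicPt i.1 i.2)‖)]
          have := mul_le_mul_of_nonneg_left h4 (hlam n).le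
          linarith
      _ ≤ 4 * M₀ := by
          rw [Finset.sum_add_distrib, ← Finset.mul_sum, ← Finset.mul_sum]
          linarith
  calc ∑ n ∈ Finset.range N, lam (n + 1) * fderiv ℝ (besov M) γ (schauder d (n + 1)) ^ 2
      ≤ ∑ n ∈ Finset.range N, lam (n + 1) * (besovGrad M γ *
          ∑ i ∈ dyadicIdx M, a i * ‖dyadicIncr i (schauder d (n + 1))‖ ^ 2) := by
        refine Finset.sum_le_sum fun n _ => mul_le_mul_of_nonneg_left ?_ (hlam n).le
        rw [← sq_abs]
        refine (pow_le_pow_left₀ (abs_nonneg _) (abs_fderiv_besov_le M γ _) 2).trans ?_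
        exact Finset.sum_sq_le_sum_mul_sum_of_sq_le_mul _ (fun i _ => ha0 i)
          (fun i _ => mul_nonneg (ha0 i) (sq_nonneg _)) fun i _ => le_of_eq (by simp only [ha]; ring)
    _ = besovGrad M γ * ∑ i ∈ dyadicIdx M, a i *
          ∑ n ∈ Finset.range N, lam (n + 1) * ‖dyadicIncr i (schauder d (n + 1))‖ ^ 2 := by
        simp only [Finset.mul_sum]
        rw [Finset.sum_comm]
        exact Finset.sum_congr rfl fun i _ => Finset.sum_congr rfl fun n _ => by ring
    _ ≤ besovGrad M γ * ∑ i ∈ dyadicIdx M, a i * (4 * M₀) := by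
        refine mul_le_mul_of_nonneg_left ?_ (Finset.sum_nonneg fun i _ => ha0 i)
        exact Finset.sum_le_sum fun i _ => mul_le_mul_of_nonneg_left (hincr i) (ha0 i)
    _ = _ := by rw [← Finset.sum_mul]; simp only [besovGrad, ha]; ring

theorem IsWienerMeasure.integral_norm_dyadicIncr_pow (hν : IsWienerMeasure ν) {i : Σ _ : ℕ, ℕ}
    (hi : i.2 < 2 ^ i.1) (p : ℕ) : ∫ γ, ‖dyadicIncr i γ‖ ^ (2 * p) ∂ν =
      (∫ x, ‖x‖ ^ (2 * p) ∂stdGaussian (E d)) * ((1 / 2) ^ i.1) ^ p := by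
  have h1 := coe_dyadicPt hi.le
  have h2 := coe_dyadicPt (l := i.1) (k := i.2 + 1) (by omega)
  have hd : (dyadicPt i.1 (i.2 + 1) : ℝ) - dyadicPt i.1 i.2 = (1 / 2) ^ i.1 := by
    rw [h1, h2, ← sub_div, one_div, inv_pow]
    push_cast
    simp
  have hle : dyadicPt i.1 i.2 ≤ dyadicPt i.1 (i.2 + 1) := by
    rw [← Subtype.coe_le_coe, ← sub_nonneg, hd]
    positivity
  have hg := hν.gauss _ _ hle
  have hm : Measurable (dyadicIncr (d := d) i) :=
    ((continuous_eval _).sub (continuous_eval _)).measurable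
  have hc : Continuous fun x : E d => ‖x‖ ^ (2 * p) := by fun_prop
  calc ∫ γ, ‖dyadicIncr i γ‖ ^ (2 * p) ∂ν = ∫ x, ‖x‖ ^ (2 * p) ∂(ν.map (dyadicIncr i)) := by
        rw [integral_map hm.aemeasurable hc.aestronglyMeasurable]
    _ = ∫ x, ‖x‖ ^ (2 * p) ∂((stdGaussian (E d)).map
          fun x => √((1 / 2 : ℝ) ^ i.1) • x) := by
        rw [← hd]
        exact congrArg (fun μ => ∫ x, ‖x‖ ^ (2 * p) ∂μ) hg
    _ = ∫ x, ‖x‖ ^ (2 * p) * ((1 / 2) ^ i.1) ^ p ∂stdGaussian (E d) := by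
        rw [integral_map (by fun_prop) hc.aestronglyMeasurable]
        refine integral_congr_ae (ae_of_all _ fun x => ?_)
        simp only [norm_smul, mul_pow, Real.norm_eq_abs, abs_of_nonneg (Real.sqrt_nonneg _)]
        rw [pow_mul √((1 / 2 : ℝ) ^ i.1), Real.sq_sqrt (by positivity), mul_comm]
    _ = _ := integral_mul_const _ _

/-- By Brownian scaling a term of level `l` has mean `2ˡ · c 2⁻⁴ˡ = c 8⁻ˡ`, which is within the
allowance `4⁻ˡ`. -/
theorem IsWienerMeasure.exists_integral_besov_le (hν : IsWienerMeasure ν)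
    (hInt : ∀ F ∈ Z d, Integrable F ν) : ∃ B, ∀ M, ∫ γ, besov M γ ∂ν ≤ B := by
  set c := ∫ x, ‖x‖ ^ (2 * 4) ∂stdGaussian (E d) with hc
  have hc0 : 0 ≤ c := integral_nonneg fun x => by positivity
  refine ⟨2 * c, fun M => ?_⟩
  simp only [besov]
  rw [integral_finsetSum _ fun i _ => (hInt _ (norm_dyadicIncr_pow_mem_Z i 4)).const_mul _]
  calc ∑ i ∈ dyadicIdx M, ∫ γ, 2 ^ i.1 * ‖dyadicIncr i γ‖ ^ 8 ∂ν
      = ∑ i ∈ dyadicIdx M, 2 ^ i.1 * (c * ((1 / 2) ^ i.1) ^ 4) := by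
        refine Finset.sum_congr rfl fun i hi => ?_
        rw [integral_const_mul]
        congr 1
        exact hν.integral_norm_dyadicIncr_pow (mem_dyadicIdx.1 hi).2 4
    _ ≤ 2 * c := by
        refine sum_dyadicIdx_le M (a := fun l => 2 ^ l * (c * ((1 / 2) ^ l) ^ 4)) hc0 fun l => ?_
        calc (2 : ℝ) ^ l * (c * ((1 / 2) ^ l) ^ 4) = c * (2 * (1 / 2) ^ 4) ^ l := by
              rw [mul_pow, ← pow_mul, ← pow_mul, mul_comm l 4]; ring
          _ ≤ c * (1 / 4) ^ l := by gcongr; norm_num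

theorem IsWienerMeasure.exists_integral_besovGrad_le (hν : IsWienerMeasure ν)
    (hInt : ∀ F ∈ Z d, Integrable F ν) : ∃ B, ∀ M,
      Integrable (fun γ => besovGrad M γ ^ 4) ν ∧ ∫ γ, besovGrad M γ ^ 4 ∂ν ≤ B := by
  set c := ∫ x, ‖x‖ ^ (2 * 14) ∂stdGaussian (E d) with hc
  have hc0 : 0 ≤ c := integral_nonneg fun x => by positivity
  refine ⟨8 * (2 * (8 ^ 4 * c)), fun M => ?_⟩
  have hle : ∀ γ : Omega d, besovGrad M γ ^ 4 ≤ 8 * ∑ i ∈ dyadicIdx M,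
      8 ^ 4 * (2 ^ 10) ^ i.1 * ‖dyadicIncr i γ‖ ^ 28 := by
    intro γ
    -- The weights `4⁻ˡ` have total mass at most `2`. They turn the fourth power into terms `2¹⁰ˡ
    -- |Δ|²⁸`, of mean `c 2¹⁰ˡ 2⁻¹⁴ˡ = c 16⁻ˡ` up to the factor `8⁴`.
    refine (sum_pow_four_le (w := fun i => (1 / 4) ^ i.1) (dyadicIdx M)
      (fun i _ => by positivity) ?_).trans_eq ?_
    · simpa using sum_dyadicIdx_le M (a := fun l => (1 / 4) ^ l) zero_le_one fun l => by simp
    · congr 1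
      refine Finset.sum_congr rfl fun i _ => ?_
      have e1 : ((2 : ℝ) ^ 10) ^ i.1 = (2 ^ i.1) ^ 4 * (4 ^ i.1) ^ 3 := by
        rw [pow_right_comm _ i.1, pow_right_comm _ i.1, ← mul_pow]
        norm_num
      rw [e1, one_div, inv_pow, inv_pow, div_inv_eq_mul]
      ring
  have hZ : ∀ i, Integrable (fun γ : Omega d => 8 ^ 4 * (2 ^ 10) ^ i.1 * ‖dyadicIncr i γ‖ ^ 28) ν :=
    fun i => (hInt _ (norm_dyadicIncr_pow_mem_Z i 14)).const_mul _
  have hI := (integrable_finsetSum (dyadicIdx M) fun i _ => hZ i).const_mul 8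
  have h4 : ∀ γ : Omega d, 0 ≤ besovGrad M γ ^ 4 := fun γ => (by decide : Even 4).pow_nonneg _
  have hi : Integrable (fun γ => besovGrad M γ ^ 4) ν :=
    hI.mono' ((continuous_besovGrad M).pow 4).aestronglyMeasurable (ae_of_all _ fun γ => by
      rw [Real.norm_eq_abs, abs_of_nonneg (h4 γ)]; exact hle γ)
  refine ⟨hi, (integral_mono hi hI hle).trans ?_⟩
  rw [integral_const_mul, integral_finsetSum _ fun i _ => hZ i]
  refine mul_le_mul_of_nonneg_left ?_ (by norm_num)
  calc ∑ i ∈ dyadicIdx M, ∫ γ, 8 ^ 4 * (2 ^ 10) ^ i.1 * ‖dyadicIncr i γ‖ ^ 28 ∂ν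
      = ∑ i ∈ dyadicIdx M, 8 ^ 4 * (2 ^ 10) ^ i.1 * (c * ((1 / 2) ^ i.1) ^ 14) := by
        refine Finset.sum_congr rfl fun i hi => ?_
        rw [integral_const_mul]
        congr 1
        exact hν.integral_norm_dyadicIncr_pow (mem_dyadicIdx.1 hi).2 14
    _ ≤ 2 * (8 ^ 4 * c) := by
        refine sum_dyadicIdx_le M (a := fun l => 8 ^ 4 * (2 ^ 10) ^ l * (c * ((1 / 2) ^ l) ^ 14))
          (by positivity) fun l => ?_
        calc (8 : ℝ) ^ 4 * (2 ^ 10) ^ l * (c * ((1 / 2) ^ l) ^ 14)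
            = 8 ^ 4 * c * (2 ^ 10 * (1 / 2) ^ 14) ^ l := by
              rw [mul_pow, ← pow_mul (1 / 2 : ℝ), ← pow_mul (1 / 2 : ℝ), mul_comm l 14]; ring
          _ ≤ 8 ^ 4 * c * (1 / 4) ^ l := by gcongr; norm_num

/-- The functionals `besov M` are bounded, uniformly in `M`, at almost every path. -/
theorem IsWienerMeasure.ae_bddAbove_besov (hν : IsWienerMeasure ν)
    (hInt : ∀ F ∈ Z d, Integrable F ν) :
    ∀ᵐ γ ∂ν, BddAbove (Set.range fun M => besov M γ) := by
  obtain ⟨B, hB⟩ := hν.exists_integral_besov_le hInt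
  have hm : ∀ M, Measurable fun γ : Omega d => ENNReal.ofReal (besov M γ) := fun M =>
    (continuous_of_mem_Z (besov_mem_Z M)).measurable.ennreal_ofReal
  have h1 : ∫⁻ γ, ⨆ M, ENNReal.ofReal (besov M γ) ∂ν ≤ ENNReal.ofReal B := by
    rw [lintegral_iSup hm fun M N h γ => ENNReal.ofReal_le_ofReal (besov_mono γ h)]
    refine iSup_le fun M => ?_
    rw [← ofReal_integral_eq_lintegral_ofReal (hInt _ (besov_mem_Z M))
      (ae_of_all _ (besov_nonneg M))]
    exact ENNReal.ofReal_le_ofReal (hB M)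
  filter_upwards [ae_lt_top (Measurable.iSup hm) (h1.trans_lt ENNReal.ofReal_lt_top).ne] with γ hγ
  refine ⟨(⨆ M, ENNReal.ofReal (besov M γ)).toReal, ?_⟩
  rintro _ ⟨M, rfl⟩
  exact (ENNReal.ofReal_le_iff_le_toReal hγ.ne).1 (le_iSup (fun M => ENNReal.ofReal (besov M γ)) M)

/-- The level sets of the Besov functional. -/
def besovLevel (d : ℕ) (c : ℝ) : Set (Omega d) := {γ | ∀ M, besov M γ ≤ c}

theorem isClosed_besovLevel (c : ℝ) : IsClosed (besovLevel d c) := by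
  have e : besovLevel d c = ⋂ M, {γ | besov M γ ≤ c} := by ext; simp [besovLevel]
  rw [e]
  exact isClosed_iInter fun M =>
    isClosed_le (continuous_of_mem_Z (besov_mem_Z M)) continuous_const

/-- A single term of the sum bounds each increment of level `l` by a constant times `2^{-l/8}`,
which is a Hölder bound on the dyadic grid. -/
theorem isCompact_besovLevel (c : ℝ) : IsCompact (besovLevel d c) := by
  set r : ℝ := (1 / 2 : ℝ) ^ (1 / 8 : ℝ) with hr
  have hr0 : 0 ≤ r := by positivity
  have hr8 : r ^ 8 = 1 / 2 := by
    rw [hr, ← Real.rpow_natCast, ← Real.rpow_mul (by norm_num)]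
    norm_num
  have hr1 : r < 1 := Real.rpow_lt_one (by norm_num) (by norm_num) (by norm_num)
  refine isCompact_of_dyadic_bound (isClosed_besovLevel c) (R := max c 1) (by positivity) hr0 hr1
    fun γ hγ l k hk => ?_
  have h1 : 2 ^ l * ‖dyadicIncr ⟨l, k⟩ γ‖ ^ 8 ≤ c :=
    (Finset.single_le_sum (f := fun i : Σ _ : ℕ, ℕ => 2 ^ i.1 * ‖dyadicIncr i γ‖ ^ 8)
      (a := ⟨l, k⟩) (fun i _ => by positivity) (mem_dyadicIdx.2 ⟨Nat.lt_succ_self l, hk⟩)).trans (hγ (l + 1))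
  rw [dist_comm, dist_eq_norm]
  refine le_of_pow_le_pow_left₀ (n := 8) (by norm_num) (by positivity) ?_
  have hR : c ≤ (max c 1) ^ 8 := (le_max_left c 1).trans (le_self_pow₀ (le_max_right c 1) (by norm_num))
  calc ‖dyadicIncr ⟨l, k⟩ γ‖ ^ 8 = (2 ^ l * ‖dyadicIncr ⟨l, k⟩ γ‖ ^ 8) * (1 / 2) ^ l := by
        rw [one_div, inv_pow]; field_simp
    _ ≤ (max c 1) ^ 8 * (1 / 2) ^ l := by gcongr; exact h1.trans hR
    _ = _ := by rw [mul_pow, ← hr8, ← pow_mul, ← pow_mul, mul_comm l 8]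

end WienerForm

/-! ### The compact nest and quasi-regularity -/

/-- Dominated convergence in `L²`. -/
theorem tendsto_Lp_two_of_dominated {X : Type*} [MeasurableSpace X] {m : Measure X}
    {f : ℕ → Lp ℝ 2 m} {g : Lp ℝ 2 m} {b : X → ℝ} (hb : MemLp b 2 m)
    (hfb : ∀ k, ∀ᵐ x ∂m, |f k x| ≤ b x)
    (hlim : ∀ᵐ x ∂m, Tendsto (fun k => f k x) atTop (𝓝 (g x))) : Tendsto f atTop (𝓝 g) := by
  rw [tendsto_iff_norm_sub_tendsto_zero]
  have hsq : ∀ k, ‖f k - g‖ ^ 2 = ∫ x, (f k x - g x) ^ 2 ∂m := by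
    intro k
    rw [← real_inner_self_eq_norm_sq, L2.inner_def]
    refine integral_congr_ae ?_
    filter_upwards [Lp.coeFn_sub (f k) g] with x hx
    rw [hx]
    simp [pow_two]
  have hfb' : ∀ᵐ x ∂m, ∀ k, |f k x| ≤ b x := ae_all_iff.2 hfb
  have h1 : Tendsto (fun k => ∫ x, (f k x - g x) ^ 2 ∂m) atTop (𝓝 (∫ _x, (0 : ℝ) ∂m)) := by
    refine tendsto_integral_of_dominated_convergence (fun x => (2 * b x) ^ 2) (fun k => ?_)
      (hb.const_mul 2).integrable_sq (fun k => ?_) ?_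
    · exact ((Lp.aestronglyMeasurable _).sub (Lp.aestronglyMeasurable _)).pow 2
    · filter_upwards [hfb', hlim] with x hx hl
      have hg : |g x| ≤ b x := le_of_tendsto hl.abs (Eventually.of_forall hx)
      rw [Real.norm_eq_abs, abs_pow]
      refine pow_le_pow_left₀ (abs_nonneg _) ((abs_sub _ _).trans ?_) 2
      linarith [hx k]
    · filter_upwards [hlim] with x hl
      have := (hl.sub_const (g x)).pow 2
      simpa using this
  rw [integral_zero] at h1
  have h2 := h1.sqrt
  rw [Real.sqrt_zero] at h2
  refine h2.congr fun k => ?_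
  rw [← hsq, Real.sqrt_sq (norm_nonneg _)]

open scoped ContDiff in
/-- Smooth cut-off functions on the scales `j + 1` with uniformly bounded derivatives. -/
theorem exists_smooth_cutoff : ∃ (L : ℝ) (η : ℕ → ℝ → ℝ), ∀ j, (η j).HasTemperateGrowth ∧
    (∀ x, 0 ≤ η j x) ∧ (∀ x, η j x ≤ 1) ∧ (∀ x : ℝ, 0 ≤ x → x ≤ (j : ℝ) + 1 → η j x = 1) ∧
    (∀ x, 2 * ((j : ℝ) + 1) ≤ x → η j x = 0) ∧ ∀ x, |deriv (η j) x| ≤ L := by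
  let θ : ContDiffBump (0 : ℝ) := ⟨1, 2, by norm_num, by norm_num⟩
  have hθs : ContDiff ℝ ∞ θ := θ.contDiff
  have hd : Continuous (deriv θ) := hθs.continuous_deriv (by simp)
  obtain ⟨L, hL⟩ := hd.bounded_above_of_compact_support θ.hasCompactSupport.deriv
  refine ⟨L, fun j x => θ ((j + 1 : ℝ)⁻¹ * x), fun j => ?_⟩
  have hj : (0 : ℝ) < j + 1 := by positivity
  refine ⟨?_, fun x => θ.nonneg, fun x => θ.le_one, fun x h0 hx => ?_, fun x hx => ?_, fun x => ?_⟩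
  · exact (θ.hasCompactSupport.hasTemperateGrowth hθs).comp
      (ContinuousLinearMap.hasTemperateGrowth ((j + 1 : ℝ)⁻¹ • ContinuousLinearMap.id ℝ ℝ))
  · refine θ.one_of_mem_closedBall ?_
    rw [mem_closedBall_zero_iff, Real.norm_eq_abs, abs_of_nonneg (by positivity)]
    show _ ≤ (1 : ℝ)
    rw [inv_mul_le_iff₀ hj]
    linarith
  · refine θ.zero_of_le_dist ?_
    have hx0 : 0 ≤ x := le_trans (by positivity) hx
    rw [dist_zero_right, Real.norm_eq_abs, abs_of_nonneg (by positivity)]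
    show (2 : ℝ) ≤ _
    rw [le_inv_mul_iff₀ hj]
    linarith
  · have h1 : deriv (fun x => θ ((j + 1 : ℝ)⁻¹ * x)) x =
        (j + 1 : ℝ)⁻¹ * deriv θ ((j + 1 : ℝ)⁻¹ * x) := by
      simpa using deriv_comp_mul_left (j + 1 : ℝ)⁻¹ θ x
    rw [h1, abs_mul, abs_of_nonneg (by positivity)]
    have h2 : |deriv θ ((j + 1 : ℝ)⁻¹ * x)| ≤ L := hL _
    have h3 : (j + 1 : ℝ)⁻¹ ≤ 1 := inv_le_one_of_one_le₀ (by linarith [(Nat.cast_nonneg j : (0 : ℝ) ≤ j)])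
    calc _ ≤ 1 * |deriv θ ((j + 1 : ℝ)⁻¹ * x)| := by gcongr
      _ ≤ L := by rwa [one_mul]

/-- The points of a closed graph whose first component vanishes off one of the sets `K j`. -/
def supportedGraph {X Y : Type*} [MeasurableSpace X] {m : Measure X}
    [NormedAddCommGroup Y] [InnerProductSpace ℝ Y]
    (G : Submodule ℝ (Lp ℝ 2 m × Y)) (K : ℕ → Set X) : Set (Lp ℝ 2 m × Y) :=
  {p | p ∈ G ∧ ∃ j, ∀ᵐ γ ∂m, γ ∉ K j → p.1 γ = 0}

/-- Convexity keeps the convex combinations that give strong convergence within the elements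
supported on some `K j`. -/
theorem convex_supportedGraph {X Y : Type*} [MeasurableSpace X] {m : Measure X}
    [NormedAddCommGroup Y] [InnerProductSpace ℝ Y]
    (G : Submodule ℝ (Lp ℝ 2 m × Y)) {K : ℕ → Set X} (hK : Monotone K) :
    Convex ℝ (supportedGraph G K) := by
  rintro p ⟨hp, i, hi⟩ q ⟨hq, j, hj⟩ a b - - -
  refine ⟨G.add_mem (G.smul_mem a hp) (G.smul_mem b hq), max i j, ?_⟩
  filter_upwards [hi, hj, Lp.coeFn_add (a • p.1) (b • q.1), Lp.coeFn_smul a p.1,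
    Lp.coeFn_smul b q.1] with γ h1 h2 h3 h4 h5 hγ
  have e1 := h1 fun hh => hγ (hK (le_max_left i j) hh)
  have e2 := h2 fun hh => hγ (hK (le_max_right i j) hh)
  show (a • p.1 + b • q.1 : Lp ℝ 2 m) γ = 0
  rw [h3, Pi.add_apply, h4, h5, Pi.smul_apply, Pi.smul_apply, e1, e2]
  simp

namespace WienerForm

variable {d : ℕ} [NeZero d] {m : Measure (Omega d)} {lam : ℕ → ℝ}

namespace IsRegularData

theorem energy_le_iff (h : IsRegularData lam m) {F : Omega d → ℝ} (hF : F ∈ Z d) {c : ℝ} :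
    energy lam m F F ≤ c ↔ ∀ N, ∑ n ∈ Finset.range N,
      lam (n + 1) * ∫ γ, fderiv ℝ F γ (schauder d (n + 1)) ^ 2 ∂m ≤ c := by
  have hs := (h.finiteEnergy F hF).2
  simp only [cmInner_S_D hF] at hs
  have h0 : ∀ n, 0 ≤ lam (n + 1) * ∫ γ, fderiv ℝ F γ (schauder d (n + 1)) ^ 2 ∂m := fun n =>
    mul_nonneg (h.lam_pos n).le (integral_nonneg fun γ => sq_nonneg _)
  have e : energy lam m F F =
      ∑' n, lam (n + 1) * ∫ γ, fderiv ℝ F γ (schauder d (n + 1)) ^ 2 ∂m := by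
    simp only [energy, cmInner_S_D hF, pow_two]
  rw [e]
  exact ⟨fun hc N => (hs.sum_le_tsum _ fun n _ => h0 n).trans hc,
    fun hc => Real.tsum_le_of_sum_range_le h0 hc⟩

/-- The energy of a cylindrical function multiplied by a cut-off. -/
theorem energy_mul_cutoff_le [IsFiniteMeasure m] (h : IsRegularData lam m) {M₀ B L : ℝ}
    (hM₀ : 0 ≤ M₀) (hM : SchauderBound d lam M₀) {M : ℕ}
    (hI : Integrable (fun γ => besovGrad M γ ^ 4) m) (hB : ∫ γ, besovGrad M γ ^ 4 ∂m ≤ B)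
    {η : ℝ → ℝ} (hη : η.HasTemperateGrowth) (hη0 : ∀ x, 0 ≤ η x) (hη1 : ∀ x, η x ≤ 1)
    (hηL : ∀ x, |deriv η x| ≤ L) {F : Omega d → ℝ} (hF : F ∈ Z d) :
    energy lam m (fun γ => F γ * η (besov M γ)) (fun γ => F γ * η (besov M γ)) ≤
      2 * energy lam m F F + 8 * L ^ 2 * M₀ * (∫ γ, F γ ^ 4 ∂m + B) := by
  have hV := besov_mem_Z (d := d) M
  have hηV := comp_mem_Z hV hη
  have hG := mul_mem_Z hF hηV
  refine (h.energy_le_iff hG).2 fun N => ?_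
  set a : ℕ → Omega d → ℝ := fun n γ => fderiv ℝ F γ (schauder d (n + 1)) with ha
  set v : ℕ → Omega d → ℝ := fun n γ => fderiv ℝ (besov M) γ (schauder d (n + 1)) with hv
  have haZ : ∀ n, a n ∈ Z d := fun n => fderiv_mem_Z hF _
  have hvZ : ∀ n, v n ∈ Z d := fun n => fderiv_mem_Z hV _
  have hF2v : ∀ n, (fun γ => F γ ^ 2 * v n γ ^ 2) ∈ Z d := fun n =>
    mul_mem_Z (pow_mem_Z hF 2) (pow_mem_Z (hvZ n) 2)
  have hpt : ∀ n γ, fderiv ℝ (fun γ => F γ * η (besov M γ)) γ (schauder d (n + 1)) ^ 2 ≤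
      2 * a n γ ^ 2 + 2 * L ^ 2 * (F γ ^ 2 * v n γ ^ 2) := by
    intro n γ
    rw [fderiv_mul_apply_of_mem_Z hF hηV, fderiv_comp_apply_of_mem_Z hV hη]
    have h1 : (a n γ * η (besov M γ)) ^ 2 ≤ a n γ ^ 2 := by
      rw [mul_pow]
      exact mul_le_of_le_one_right (sq_nonneg _) (pow_le_one₀ (hη0 _) (hη1 _))
    have h2 : (F γ * (deriv η (besov M γ) * v n γ)) ^ 2 ≤ L ^ 2 * (F γ ^ 2 * v n γ ^ 2) := by
      have h3 : deriv η (besov M γ) ^ 2 ≤ L ^ 2 := by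
        rw [← sq_abs]; exact pow_le_pow_left₀ (abs_nonneg _) (hηL _) 2
      calc _ = deriv η (besov M γ) ^ 2 * (F γ ^ 2 * v n γ ^ 2) := by ring
        _ ≤ _ := by gcongr
    have h4 := sq_nonneg (a n γ * η (besov M γ) - F γ * (deriv η (besov M γ) * v n γ))
    calc _ = (a n γ * η (besov M γ) + F γ * (deriv η (besov M γ) * v n γ)) ^ 2 := rfl
      _ ≤ _ := by nlinarith
  have hF4 : Integrable (fun γ => F γ ^ 4) m := h.integrable _ (pow_mem_Z hF 4)
  -- The cross term `F² besovGrad²` is bounded by the sum of fourth powers; this is why fourth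
  -- moments of `besovGrad` are required.
  have hsum : ∑ n ∈ Finset.range N, lam (n + 1) * ∫ γ, F γ ^ 2 * v n γ ^ 2 ∂m ≤
      4 * M₀ * (∫ γ, F γ ^ 4 ∂m + B) := by
    calc ∑ n ∈ Finset.range N, lam (n + 1) * ∫ γ, F γ ^ 2 * v n γ ^ 2 ∂m
        = ∫ γ, ∑ n ∈ Finset.range N, lam (n + 1) * (F γ ^ 2 * v n γ ^ 2) ∂m := by
          rw [integral_finsetSum _ fun n _ => (h.integrable _ (hF2v n)).const_mul _]
          exact Finset.sum_congr rfl fun n _ => (integral_const_mul _ _).symm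
      _ ≤ ∫ γ, 4 * M₀ * (F γ ^ 4 + besovGrad M γ ^ 4) ∂m := by
          refine integral_mono
            (integrable_finsetSum _ fun n _ => (h.integrable _ (hF2v n)).const_mul _)
            ((hF4.add hI).const_mul _) fun γ => ?_
          have h1 := sum_sq_fderiv_besov_le h.lam_pos hM M γ N
          calc ∑ n ∈ Finset.range N, lam (n + 1) * (F γ ^ 2 * v n γ ^ 2)
              = F γ ^ 2 * ∑ n ∈ Finset.range N, lam (n + 1) * v n γ ^ 2 := by
                rw [Finset.mul_sum]
                exact Finset.sum_congr rfl fun n _ => by ring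
            _ ≤ F γ ^ 2 * (4 * M₀ * besovGrad M γ ^ 2) := by gcongr
            _ = 4 * M₀ * (F γ ^ 2 * besovGrad M γ ^ 2) := by ring
            _ ≤ 4 * M₀ * (F γ ^ 4 + besovGrad M γ ^ 4) := by
                gcongr
                nlinarith [sq_nonneg (F γ ^ 2 - besovGrad M γ ^ 2), sq_nonneg (F γ ^ 2),
                  sq_nonneg (besovGrad M γ ^ 2)]
      _ = 4 * M₀ * (∫ γ, F γ ^ 4 ∂m + ∫ γ, besovGrad M γ ^ 4 ∂m) := by
          rw [integral_const_mul, integral_add hF4 hI]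
      _ ≤ _ := by gcongr
  have hE := (h.energy_le_iff hF).1 le_rfl N
  calc ∑ n ∈ Finset.range N, lam (n + 1) *
        ∫ γ, fderiv ℝ (fun γ => F γ * η (besov M γ)) γ (schauder d (n + 1)) ^ 2 ∂m
      ≤ ∑ n ∈ Finset.range N, (2 * (lam (n + 1) * ∫ γ, a n γ ^ 2 ∂m) +
          2 * L ^ 2 * (lam (n + 1) * ∫ γ, F γ ^ 2 * v n γ ^ 2 ∂m)) := by
        refine Finset.sum_le_sum fun n _ => ?_
        have ia := h.integrable _ (pow_mem_Z (haZ n) 2)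
        have iv := h.integrable _ (hF2v n)
        have h1 := integral_mono (h.integrable _ (pow_mem_Z (fderiv_mem_Z hG _) 2))
          ((ia.const_mul 2).add (iv.const_mul (2 * L ^ 2))) (hpt n)
        simp only [Pi.add_apply] at h1
        rw [integral_add (ia.const_mul 2) (iv.const_mul (2 * L ^ 2)), integral_const_mul,
          integral_const_mul] at h1
        have h2 := mul_le_mul_of_nonneg_left h1 (h.lam_pos n).le
        linarith
    _ = 2 * ∑ n ∈ Finset.range N, lam (n + 1) * ∫ γ, a n γ ^ 2 ∂m +
          2 * L ^ 2 * ∑ n ∈ Finset.range N, lam (n + 1) * ∫ γ, F γ ^ 2 * v n γ ^ 2 ∂m := by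
        rw [Finset.sum_add_distrib, Finset.mul_sum, Finset.mul_sum]
    _ ≤ 2 * energy lam m F F + 2 * L ^ 2 * (4 * M₀ * (∫ γ, F γ ^ 4 ∂m + B)) := by gcongr
    _ = _ := by ring

end IsRegularData

/-- The conditions under which the level sets of the Besov functional form a nest. -/
structure IsTightData (lam : ℕ → ℝ) (m : Measure (Omega d)) : Prop extends
    IsRegularData lam m where
  bddAbove : ∀ᵐ γ ∂m, BddAbove (Set.range fun M => besov M γ)
  schauderBound : ∃ M₀, 0 ≤ M₀ ∧ SchauderBound d lam M₀
  besovGrad : ∃ B, ∀ M, Integrable (fun γ => besovGrad M γ ^ 4) m ∧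
    ∫ γ, besovGrad M γ ^ 4 ∂m ≤ B

/-- The nest of level sets of the Besov functional. -/
def besovNest (d : ℕ) (j : ℕ) : Set (Omega d) := besovLevel d (2 * ((j : ℝ) + 1))

theorem besovNest_mono (n : ℕ) : Monotone (besovNest n) := by
  intro i j hij γ hγ M
  refine (hγ M).trans ?_
  gcongr

namespace IsTightData

/-- The cylindrical `F` is cut off by `η j (besov M)`, whose energy bound depends on neither `j` nor
`M`. Two limits, each through convex combinations, first reach the cut-off by the full functional
`V` and then `F` itself. -/
theorem mem_closure_supportedGraph [IsFiniteMeasure m] (h : IsTightData lam m)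
    {p : Lp ℝ 2 m × lp (fun _ : ℕ => Lp ℝ 2 m) 2} (hp : p ∈ gradGraph lam m) :
    p ∈ closure (supportedGraph (gradGraph lam m).topologicalClosure (besovNest d)) := by
  have hr := h.toIsRegularData
  obtain ⟨M₀, hM₀, hM⟩ := h.schauderBound
  obtain ⟨B, hB⟩ := h.besovGrad
  obtain ⟨L, η, hη⟩ := exists_smooth_cutoff
  have hpG := Submodule.le_topologicalClosure _ hp
  have hGc : IsClosed ((gradGraph lam m).topologicalClosure :
      Set (Lp ℝ 2 m × lp (fun _ : ℕ => Lp ℝ 2 m) 2)) :=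
    Submodule.isClosed_topologicalClosure _
  obtain ⟨F, hF, hp1, -⟩ := hp
  set c := √(2 * energy lam m F F + 8 * L ^ 2 * M₀ * (∫ γ, F γ ^ 4 ∂m + B)) with hc
  have hFL : MemLp (fun γ => |F γ|) 2 m :=
    ((memLp_two_iff_integrable_sq (continuous_of_mem_Z hF).aestronglyMeasurable).2
      (hr.integrable _ (pow_mem_Z hF 2))).abs
  have hcut : ∀ j γ x, |F γ * η j x| ≤ |F γ| := by
    intro j γ x
    rw [abs_mul, abs_of_nonneg ((hη j).2.1 x)]
    exact mul_le_of_le_one_right (abs_nonneg _) ((hη j).2.2.1 x)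
  set V : Omega d → ℝ := fun γ => ⨆ M, besov M γ with hV
  have hVlim : ∀ᵐ γ ∂m, Tendsto (fun M => besov M γ) atTop (𝓝 (V γ)) := by
    filter_upwards [h.bddAbove] with γ hγ
    exact tendsto_atTop_ciSup (besov_mono γ) hγ
  have hVm : Measurable V := Measurable.iSup fun M =>
    (continuous_of_mem_Z (besov_mem_Z M)).measurable
  have hηc : ∀ j, Continuous (η j) := fun j => (hη j).1.1.continuous
  -- Limit `M → ∞`: `F η_j(V)` need not be cylindrical, but lower semicontinuity puts it in the
  -- domain of the closure with the same energy bound.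
  have hlimit : ∀ j, ∃ q ∈ (gradGraph lam m).topologicalClosure,
      q.1 =ᵐ[m] (fun γ => F γ * η j (V γ)) ∧ ‖q.2‖ ≤ c := by
    intro j
    have hmem : MemLp (fun γ => F γ * η j (V γ)) 2 m :=
      hFL.mono ((continuous_of_mem_Z hF).measurable.mul
        ((hηc j).measurable.comp hVm)).aestronglyMeasurable
        (ae_of_all _ fun γ => by simpa using hcut j γ (V γ))
    have hZ : ∀ M, (fun γ => F γ * η j (besov M γ)) ∈ Z d := fun M =>
      mul_mem_Z hF (comp_mem_Z (besov_mem_Z M) (hη j).1)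
    choose r hr0 hr1 hr2 using fun M => hr.exists_mem (hZ M)
    have hlim : Tendsto (fun M => (r M).1) atTop (𝓝 (hmem.toLp _)) := by
      refine tendsto_Lp_two_of_dominated hFL (fun M => ?_) ?_
      · filter_upwards [hr1 M] with γ hγ
        rw [hγ]
        exact hcut j γ _
      · filter_upwards [ae_all_iff.2 hr1, hmem.coeFn_toLp, hVlim] with γ h1 h2 h3
        rw [h2]
        simp only [h1]
        exact (((hηc j).tendsto _).comp h3).const_mul _
    obtain ⟨y, hy, hyc⟩ := exists_mem_graph_of_tendsto hGc
      (fun M => Submodule.le_topologicalClosure _ (hr0 M)) hlim (M := c) fun M => by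
        refine Real.le_sqrt_of_sq_le ?_
        rw [norm_sq_eq_energy hr.lam_pos (hZ M) (hr2 M)]
        exact hr.energy_mul_cutoff_le hM₀ hM (hB M).1 (hB M).2 (hη j).1 (hη j).2.1
          (hη j).2.2.1 (hη j).2.2.2.2.2 hF
    exact ⟨_, hy, hmem.coeFn_toLp, hyc⟩
  choose q hqG hq1 hq2 using hlimit
  have hqlim : Tendsto (fun j => (q j).1) atTop (𝓝 p.1) := by
    refine tendsto_Lp_two_of_dominated hFL (fun j => ?_) ?_
    · filter_upwards [hq1 j] with γ hγ
      rw [hγ]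
      exact hcut j γ _
    · filter_upwards [ae_all_iff.2 hq1, hp1, h.bddAbove] with γ h1 h2 h3
      rw [h2]
      simp only [h1]
      have h0 : 0 ≤ V γ := (besov_nonneg 0 γ).trans (le_ciSup h3 0)
      refine tendsto_const_nhds.congr' ?_
      obtain ⟨j₀, hj₀⟩ := exists_nat_ge (V γ)
      filter_upwards [eventually_ge_atTop j₀] with j hj
      have hj' : (j₀ : ℝ) ≤ j := by exact_mod_cast hj
      rw [(hη j).2.2.2.1 _ h0 (by linarith), mul_one]
  obtain ⟨y, s, hs, hslim, -⟩ := exists_convexHull_tendsto_of_bounded_snd hqlim hq2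
  have hsT : ∀ k, s k ∈ supportedGraph (gradGraph lam m).topologicalClosure (besovNest d) := by
    intro k
    refine convexHull_min ?_ (convex_supportedGraph _ (besovNest_mono d)) (hs k)
    rintro _ ⟨j, -, rfl⟩
    -- The cut-off `η j` vanishes beyond `2 (j + 1)`, which is the level defining `besovNest d j`.
    refine ⟨hqG j, j, ?_⟩
    filter_upwards [hq1 j, h.bddAbove] with γ h1 h2 hγ
    have hγ' : ∃ M, 2 * ((j : ℝ) + 1) < besov M γ := by
      simpa [besovNest, besovLevel] using hγ
    obtain ⟨M, hM⟩ := hγ'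
    rw [h1, (hη j).2.2.2.2.1 _ (hM.le.trans (le_ciSup h2 M)), mul_zero]
  have hy : (p.1, y) ∈ (gradGraph lam m).topologicalClosure :=
    hGc.mem_of_tendsto hslim (Eventually.of_forall fun k => (hsT k).1)
  -- The limit of the gradients is identified with the gradient of `F` by single-valuedness of the
  -- closed graph.
  have hpy : p.2 - y = 0 := hr.injective (p - (p.1, y))
    (Submodule.sub_mem _ hpG hy) (by simp)
  have hpe : p = (p.1, y) := Prod.ext rfl (sub_eq_zero.1 hpy)
  rw [hpe]
  exact mem_closure_of_tendsto hslim (Eventually.of_forall hsT)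

theorem isNest_besovNest [IsFiniteMeasure m] (h : IsTightData lam m) :
    (energyForm lam m).IsNest (besovNest d) where
  closed j := isClosed_besovLevel _
  mono := besovNest_mono d
  dense := by
    have hr := h.toIsRegularData
    refine isE1Dense_of_forall_tendsto hr.injective fun v => ?_
    have h1 : ((gradGraph lam m).topologicalClosure : Set _) ⊆
        closure (supportedGraph (gradGraph lam m).topologicalClosure (besovNest d)) :=
      closure_minimal (fun p hp => h.mem_closure_supportedGraph hp) isClosed_closure
    refine closure_mono ?_ (h1 (mk_graphValue_mem hr.injective v))
    rintro p ⟨hp, hj⟩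
    exact ⟨hp, ⟨p.1, mem_dom_formOfGraph hp⟩, hj, rfl⟩

/-- Once the compact nest is available, continuity of cylindrical functions gives quasi-continuity.
The coordinates at a countable dense set of times separate all paths, so the exceptional set is
empty. -/
theorem isQuasiRegular [IsFiniteMeasure m] (h : IsTightData lam m) :
    (energyForm lam m).IsQuasiRegular := by
  have hr := h.toIsRegularData
  have hN := h.isNest_besovNest
  have hqc : ∀ F ∈ Z d, (energyForm lam m).IsQuasiContinuous F := fun F hF =>
    ⟨besovNest d, hN, fun k => (continuous_of_mem_Z hF).continuousOn⟩
  refine ⟨⟨besovNest d, hN, fun k => isCompact_besovLevel _⟩,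
    ⟨_, hr.isE1Dense_Z, fun u ⟨F, hF, hu⟩ => ⟨F, hqc F hF, hu⟩⟩, ?_⟩
  set f : ℕ → Omega d → ℝ := fun n γ => inner ℝ
    (EuclideanSpace.single (Fin.ofNat d n.unpair.2) (1 : ℝ))
    (γ.1 (TopologicalSpace.denseSeq unitInterval n.unpair.1)) with hf
  have hfZ : ∀ n, f n ∈ Z d := fun n => inner_eval_mem_Z _ _
  choose u hu using fun n => hr.isClosureOf.mem_dom (f n) (hfZ n)
  refine ⟨u, f, ∅, ⟨besovNest d, hN, Set.empty_subset _⟩, fun n => ⟨hqc _ (hfZ n), hu n⟩, ?_⟩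
  intro x _ y _ hxy
  by_contra! hcon
  refine hxy (Subtype.ext (ContinuousMap.ext fun t => ?_))
  refine congrFun (Continuous.ext_on (TopologicalSpace.denseRange_denseSeq unitInterval)
    x.1.continuous y.1.continuous ?_) t
  rintro _ ⟨k, rfl⟩
  ext i
  have hk := hcon (Nat.pair k i)
  have hi : Fin.ofNat d (i : ℕ) = i := Fin.ofNat_val_eq_self i
  simpa [hf, hi, EuclideanSpace.inner_single_left] using hk

end IsTightData

end WienerForm

end

theorem mainTheorem2 (d : ℕ) [NeZero d]
    (ν : Measure (WienerForm.Omega d)) (hν : WienerForm.IsWienerMeasure ν)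
    (φ : WienerForm.Omega d → ℝ) (hφ_meas : AEMeasurable φ ν)
    (C : ℝ) (hφ : ∀ᵐ γ ∂ν, 0 < φ γ ∧ φ γ ≤ C)
    (hφ_int : ∀ F ∈ WienerForm.Z d, Integrable (fun γ => F γ / φ γ) ν)
    (lam : ℕ → ℝ) (hlam_pos : ∀ n, 1 ≤ n → 0 < lam n)
    (hlam_mono : ∀ k n, 1 ≤ k → k ≤ n → lam k ≤ lam n)
    (c : ℕ → ℕ) (hc_zero : c 0 = 0) (hc_digit : ∀ q, c q ≤ 1)
    (hlam_sum : ∀ j, 1 ≤ j → j ≤ d →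
      Summable fun p : ℕ => lam (WienerForm.idx d c (p + 1) j) / 2 ^ (p + 1)) :
    (∀ F ∈ WienerForm.Z d, WienerForm.FiniteEnergy lam (WienerForm.weighted ν φ) F) ∧
    DirForm.IsClosable (WienerForm.weighted ν φ) (WienerForm.Z d)
      (WienerForm.energy lam (WienerForm.weighted ν φ)) ∧
    ∃ ℰ : DirForm.SymmForm (WienerForm.weighted ν φ),
      ℰ.IsClosureOf (WienerForm.Z d) (WienerForm.energy lam (WienerForm.weighted ν φ)) ∧
      ℰ.IsDirichletForm ∧ ℰ.IsQuasiRegular := by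
  have := hν.prob
  have hw : WienerForm.IsAdmissibleWeight ν φ C := ⟨hφ_meas, hφ, hφ_int⟩
  have := hw.isFiniteMeasure_weighted
  obtain ⟨M₀, hM₀, hM⟩ := WienerForm.exists_sum_norm_sq_S_le hlam_pos hlam_mono
    (hlam_sum 1 le_rfl (NeZero.pos d))
  have hlam : ∀ n, 0 < lam (n + 1) := fun n => hlam_pos _ (Nat.le_add_left 1 n)
  have hInt : ∀ F ∈ WienerForm.Z d, Integrable F ν := fun F hF => hw.integrable hF
  have hintw : ∀ F ∈ WienerForm.Z d, Integrable F (WienerForm.weighted ν φ) := fun F hF =>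
    hw.integrable_weighted (hInt F hF)
  obtain ⟨B, hB⟩ := hν.exists_integral_besovGrad_le hInt
  have h : WienerForm.IsTightData lam (WienerForm.weighted ν φ) :=
    { lam_pos := hlam
      integrable := hintw
      finiteEnergy := fun F hF => WienerForm.finiteEnergy_of_mem_Z hlam hM hintw hF
      injective := fun p hp h1 => WienerForm.snd_eq_zero_of_mem_closure_gradGraph hν hw hp h1
      bddAbove := hw.ae_weighted_iff.2 (hν.ae_bddAbove_besov hInt)
      schauderBound := ⟨M₀, hM₀, hM⟩
      besovGrad := ⟨|C| * B, fun M => ⟨hw.integrable_weighted (hB M).1,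
        (hw.integral_weighted_le (hB M).1 fun γ => (by decide : Even 4).pow_nonneg _).trans
          (mul_le_mul_of_nonneg_left (hB M).2 (abs_nonneg C))⟩⟩ }
  exact ⟨h.finiteEnergy, h.toIsRegularData.isClosable, WienerForm.energyForm lam _,
    h.toIsRegularData.isClosureOf, h.toIsRegularData.isDirichletForm, h.isQuasiRegular⟩
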